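/- Throughout, $k$ is a commutative ring with $1$, $\mathbb N=\{0,1,2,\dots\}$, and $\otimes=\otimes_k$. **Definitions.** Let $L$ be a $k$-module with $k$-linear maps $[\,,]:L\otimes L\to L$ and $S,\langle\,,\rangle:L\otimes L\to L\otimes L$. Its enveloping algebra $U(L)$ is the quotient of the tensor algebra $L^{\otimes}$ by the two-sided ideal generated by all $x\otimes y-S(x\otimes y)-\langle x,y\rangle-[x,y]$; write $\pi:L^\otimes\to U(L)$ for the projection. The $q$-symmetric algebra $\mathcal S(L)$ is the quotient of $L^{\otimes}$ by the ideal generated by all $x\otimes y-S(x\otimes y)$; the image of $x\in L$ in it is denoted $z_x$. $L$ is a *basic $T$-Lie algebra* if it has a grading $L=\bigoplus_{\eta\in\mathbb N}L_\eta$ and a totally ordered basis $\mathcal B$ of homogeneous elements such that: (i) $[L_a,L_b]\subseteq\sum_{c<a+b}L_c$ (for instance $[L_a,L_b]\subseteq L_{a+b-1}$) and $\langle L_a,L_b\rangle\subseteq\sum_{c+d<a+b}L_c\otimes L_d$; (ii) $[\,,]S=-[\,,]$, $\langle\,,\rangle S=-\langle\,,\rangle$, $[\,,]\langle\,,\rangle=0$,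 and $[x,x]=0$, $\langle x,x\rangle=0$ for $x\in\mathcal B$; (iii) $S(x\otimes y)=q_{x,y}\,y\otimes x$ for $x,y\in\mathcal B$, with $q_{x,y}\in k$, $q_{x,y}q_{y,x}=1$, $q_{x,x}=1$; (iv) (multiplicativity) $S([x,y]\otimes z)=q_{x,z}q_{y,z}\,z\otimes[x,y]$ and $S(x\otimes[y,z])=q_{x,y}q_{x,z}\,[y,z]\otimes x$ for $x<y<z$ in $\mathcal B$; (v) (Jacobi) $[x,[y,z]]-[[x,y],z]-q_{x,y}[y,[x,z]]=0$ for $x>y>z$ in $\mathcal B$. For a finite non-decreasing sequence $\Sigma=(x_1,\dots,x_u)$ in $\mathcal B$ put $z_\Sigma=z_{x_1}\cdots z_{x_u}\in\mathcal S(L)$ and $\eta(\Sigma)=\sum\eta(x_i)$, where $\eta(x)$ is the degree of $x\in\mathcal B$; $x\le\Sigma$ means that $x\le x_i$ for all $i$. Let $L\otimes\mathcal S(L)\to\mathcal S(L)$, $x\otimes w\mapsto x\cdot w$, be the linear map determined recursively by: $x\cdot z_\Sigma=z_xz_\Sigma$ if $x\le\Sigma$; $x\cdot(z_yz_\Sigma)=q_{x,y}\,y\cdot(x\cdot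 z_\Sigma)+\langle x,y\rangle\cdot z_\Sigma+[x,y]\cdot z_\Sigma$ if $y<x$ and $y\le\Sigma$; and $x\cdot z_\Sigma-z_xz_\Sigma$ lies in the span of the $z_{\Sigma'}$ with $\eta(\Sigma')<\eta(x)+\eta(\Sigma)$ (here $x,y\in\mathcal B$, and tensors act by $(u\otimes v)\cdot w=u\cdot(v\cdot w)$). The basic $T$-Lie algebra $L$ is *adequate* if for all $x>y>z$ in $\mathcal B$ and all non-decreasing $\Sigma$ with $z\le\Sigma$ the element $$\langle x,[y,z]\rangle-\langle[x,y],z\rangle-\bigl(q_{x,y}\,y\otimes[x,z]-q_{y,z}[x,z]\otimes y-q_{x,y}[y,[x,z]]\bigr)+\bigl(x\otimes\langle y,z\rangle-q_{x,y}q_{x,z}\langle y,z\rangle\otimes x\bigr)$$ $$-\bigl(q_{x,y}\,y\otimes\langle x,z\rangle-q_{y,z}\langle x,z\rangle\otimes y\bigr)+\bigl(q_{x,z}q_{y,z}\,z\otimes\langle x,y\rangle-\langle x,y\rangle\otimes z\bigr)$$ of $L^\otimes$ annihilates $z_\Sigma$. Let $U_m=\pi\bigl(\sum L_{\eta_1}\otimes\cdots\otimes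 L_{\eta_r}\bigr)$, the sum over $r\ge0$ and $\eta_1+\dots+\eta_r\le m$, let $U_{-1}=0$, and let $G=\bigoplus_{m\ge0}U_m/U_{m-1}$ be the associated graded algebra of $U(L)$. **Statement.** 1. If $L$ is an adequate basic $T$-Lie algebra, then $\mathcal S(L)\cong G$ as $k$-algebras, by an isomorphism that sends $z_x$, for $x\in L_m$, to the class of $\pi(x)$ in $U_m/U_{m-1}$. 2. If moreover $k$ is an integral domain, then $U(L)$ is nonzero and has no nonzero zero divisors. 3. Let $k$ be an integral domain. (a) Let $q\in k^\times$, $n\ge0$, and let $(sl_{n+1}^+)_q$ be the free $k$-module on the matrix units $e_{ij}$, $1\le i<j\le n+1$, ordered by $e_{ab}<e_{ij}$ iff $a+b<i+j$, or $a+b=i+j$ and $b<j$. Let $c_{ab,ij}\in\mathbb Z$ be given by $[[e_{ab},e_{ab}^t],e_{ij}]=c_{ab,ij}e_{ij}$. For $e_{ab}<e_{ij}$ put $S(e_{ab}\otimes e_{ij})=q^{c_{ab,ij}}e_{ij}\otimes e_{ab}$, let $[e_{ab},e_{ij}]_q$ be the matrix commutator, and let $\langle e_{ab},e_{ij}\rangle=(q-q^{-1})e_{ib}\otimes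 e_{aj}$ if $a<i<b<j$ and $0$ otherwise; extend to all pairs by $S(e_{ab}\otimes e_{ab})=e_{ab}\otimes e_{ab}$, $S^2=1$, $[\,,]_qS=-[\,,]_q$, $\langle\,,\rangle S=-\langle\,,\rangle$, with $[e_{ab},e_{ab}]_q=0$ and $\langle e_{ab},e_{ab}\rangle=0$. Then $U((sl_{n+1}^+)_q)$ is nonzero and has no nonzero zero divisors. (b) Let $n\ge0$, $u\in k^\times$, and for $1\le i<j\le n$ let $p_{ij},q_{ij}\in k^\times$ and $\varepsilon_{ij}\in\{1,-1\}$ be such that $p_{ij}q_{ij}=u^{\varepsilon_{ij}}$, and such that $\varepsilon_{ij}=\varepsilon_{jl}$ implies $\varepsilon_{il}=\varepsilon_{ij}$ for $i<j<l$. Let $M_{p,q,\varepsilon}(n)$, the multiparametric deformation of $GL(n)$, be the $k$-algebra with generators $Z_i^l$ ($1\le i,l\le n$) and the relations, for $i<j$ and $l<m$, $$Z_r^lZ_r^m=p_{lm}Z_r^mZ_r^l\ (1\le r\le n),\qquad Z_i^rZ_j^r=q_{ij}Z_j^rZ_i^r\ (1\le r\le n),$$ $$\text{if }\varepsilon_{ij}=\varepsilon_{lm}:\quad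 Z_i^mZ_j^l=q_{lm}p_{ij}^{-1}Z_j^lZ_i^m,\quad Z_i^lZ_j^m=q_{ij}q_{lm}^{-1}Z_j^mZ_i^l+(q_{ij}-p_{ij}^{-1})Z_j^lZ_i^m,$$ $$\text{if }\varepsilon_{ij}\ne\varepsilon_{lm}:\quad Z_i^lZ_j^m=p_{ij}^{-1}q_{lm}^{-1}Z_j^mZ_i^l,\quad Z_i^mZ_j^l=p_{ij}^{-1}p_{lm}^{-1}Z_j^lZ_i^m+(q_{ij}-p_{ij}^{-1})Z_j^mZ_i^l.$$ Then $M_{p,q,\varepsilon}(n)$ is nonzero and has no nonzero zero divisors. -/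

import Mathlib

open scoped TensorProduct DirectSum

noncomputable section

/-! ### Filtered algebras and their associated graded algebras -/

/-- An increasing filtration `F 0 ⊆ F 1 ⊆ …` of a `k`-algebra by submodules, with `1 ∈ F 0` and
`F m * F n ⊆ F (m + n)`. -/
structure AlgFiltration (k A : Type*) [CommRing k] [Ring A] [Algebra k A] where
  F : ℕ → Submodule k A
  mono : Monotone F
  one_mem : (1 : A) ∈ F 0
  mul_mem : ∀ {m n : ℕ} {a b : A}, a ∈ F m → b ∈ F n → a * b ∈ F (m + n)

namespace AlgFiltration

variable {k A : Type*} [CommRing k] [Ring A] [Algebra k A] (E : AlgFiltration k A)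

/-- The previous step of the filtration, where `F (-1) = 0`. -/
def prev : ℕ → Submodule k A
  | 0 => ⊥
  | m + 1 => E.F m

/-- The graded component `G^m = F m / F (m - 1)`. -/
abbrev Gr (m : ℕ) : Type _ := E.F m ⧸ (E.prev m).submoduleOf (E.F m)

/-- The class in `G^m` of an element of `F m`. -/
def cls {m : ℕ} (a : A) (ha : a ∈ E.F m) : E.Gr m := Submodule.Quotient.mk ⟨a, ha⟩

theorem prev_mul_mem {m n : ℕ} {a b : A} (ha : a ∈ E.prev m) (hb : b ∈ E.F n) :
    a * b ∈ E.prev (m + n) := by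
  cases m with
  | zero =>
    have : a = 0 := by simpa [prev] using ha
    simp [this]
  | succ m =>
    rw [show m + 1 + n = (m + n) + 1 by omega]
    exact E.mul_mem ha hb

theorem mul_prev_mem {m n : ℕ} {a b : A} (ha : a ∈ E.F m) (hb : b ∈ E.prev n) :
    a * b ∈ E.prev (m + n) := by
  cases n with
  | zero =>
    have : b = 0 := by simpa [prev] using hb
    simp [this]
  | succ n => exact E.mul_mem ha hb

/-- Multiplication `F m × F n → F (m + n)`. -/
def mulF (m n : ℕ) : E.F m →ₗ[k] E.F n →ₗ[k] E.F (m + n) :=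
  LinearMap.mk₂ k (fun a b => ⟨(a : A) * b, E.mul_mem a.2 b.2⟩)
    (fun a a' b => Subtype.ext (add_mul (a : A) a' b))
    (fun c a b => Subtype.ext (smul_mul_assoc c (a : A) b))
    (fun a b b' => Subtype.ext (mul_add (a : A) b b'))
    (fun c a b => Subtype.ext (mul_smul_comm c (a : A) b))

/-- The multiplication `G^m × G^n → G^(m+n)` induced by that of the algebra. -/
def mulGr (m n : ℕ) : E.Gr m →ₗ[k] E.Gr n →ₗ[k] E.Gr (m + n) :=
  Submodule.liftQ _
    (LinearMap.flip
      (Submodule.liftQ _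
        (LinearMap.flip ((E.mulF m n).compr₂ (Submodule.mkQ _)))
        (by
          intro b hb
          rw [LinearMap.mem_ker]
          ext a
          exact (Submodule.Quotient.mk_eq_zero _).2 (E.mul_prev_mem a.2 hb))))
    (by
      intro a ha
      rw [LinearMap.mem_ker]
      ext b
      exact (Submodule.Quotient.mk_eq_zero _).2 (E.prev_mul_mem ha b.2))

theorem mulGr_cls {m n : ℕ} (a b : A) (ha : a ∈ E.F m) (hb : b ∈ E.F n) :
    E.mulGr m n (E.cls a ha) (E.cls b hb) = E.cls (a * b) (E.mul_mem ha hb) := rfl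

theorem exists_cls {m : ℕ} (x : E.Gr m) : ∃ (a : A) (ha : a ∈ E.F m), E.cls a ha = x := by
  obtain ⟨⟨a, ha⟩, rfl⟩ := Submodule.Quotient.mk_surjective _ x
  exact ⟨a, ha, rfl⟩

theorem mk_cls_congr {m n : ℕ} (h : m = n) {a b : A} (hab : a = b) (ha : a ∈ E.F m)
    (hb : b ∈ E.F n) : GradedMonoid.mk (A := E.Gr) m (E.cls a ha) = .mk n (E.cls b hb) := by
  subst h
  subst hab
  rfl

instance gOne : GradedMonoid.GOne E.Gr where
  one := E.cls 1 E.one_mem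

instance gMul : GradedMonoid.GMul E.Gr where
  mul {m n} x y := E.mulGr m n x y

instance gMonoid : GradedMonoid.GMonoid E.Gr where
  one_mul := by
    rintro ⟨m, x⟩
    obtain ⟨a, ha, rfl⟩ := E.exists_cls x
    exact E.mk_cls_congr (zero_add m) (one_mul a) (E.mul_mem E.one_mem ha) ha
  mul_one := by
    rintro ⟨m, x⟩
    obtain ⟨a, ha, rfl⟩ := E.exists_cls x
    exact E.mk_cls_congr (add_zero m) (mul_one a) (E.mul_mem ha E.one_mem) ha
  mul_assoc := by
    rintro ⟨m, x⟩ ⟨n, y⟩ ⟨p, z⟩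
    obtain ⟨a, ha, rfl⟩ := E.exists_cls x
    obtain ⟨b, hb, rfl⟩ := E.exists_cls y
    obtain ⟨c, hc, rfl⟩ := E.exists_cls z
    exact E.mk_cls_congr (add_assoc m n p) (mul_assoc a b c)
      (E.mul_mem (E.mul_mem ha hb) hc) (E.mul_mem ha (E.mul_mem hb hc))

instance gSemiring : DirectSum.GSemiring E.Gr where
  __ := E.gMonoid
  mul_zero {m n} x := map_zero (E.mulGr m n x)
  zero_mul {m n} x := LinearMap.map_zero₂ (E.mulGr m n) x
  mul_add {m n} x y z := map_add (E.mulGr m n x) y z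
  add_mul {m n} x y z := LinearMap.map_add₂ (E.mulGr m n) x y z
  natCast r := r • E.cls 1 E.one_mem
  natCast_zero := zero_smul _ _
  natCast_succ r := by rw [add_smul, one_smul]; rfl

instance gRing : DirectSum.GRing E.Gr where
  intCast r := r • E.cls 1 E.one_mem
  intCast_ofNat _ := natCast_zsmul _ _
  intCast_negSucc_ofNat _ := negSucc_zsmul _ _

theorem algebraMap_mem (r : k) : algebraMap k A r ∈ E.F 0 := by
  rw [Algebra.algebraMap_eq_smul_one]
  exact (E.F 0).smul_mem r E.one_mem

instance gAlgebra : DirectSum.GAlgebra k E.Gr where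
  toFun :=
    { toFun := fun r => E.cls (algebraMap k A r) (E.algebraMap_mem r)
      map_zero' := (Submodule.Quotient.mk_eq_zero _).2 (by
        rw [Submodule.submoduleOf, Submodule.mem_comap]
        exact (map_zero (algebraMap k A)))
      map_add' := fun r s => by
        rw [cls, cls, cls, ← Submodule.Quotient.mk_add]
        congr 1
        exact Subtype.ext (map_add (algebraMap k A) r s) }
  map_one := by
    change E.cls _ _ = E.cls _ _
    simp only [map_one]
  map_mul r s := E.mk_cls_congr (add_zero 0).symm (map_mul (algebraMap k A) r s) _ _
  commutes := by
    rintro r ⟨m, x⟩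
    obtain ⟨a, ha, rfl⟩ := E.exists_cls x
    exact E.mk_cls_congr (by omega) (Algebra.commutes r a)
      (E.mul_mem (E.algebraMap_mem r) ha) (E.mul_mem ha (E.algebraMap_mem r))
  smul_def := by
    rintro r ⟨m, x⟩
    obtain ⟨a, ha, rfl⟩ := E.exists_cls x
    exact E.mk_cls_congr (zero_add m).symm (Algebra.smul_def r a)
      ((E.F m).smul_mem r ha) (E.mul_mem (E.algebraMap_mem r) ha)

/-- The associated graded algebra `G = ⨁ G^m`. -/
abbrev AssocGraded : Type _ := ⨁ m : ℕ, E.Gr m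

end AlgFiltration

/-! ### `T`-Lie algebras -/

/-- The operations of a `T`-Lie algebra on a `k`-module `L`. -/
structure TLieData (k L : Type*) [CommRing k] [AddCommGroup L] [Module k L] where
  /-- the bracket `[ , ]` -/
  bracket : L ⊗[k] L →ₗ[k] L
  /-- the presymmetry `S` -/
  presym : L ⊗[k] L →ₗ[k] L ⊗[k] L
  /-- the pseudobracket `⟨ , ⟩` -/
  pseudo : L ⊗[k] L →ₗ[k] L ⊗[k] L

namespace TLieData

variable {k L : Type*} [CommRing k] [AddCommGroup L] [Module k L]

/-- The inclusion `L ⊗ L → L^⊗` into the tensor algebra, `x ⊗ y ↦ x y`. -/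
def tensorTwo (k L : Type*) [CommRing k] [AddCommGroup L] [Module k L] :
    L ⊗[k] L →ₗ[k] TensorAlgebra k L :=
  TensorProduct.lift
    ((LinearMap.mul k (TensorAlgebra k L)).compl₁₂ (TensorAlgebra.ι k) (TensorAlgebra.ι k))

/-- The defining relations `x ⊗ y = S (x ⊗ y) + ⟨x, y⟩ + [x, y]` of `U(L)`. -/
inductive Rel (D : TLieData k L) : TensorAlgebra k L → TensorAlgebra k L → Prop
  | mk (x y : L) : Rel D (tensorTwo k L (x ⊗ₜ y))
      (tensorTwo k L (D.presym (x ⊗ₜ y)) + tensorTwo k L (D.pseudo (x ⊗ₜ y)) +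
        TensorAlgebra.ι k (D.bracket (x ⊗ₜ y)))

/-- The universal enveloping algebra `U(L)`: the quotient of the tensor algebra by the two-sided
ideal generated by all `x ⊗ y - S (x ⊗ y) - ⟨x, y⟩ - [x, y]`. -/
def Env (D : TLieData k L) : Type _ := RingQuot (Rel D)

instance (D : TLieData k L) : Ring D.Env := inferInstanceAs (Ring (RingQuot (Rel D)))

instance (D : TLieData k L) : Algebra k D.Env := inferInstanceAs (Algebra k (RingQuot (Rel D)))

/-- The natural projection `π : L^⊗ → U(L)`. -/
def proj (D : TLieData k L) : TensorAlgebra k L →ₐ[k] D.Env := RingQuot.mkAlgHom k (Rel D)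

/-- The canonical map `L → U(L)`. -/
def envι (D : TLieData k L) : L →ₗ[k] D.Env := D.proj.toLinearMap ∘ₗ TensorAlgebra.ι k

/-- The abelian `T`-Lie algebra `L⁰`: same module and presymmetry, zero bracket and
pseudobracket. -/
def abelian (D : TLieData k L) : TLieData k L where
  bracket := 0
  presym := D.presym
  pseudo := 0

/-- The `q`-symmetric algebra `𝒮(L) = U(L⁰)`. -/
abbrev QSym (D : TLieData k L) : Type _ := D.abelian.Env

/-! #### Axioms -/

/-- The submodule `M ⊗ N ⊆ L ⊗ L`. -/
def tensorSub (M N : Submodule k L) : Submodule k (L ⊗[k] L) :=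
  LinearMap.range (TensorProduct.map M.subtype N.subtype)

/-- Stability with respect to a family `gr` of submodules of `L`:
`L = ⨁ L_η`, `[L_a, L_b] ⊆ L_(a+b-1)` and `⟨L_a, L_b⟩ ⊆ ∑_(c+d ≤ a+b-1) L_c ⊗ L_d`
(there are no components of negative degree, so the right-hand sides are `0` if `a = b = 0`). -/
structure IsStable (D : TLieData k L) (gr : ℕ → Submodule k L) : Prop where
  isInternal : DirectSum.IsInternal gr
  bracket_mem : ∀ (a b : ℕ), ∀ x ∈ gr a, ∀ y ∈ gr b,
    D.bracket (x ⊗ₜ y) ∈ ⨆ (c : ℕ) (_ : c + 1 = a + b), gr c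
  pseudo_mem : ∀ (a b : ℕ), ∀ x ∈ gr a, ∀ y ∈ gr b,
    D.pseudo (x ⊗ₜ y) ∈ ⨆ (c : ℕ) (d : ℕ) (_ : c + d + 1 ≤ a + b), tensorSub (gr c) (gr d)

/-- Antisymmetry: `[ , ] S = -[ , ]`, `⟨ , ⟩ S = -⟨ , ⟩`, `[ , ] ⟨ , ⟩ = 0`. -/
structure IsAntisymm (D : TLieData k L) : Prop where
  bracket_presym : D.bracket ∘ₗ D.presym = -D.bracket
  pseudo_presym : D.pseudo ∘ₗ D.presym = -D.pseudo
  bracket_pseudo : D.bracket ∘ₗ D.pseudo = 0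

/-- A `T`-Lie algebra with strict gradation `gr`. -/
structure IsTLie (D : TLieData k L) (gr : ℕ → Submodule k L) : Prop
    extends D.IsStable gr, D.IsAntisymm where
  /-- `[ , ](1 ⊗ [ , ]) - [ , ]([ , ] ⊗ 1) - [ , ](1 ⊗ [ , ])(S ⊗ 1) = 0` on `L ⊗ L ⊗ L` -/
  jacobi : D.bracket ∘ₗ D.bracket.lTensor L
      - D.bracket ∘ₗ D.bracket.rTensor L ∘ₗ (TensorProduct.assoc k L L L).symm.toLinearMap
      - D.bracket ∘ₗ D.bracket.lTensor L ∘ₗ (TensorProduct.assoc k L L L).toLinearMap ∘ₗ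
          D.presym.rTensor L ∘ₗ (TensorProduct.assoc k L L L).symm.toLinearMap = 0

/-- Stability in the filtered sense, where `[L_a, L_b] ⊆ ∑_(c ≤ a+b-1) L_c` is enough. -/
structure IsFilStable (D : TLieData k L) (gr : ℕ → Submodule k L) : Prop where
  isInternal : DirectSum.IsInternal gr
  bracket_mem : ∀ (a b : ℕ), ∀ x ∈ gr a, ∀ y ∈ gr b,
    D.bracket (x ⊗ₜ y) ∈ ⨆ (c : ℕ) (_ : c + 1 ≤ a + b), gr c
  pseudo_mem : ∀ (a b : ℕ), ∀ x ∈ gr a, ∀ y ∈ gr b,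
    D.pseudo (x ⊗ₜ y) ∈ ⨆ (c : ℕ) (d : ℕ) (_ : c + d + 1 ≤ a + b), tensorSub (gr c) (gr d)

theorem IsStable.isFilStable {D : TLieData k L} {gr : ℕ → Submodule k L} (h : D.IsStable gr) :
    D.IsFilStable gr where
  isInternal := h.isInternal
  bracket_mem a b x hx y hy := by
    refine (iSup₂_le fun c hc => ?_ : _ ≤ ⨆ (c : ℕ) (_ : c + 1 ≤ a + b), gr c)
      (h.bracket_mem a b x hx y hy)
    exact le_iSup₂_of_le (f := fun (c : ℕ) (_ : c + 1 ≤ a + b) => gr c) c (Nat.le_of_eq hc) le_rfl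
  pseudo_mem := h.pseudo_mem

/-- A basic `T`-Lie algebra, with gradation `gr`, totally ordered homogeneous basis `b` (where
`b i` has degree `deg i`) and structure constants `q` of the presymmetry. Stability in the
filtered sense and the Jacobi identity on decreasing triples of the basis are enough; both hold in
every `T`-Lie algebra, see `IsTLie.isBasic`. -/
structure IsBasic {ι : Type*} [LinearOrder ι] (D : TLieData k L) (gr : ℕ → Submodule k L)
    (b : Module.Basis ι k L) (deg : ι → ℕ) (q : ι → ι → k) : Prop
    extends D.IsFilStable gr, D.IsAntisymm where
  homogeneous : ∀ i, b i ∈ gr (deg i)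
  presym_basis : ∀ i j, D.presym (b i ⊗ₜ b j) = q i j • (b j ⊗ₜ b i)
  q_mul : ∀ i j, q i j * q j i = 1
  q_self : ∀ i, q i i = 1
  /-- automatic from antisymmetry if `2` is invertible -/
  bracket_self : ∀ i, D.bracket (b i ⊗ₜ b i) = 0
  /-- automatic from antisymmetry if `2` is invertible -/
  pseudo_self : ∀ i, D.pseudo (b i ⊗ₜ b i) = 0
  /-- multiplicativity: `S ([x, y] ⊗ z) = q_(x,z) q_(y,z) z ⊗ [x, y]` for `x < y < z` -/
  mult_left : ∀ i j l, i < j → j < l →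
    D.presym (D.bracket (b i ⊗ₜ b j) ⊗ₜ b l) =
      (q i l * q j l) • (b l ⊗ₜ D.bracket (b i ⊗ₜ b j))
  /-- multiplicativity: `S (x ⊗ [y, z]) = q_(x,y) q_(x,z) [y, z] ⊗ x` for `x < y < z` -/
  mult_right : ∀ i j l, i < j → j < l →
    D.presym (b i ⊗ₜ D.bracket (b j ⊗ₜ b l)) =
      (q i j * q i l) • (D.bracket (b j ⊗ₜ b l) ⊗ₜ b i)
  /-- `[x, [y, z]] - [[x, y], z] - q_(x,y) [y, [x, z]] = 0` for `x > y > z` -/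
  jacobi : ∀ i j l, l < j → j < i →
    D.bracket (b i ⊗ₜ D.bracket (b j ⊗ₜ b l)) - D.bracket (D.bracket (b i ⊗ₜ b j) ⊗ₜ b l)
      - q i j • D.bracket (b j ⊗ₜ D.bracket (b i ⊗ₜ b l)) = 0

/-- A `T`-Lie algebra with a totally ordered homogeneous basis on which the presymmetry is diagonal
and multiplicative is basic. -/
theorem IsTLie.isBasic {ι : Type*} [LinearOrder ι] {D : TLieData k L} {gr : ℕ → Submodule k L}
    (h : D.IsTLie gr) (b : Module.Basis ι k L) (deg : ι → ℕ) (q : ι → ι → k)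
    (hdeg : ∀ i, b i ∈ gr (deg i))
    (hS : ∀ i j, D.presym (b i ⊗ₜ b j) = q i j • (b j ⊗ₜ b i))
    (hq : ∀ i j, q i j * q j i = 1) (hqs : ∀ i, q i i = 1)
    (hb : ∀ i, D.bracket (b i ⊗ₜ b i) = 0) (hp : ∀ i, D.pseudo (b i ⊗ₜ b i) = 0)
    (hl : ∀ i j l, i < j → j < l → D.presym (D.bracket (b i ⊗ₜ b j) ⊗ₜ b l) =
      (q i l * q j l) • (b l ⊗ₜ D.bracket (b i ⊗ₜ b j)))
    (hr : ∀ i j l, i < j → j < l → D.presym (b i ⊗ₜ D.bracket (b j ⊗ₜ b l)) =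
      (q i j * q i l) • (D.bracket (b j ⊗ₜ b l) ⊗ₜ b i)) :
    D.IsBasic gr b deg q where
  toIsFilStable := h.toIsStable.isFilStable
  toIsAntisymm := h.toIsAntisymm
  homogeneous := hdeg
  presym_basis := hS
  q_mul := hq
  q_self := hqs
  bracket_self := hb
  pseudo_self := hp
  mult_left := hl
  mult_right := hr
  jacobi i j l _ _ := by
    have := LinearMap.congr_fun h.jacobi (b i ⊗ₜ (b j ⊗ₜ b l))
    simpa [hS, ← TensorProduct.smul_tmul'] using this

/-! #### Adequateness -/

variable {ι : Type*} [LinearOrder ι]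

/-- `z_Σ = z_(i₁) ⋯ z_(iᵤ)` in `𝒮(L)`, for `Σ = (i₁, …, iᵤ)`. -/
def word (D : TLieData k L) (b : Module.Basis ι k L) (s : List ι) : D.QSym :=
  (s.map fun i => D.abelian.envι (b i)).prod

/-- The span in `𝒮(L)` of the `z_Σ`, `Σ` non-decreasing, of degree `η(Σ) < p`. -/
def symLT (D : TLieData k L) (b : Module.Basis ι k L) (deg : ι → ℕ) (p : ℕ) :
    Submodule k D.QSym :=
  Submodule.span k {w | ∃ s : List ι, s.Pairwise (· ≤ ·) ∧ (s.map deg).sum < p ∧ w = D.word b s}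

/-- The map `L ⊗ 𝒮(L) → 𝒮(L)`, `x ⊗ w ↦ x · w`, used to compare `U(L)` with `𝒮(L)`. It is
pinned down recursively (on `η(x) + η(Σ)` and the length of `Σ`) by the conditions
* `x · z_Σ = z_x z_Σ` if `x ≤ Σ`,
* `x · (z_y z_Σ) = q_(x,y) y · (x · z_Σ) + ⟨x, y⟩ · z_Σ + [x, y] · z_Σ` if `y < x`, `y ≤ Σ`,
* `x · z_Σ - z_x z_Σ` has degree `< η(x) + η(Σ)`,

where `Σ` is non-decreasing and `(u ⊗ v) · w = u · (v · w)`, i.e. tensors act through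
`TensorAlgebra.lift k act`. -/
structure IsPBWAction (D : TLieData k L) (b : Module.Basis ι k L) (deg : ι → ℕ) (q : ι → ι → k)
    (act : L →ₗ[k] Module.End k D.QSym) : Prop where
  of_le : ∀ (i : ι) (s : List ι), s.Pairwise (· ≤ ·) → (∀ t ∈ s, i ≤ t) →
    act (b i) (D.word b s) = D.abelian.envι (b i) * D.word b s
  of_lt : ∀ (i j : ι) (s : List ι), s.Pairwise (· ≤ ·) → j < i → (∀ t ∈ s, j ≤ t) →
    act (b i) (D.word b (j :: s)) =
      q i j • act (b j) (act (b i) (D.word b s))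
        + TensorAlgebra.lift k act (tensorTwo k L (D.pseudo (b i ⊗ₜ b j))) (D.word b s)
        + act (D.bracket (b i ⊗ₜ b j)) (D.word b s)
  lower : ∀ (i : ι) (s : List ι), s.Pairwise (· ≤ ·) →
    act (b i) (D.word b s) - D.abelian.envι (b i) * D.word b s ∈
      D.symLT b deg (deg i + (s.map deg).sum)

/-- For `x > y > z`, the part of the two ways of reordering `x ⊗ y ⊗ z` that is not governed by
the Jacobi identity and multiplicativity: the element
```
⟨x, [y, z]⟩ - ⟨[x, y], z⟩ - (q_(x,y) y ⊗ [x, z] - q_(y,z) [x, z] ⊗ y - q_(x,y) [y, [x, z]])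
  + (x ⊗ ⟨y, z⟩ - q_(x,y) q_(x,z) ⟨y, z⟩ ⊗ x) - (q_(x,y) y ⊗ ⟨x, z⟩ - q_(y,z) ⟨x, z⟩ ⊗ y)
  + (q_(x,z) q_(y,z) z ⊗ ⟨x, y⟩ - ⟨x, y⟩ ⊗ z)
```
of the tensor algebra. -/
def residue (D : TLieData k L) (b : Module.Basis ι k L) (q : ι → ι → k) (x y z : ι) :
    TensorAlgebra k L :=
  let e : ι → TensorAlgebra k L := fun i => TensorAlgebra.ι k (b i)
  let br : ι → ι → L := fun i j => D.bracket (b i ⊗ₜ b j)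
  let ps : ι → ι → TensorAlgebra k L := fun i j => tensorTwo k L (D.pseudo (b i ⊗ₜ b j))
  tensorTwo k L (D.pseudo (b x ⊗ₜ br y z)) - tensorTwo k L (D.pseudo (br x y ⊗ₜ b z))
    - (q x y • (e y * TensorAlgebra.ι k (br x z)) - q y z • (TensorAlgebra.ι k (br x z) * e y)
        - q x y • TensorAlgebra.ι k (D.bracket (b y ⊗ₜ br x z)))
    + (e x * ps y z - (q x y * q x z) • (ps y z * e x))
    - (q x y • (e y * ps x z) - q y z • (ps x z * e y))
    + ((q x z * q y z) • (e z * ps x y) - ps x y * e z)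

/-- Adequateness: for the map `L ⊗ 𝒮(L) → 𝒮(L)` of `IsPBWAction`, and `x > y > z` in the basis,
the residue annihilates every `z_Σ` with `Σ` non-decreasing and `z ≤ Σ`. -/
def IsAdequate (D : TLieData k L) (b : Module.Basis ι k L) (deg : ι → ℕ) (q : ι → ι → k) : Prop :=
  ∀ act : L →ₗ[k] Module.End k D.QSym, D.IsPBWAction b deg q act →
    ∀ x y z : ι, z < y → y < x → ∀ s : List ι, s.Pairwise (· ≤ ·) → (∀ t ∈ s, z ≤ t) →
      TensorAlgebra.lift k act (D.residue b q x y z) (D.word b s) = 0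

/-! #### The filtration of `U(L)` -/

/-- `T_m = ∑ L_(η₁) ⊗ ⋯ ⊗ L_(η_r)`, over `r ≥ 0` and `η₁ + ⋯ + η_r ≤ m`. -/
def tensorFil (gr : ℕ → Submodule k L) (m : ℕ) : Submodule k (TensorAlgebra k L) :=
  ⨆ (l : List ℕ) (_ : l.sum ≤ m), (l.map fun η => (gr η).map (TensorAlgebra.ι k)).prod

theorem tensorFil_mono (gr : ℕ → Submodule k L) : Monotone (tensorFil gr) := by
  intro m n h
  exact iSup₂_le fun l hl => le_iSup₂_of_le l (hl.trans h) le_rfl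

theorem one_mem_tensorFil (gr : ℕ → Submodule k L) : (1 : TensorAlgebra k L) ∈ tensorFil gr 0 := by
  refine (le_iSup₂_of_le (f := fun (l : List ℕ) (_ : l.sum ≤ 0) =>
    (l.map fun η => (gr η).map (TensorAlgebra.ι k)).prod) [] (by simp) le_rfl) ?_
  simp

theorem tensorFil_mul (gr : ℕ → Submodule k L) (m n : ℕ) :
    tensorFil gr m * tensorFil gr n ≤ tensorFil gr (m + n) := by
  simp only [tensorFil, Submodule.iSup_mul, Submodule.mul_iSup, iSup_le_iff]
  intro l hl l' hl'
  refine le_iSup₂_of_le (l' ++ l) (by rw [List.sum_append]; omega) ?_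
  rw [List.map_append, List.prod_append]

/-- The filtration `U_m = π(T_m)` of `U(L)`. -/
def envFil (D : TLieData k L) (gr : ℕ → Submodule k L) : AlgFiltration k D.Env where
  F m := (tensorFil gr m).map D.proj.toLinearMap
  mono _ _ h := Submodule.map_mono (tensorFil_mono gr h)
  one_mem := ⟨1, one_mem_tensorFil gr, map_one D.proj⟩
  mul_mem := by
    rintro m n _ _ ⟨a, ha, rfl⟩ ⟨c, hc, rfl⟩
    exact ⟨a * c, tensorFil_mul gr m n (Submodule.mul_mem_mul ha hc), map_mul D.proj a c⟩

theorem envι_mem (D : TLieData k L) (gr : ℕ → Submodule k L) (m : ℕ) (x : L) (hx : x ∈ gr m) :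
    D.envι x ∈ (D.envFil gr).F m := by
  refine ⟨TensorAlgebra.ι k x, ?_, rfl⟩
  refine (le_iSup₂_of_le (f := fun (l : List ℕ) (_ : l.sum ≤ m) =>
    (l.map fun η => (gr η).map (TensorAlgebra.ι k)).prod) [m] (by simp) le_rfl) ?_
  simpa using Submodule.mem_map_of_mem (f := TensorAlgebra.ι k) hx

/-- The graded algebra `G = ⨁ U_m / U_(m-1)` of `U(L)`. -/
abbrev GrEnv (D : TLieData k L) (gr : ℕ → Submodule k L) : Type _ := (D.envFil gr).AssocGraded

end TLieData

/-! ### The algebra `(sl_{n+1}^+)_q` -/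

namespace SlPlus

/-- Indices `(i, j)`, `i < j`, of the matrix units `e_ij` spanning the strictly upper triangular
matrices of size `n + 1` (rows and columns are numbered from `0`). -/
def Idx (n : ℕ) : Type := {p : Fin (n + 1) × Fin (n + 1) // p.1 < p.2}

/-- `e_ab < e_ij` if `a + b < i + j`, or `a + b = i + j` and `b < j`. -/
def idxLT {n : ℕ} (x y : Idx n) : Prop :=
  (x.1.1 : ℕ) + x.1.2 < (y.1.1 : ℕ) + y.1.2 ∨
    ((x.1.1 : ℕ) + x.1.2 = (y.1.1 : ℕ) + y.1.2 ∧ x.1.2 < y.1.2)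

/-- The integer `c_(ab,ij)` with `[h_ab, e_ij] = c_(ab,ij) e_ij`, `h_ab = [e_ab, e_abᵗ]`. -/
def cartan {n : ℕ} (x y : Idx n) : ℤ :=
  (if x.1.1 = y.1.1 then 1 else 0) - (if x.1.1 = y.1.2 then 1 else 0)
    - (if x.1.2 = y.1.1 then 1 else 0) + (if x.1.2 = y.1.2 then 1 else 0)

/-- The matrix unit `e_ij`. -/
def unit {n : ℕ} (x : Idx n) : Matrix (Fin (n + 1)) (Fin (n + 1)) ℤ :=
  Matrix.single x.1.1 x.1.2 1

theorem cartan_spec {n : ℕ} (x y : Idx n) :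
    ⁅⁅unit x, (unit x).transpose⁆, unit y⁆ = cartan x y • unit y := by
  obtain ⟨⟨a, b⟩, hab⟩ := x
  obtain ⟨⟨i, j⟩, hij⟩ := y
  have h1 : a ≠ b := ne_of_lt hab
  have h2 : i ≠ j := ne_of_lt hij
  simp only [unit, cartan, Ring.lie_def, Matrix.transpose_single, Matrix.single_mul_single_same,
    sub_mul, mul_sub, mul_one]
  by_cases h3 : a = i <;> by_cases h4 : a = j <;> by_cases h5 : b = i <;> by_cases h6 : b = j <;>
    simp_all [Matrix.single_mul_single_of_ne, eq_comm, two_smul, sub_eq_add_neg]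

variable (k : Type*) [CommRing k]

/-- The free `k`-module with basis the `e_ij`. -/
abbrev Mod (n : ℕ) : Type _ := Idx n →₀ k

/-- The basis vector `e_ij`. -/
def e {n : ℕ} (x : Idx n) : Mod k n := Finsupp.single x 1

/-- The classical bracket `[e_ab, e_ij] = δ_bi e_aj - δ_ja e_ib` of matrix units. -/
def classical {n : ℕ} (x y : Idx n) : Mod k n :=
  if h : x.1.2 = y.1.1 then
    e k ⟨(x.1.1, y.1.2), x.2.trans (h.trans_lt y.2)⟩
  else if h : y.1.2 = x.1.1 then
    -e k ⟨(y.1.1, x.1.2), y.2.trans (h.trans_lt x.2)⟩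
  else 0

variable {k}

/-- The pseudobracket `⟨e_ab, e_ij⟩` of two basis elements `e_ab < e_ij`. -/
def pseudoUp (q : kˣ) {n : ℕ} (x y : Idx n) : Mod k n ⊗[k] Mod k n :=
  if h : x.1.1 < y.1.1 ∧ y.1.1 < x.1.2 ∧ x.1.2 < y.1.2 then
    ((q : k) - (q⁻¹ : kˣ)) •
      (e k ⟨(y.1.1, x.1.2), h.2.1⟩ ⊗ₜ e k ⟨(x.1.1, y.1.2), x.2.trans h.2.2⟩)
  else 0

/-- The linear map on `(sl_{n+1}^+)_q ⊗ (sl_{n+1}^+)_q` with given values on the basis. -/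
def ofBasis {n : ℕ} {M : Type*} [AddCommGroup M] [Module k M] (f : Idx n → Idx n → M) :
    Mod k n ⊗[k] Mod k n →ₗ[k] M :=
  TensorProduct.lift (Finsupp.lift _ k _ fun x => Finsupp.lift _ k _ fun y => f x y)

theorem ofBasis_e {n : ℕ} {M : Type*} [AddCommGroup M] [Module k M] (f : Idx n → Idx n → M)
    (x y : Idx n) : ofBasis f (e k x ⊗ₜ[k] e k y) = f x y := by
  simp [ofBasis, e]

open Classical in
/-- The `T`-Lie algebra `(sl_{n+1}^+)_q`: for basis elements `x < y`, `S (x ⊗ y) = q^c(x,y) y ⊗ x`,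
`[x, y]_q = [x, y]` and `⟨x, y⟩` as in `pseudoUp`; moreover `S (x ⊗ x) = x ⊗ x`, and the values on
the other pairs are given by `S² = 1`, `[ , ]_q S = -[ , ]_q`, `⟨ , ⟩ S = -⟨ , ⟩`. -/
def slPlus (q : kˣ) (n : ℕ) : TLieData k (Mod k n) where
  presym := ofBasis fun x y =>
    if idxLT x y then ((q ^ cartan x y : kˣ) : k) • (e k y ⊗ₜ e k x)
    else if idxLT y x then ((q ^ (-cartan y x) : kˣ) : k) • (e k y ⊗ₜ e k x)
    else e k y ⊗ₜ e k x
  bracket := ofBasis fun x y =>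
    if idxLT x y then classical k x y
    else if idxLT y x then -(((q ^ (-cartan y x) : kˣ) : k) • classical k y x)
    else 0
  pseudo := ofBasis fun x y =>
    if idxLT x y then pseudoUp q x y
    else if idxLT y x then -(((q ^ (-cartan y x) : kˣ) : k) • pseudoUp q y x)
    else 0

end SlPlus

/-! ### The multiparametric quantum matrix algebra -/

namespace QuantumMatrix

variable {k : Type*} [CommRing k] {n : ℕ}

/-- The generator `Z_i^j` in the free algebra. -/
def Z (k : Type*) [CommRing k] {n : ℕ} (i j : Fin n) : FreeAlgebra k (Fin n × Fin n) :=
  FreeAlgebra.ι k (i, j)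

/-- The defining relations of `M_{p,q,ε}(n)`. Only the entries `p i j`, `q i j`, `ε i j` with
`i < j` are used. -/
inductive Rel (p q : Fin n → Fin n → kˣ) (ε : Fin n → Fin n → ℤˣ) :
    FreeAlgebra k (Fin n × Fin n) → FreeAlgebra k (Fin n × Fin n) → Prop
  | row (i l m : Fin n) (h : l < m) :
      Rel p q ε (Z k i l * Z k i m) ((p l m : k) • (Z k i m * Z k i l))
  | col (i j l : Fin n) (h : i < j) :
      Rel p q ε (Z k i l * Z k j l) ((q i j : k) • (Z k j l * Z k i l))
  | anti_eq (i j l m : Fin n) (h : i < j) (h' : l < m) (hε : ε i j = ε l m) :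
      Rel p q ε (Z k i m * Z k j l) (((q l m * (p i j)⁻¹ : kˣ) : k) • (Z k j l * Z k i m))
  | diag_eq (i j l m : Fin n) (h : i < j) (h' : l < m) (hε : ε i j = ε l m) :
      Rel p q ε (Z k i l * Z k j m)
        (((q i j * (q l m)⁻¹ : kˣ) : k) • (Z k j m * Z k i l)
          + ((q i j : k) - ((p i j)⁻¹ : kˣ)) • (Z k j l * Z k i m))
  | diag_ne (i j l m : Fin n) (h : i < j) (h' : l < m) (hε : ε i j ≠ ε l m) :
      Rel p q ε (Z k i l * Z k j m) ((((p i j)⁻¹ * (q l m)⁻¹ : kˣ) : k) • (Z k j m * Z k i l))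
  | anti_ne (i j l m : Fin n) (h : i < j) (h' : l < m) (hε : ε i j ≠ ε l m) :
      Rel p q ε (Z k i m * Z k j l)
        ((((p i j)⁻¹ * (p l m)⁻¹ : kˣ) : k) • (Z k j l * Z k i m)
          + ((q i j : k) - ((p i j)⁻¹ : kˣ)) • (Z k j m * Z k i l))

/-- The multiparametric quantum matrix algebra `M_{p,q,ε}(n)`. -/
def Alg (p q : Fin n → Fin n → kˣ) (ε : Fin n → Fin n → ℤˣ) : Type _ :=
  RingQuot (Rel p q ε)

instance (p q : Fin n → Fin n → kˣ) (ε : Fin n → Fin n → ℤˣ) : Ring (Alg p q ε) :=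
  inferInstanceAs (Ring (RingQuot (Rel p q ε)))

instance (p q : Fin n → Fin n → kˣ) (ε : Fin n → Fin n → ℤˣ) : Algebra k (Alg p q ε) :=
  inferInstanceAs (Algebra k (RingQuot (Rel p q ε)))

/-- Admissible parameters: `p_ij q_ij = u ^ ε_ij` for `i < j`, with one unit `u` and signs
`ε_ij = ±1` such that `ε_ij = ε_jl` implies `ε_il = ε_ij` (`i < j < l`). -/
structure Admissible (p q : Fin n → Fin n → kˣ) (ε : Fin n → Fin n → ℤˣ) (u : kˣ) : Prop where
  mul_eq : ∀ i j, i < j → p i j * q i j = u ^ ((ε i j : ℤˣ) : ℤ)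
  trans : ∀ i j l, i < j → j < l → ε i j = ε j l → ε i l = ε i j

end QuantumMatrix

end

/-! The argument is of Poincaré–Birkhoff–Witt type: `U(L)` is made to act on `𝒮(L)`. In `𝒮(L)` the
generators commute up to units, so the sorted monomials form a basis (`zbasis`) and the product of
two of them is a unit times a third. They are indexed by multisets, a monoid with unique sums, so
`𝒮(L)` is a domain if `k` is.

The recursion for `x · z_Σ` terminates, by degree and then by length, since `⟨x, y⟩` and `[x, y]`
lower the degree; iterating it from zero stabilises on every vector (`IsQuadratic.exists_action`).
The relation of `U(L)` for `x > y` then holds by construction on monomials bounded below by `y`. On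
`z_z z_Σ` with `z < y`, the two ways of reordering `x y z` have the same leading term modulo
relations known by induction, and what is left is `overlap`. Hence the action is a representation
once all overlaps vanish, and relations of lower total degree may be used to show this
(`IsPBWAction.straightens`, `OverlapsResolve`). This is the diamond lemma for modules; it needs only
the two-variable axioms `IsQuadratic`.

Sending `z_x` to the class of `x` gives a homomorphism from `𝒮(L)` to the graded algebra, surjective
because products of basis elements span the filtration. It is injective because `u ↦` (degree `m`
part of `u · 1`) is a left inverse: a sorted product applied to `1` returns the same monomial. An
exhaustively filtered algebra whose graded algebra is a domain is itself a domain.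

It remains to resolve overlaps. In the adequate case, multiplicativity, the Jacobi identity and the
relations in lower degree reduce the overlap to `residue` (`IsBasic.overlapsResolve`). For
`(sl_{n+1}^+)_q` and for quantum matrices the overlaps are computed directly, with the basis ordered
by rows and the position `(a, b)` given degree `a * b`, plus a constant for `sl`: if `a < i` and `b
< j` then `i * b + a * j < a * b + i * j`, so exchanging columns lowers the degree. Quantum matrices
with arbitrary signs reduce to constant signs: the condition on `ε` ensures that reversing the pairs
of sign `-1` gives a total order of the indices, and relabelling along it makes all signs `1`. -/

noncomputable section

namespace TLieData

variable {k L ι A : Type*} [CommRing k] [AddCommGroup L] [Module k L]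
  [Semiring A] [Algebra k A]

/-! ### Universal property and induction for enveloping algebras -/

/-- The linear map `L ⊗ L → A`, `x ⊗ y ↦ f x * f y`. -/
def two (f : L →ₗ[k] A) : L ⊗[k] L →ₗ[k] A :=
  (TensorAlgebra.lift k f).toLinearMap ∘ₗ tensorTwo k L

theorem two_apply (f : L →ₗ[k] A) (t : L ⊗[k] L) :
    two f t = TensorAlgebra.lift k f (tensorTwo k L t) := rfl

theorem tensorTwo_tmul (x y : L) :
    tensorTwo k L (x ⊗ₜ y) = TensorAlgebra.ι k x * TensorAlgebra.ι k y := rfl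

@[simp]
theorem two_tmul (f : L →ₗ[k] A) (x y : L) : two f (x ⊗ₜ y) = f x * f y := by
  simp [two_apply, tensorTwo_tmul]

theorem two_comp {B : Type*} [Semiring B] [Algebra k B] (f : L →ₗ[k] A) (g : A →ₐ[k] B)
    (t : L ⊗[k] L) : g (two f t) = two (g.toLinearMap ∘ₗ f) t := by
  induction t with
  | zero => simp
  | tmul x y => simp
  | add x y hx hy => simp [hx, hy]

theorem proj_tensorTwo (D : TLieData k L) (t : L ⊗[k] L) :
    D.proj (tensorTwo k L t) = two D.envι t := by
  induction t with
  | zero => simp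
  | tmul x y => simp [tensorTwo_tmul, envι]
  | add x y hx hy => simp [hx, hy]

theorem proj_ι (D : TLieData k L) (x : L) : D.proj (TensorAlgebra.ι k x) = D.envι x := rfl

theorem envι_mul (D : TLieData k L) (x y : L) :
    D.envι x * D.envι y = two D.envι (D.presym (x ⊗ₜ y)) + two D.envι (D.pseudo (x ⊗ₜ y))
      + D.envι (D.bracket (x ⊗ₜ y)) := by
  have h := RingQuot.mkAlgHom_rel k (Rel.mk (D := D) x y)
  change D.proj _ = D.proj _ at h
  simpa [proj_tensorTwo, proj_ι] using h

theorem proj_surjective (D : TLieData k L) : Function.Surjective D.proj :=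
  RingQuot.mkAlgHom_surjective k (Rel D)

/-- The universal property of `U(L)`, with the relations tested on a basis. -/
def liftEnv (D : TLieData k L) (b : Module.Basis ι k L) (f : L →ₗ[k] A)
    (h : ∀ i j, f (b i) * f (b j) = two f (D.presym (b i ⊗ₜ b j))
      + two f (D.pseudo (b i ⊗ₜ b j)) + f (D.bracket (b i ⊗ₜ b j))) : D.Env →ₐ[k] A :=
  RingQuot.liftAlgHom k ⟨TensorAlgebra.lift k f, by
    have key : two f = two f ∘ₗ D.presym + two f ∘ₗ D.pseudo + f ∘ₗ D.bracket :=
      (b.tensorProduct b).ext fun ij => by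
        simpa [Module.Basis.tensorProduct_apply'] using h ij.1 ij.2
    rintro _ _ ⟨x, y⟩
    simpa [two_apply] using LinearMap.congr_fun key (x ⊗ₜ y)⟩

theorem liftEnv_proj (D : TLieData k L) (b : Module.Basis ι k L) (f : L →ₗ[k] A) (h)
    (t : TensorAlgebra k L) : D.liftEnv b f h (D.proj t) = TensorAlgebra.lift k f t :=
  RingQuot.liftAlgHom_mkAlgHom_apply _ _ _ _

@[simp]
theorem liftEnv_envι (D : TLieData k L) (b : Module.Basis ι k L) (f : L →ₗ[k] A) (h) (x : L) :
    D.liftEnv b f h (D.envι x) = f x := by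
  rw [← proj_ι, liftEnv_proj, TensorAlgebra.lift_ι_apply]

/-- The tensors whose image preserves `P` under left multiplication are closed under sums and
products and contain scalars and vectors, hence are all tensors. This is the induction principle
behind the spanning and exhaustion statements below. -/
theorem env_submodule_eq_top (D : TLieData k L) (b : Module.Basis ι k L)
    (P : Submodule k D.Env) (h1 : 1 ∈ P) (hP : ∀ i, ∀ w ∈ P, D.envι (b i) * w ∈ P) : P = ⊤ := by
  have key : ∀ t : TensorAlgebra k L, ∀ w ∈ P, D.proj t * w ∈ P := by
    intro t
    induction t using TensorAlgebra.induction with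
    | algebraMap r =>
      intro w hw
      rw [AlgHom.commutes, ← Algebra.smul_def]
      exact P.smul_mem r hw
    | ι x =>
      intro w hw
      rw [proj_ι]
      induction b.mem_span x using Submodule.span_induction with
      | mem x hx =>
        obtain ⟨i, rfl⟩ := hx
        exact hP i w hw
      | zero => simp
      | add x y _ _ hx hy =>
        rw [map_add, add_mul]
        exact P.add_mem hx hy
      | smul r x _ hx =>
        rw [map_smul, smul_mul_assoc]
        exact P.smul_mem r hx
    | mul a c ha hc =>
      intro w hw
      rw [map_mul, mul_assoc]
      exact ha _ (hc _ hw)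
    | add a c ha hc =>
      intro w hw
      rw [map_add, add_mul]
      exact P.add_mem (ha _ hw) (hc _ hw)
  refine eq_top_iff.2 fun u _ => ?_
  obtain ⟨t, rfl⟩ := D.proj_surjective u
  simpa using key t 1 h1

/-! ### The monomial basis of the `q`-symmetric algebra -/

/-- The presymmetry is diagonal on the basis `b`, with structure constants `q`. -/
structure IsDiagonal (D : TLieData k L) (b : Module.Basis ι k L) (q : ι → ι → k) : Prop where
  presym_basis : ∀ i j, D.presym (b i ⊗ₜ b j) = q i j • (b j ⊗ₜ b i)
  q_mul : ∀ i j, q i j * q j i = 1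
  q_self : ∀ i, q i i = 1

/-- Left multiplication by `z_i` on the span of the monomials, indexed by multisets. -/
def monOp [LinearOrder ι] (q : ι → ι → k) (i : ι) : Module.End k (Multiset ι →₀ k) :=
  -- On its way to its sorted place `i` passes exactly the letters `t < i`, each contributing `q i
  -- t`.
  Finsupp.lsum k fun s => ((s.filter (· < i)).map (q i)).prod • Finsupp.lsingle (i ::ₘ s)

theorem monOp_single [LinearOrder ι] (q : ι → ι → k) (i : ι) (s : Multiset ι) (r : k) :
    monOp q i (Finsupp.single s r)
      = ((s.filter (· < i)).map (q i)).prod • Finsupp.single (i ::ₘ s) r := by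
  simp [monOp]

variable {D : TLieData k L} {b : Module.Basis ι k L} {deg : ι → ℕ} {q : ι → ι → k}

@[simp] theorem abelian_bracket (D : TLieData k L) : D.abelian.bracket = 0 := rfl
@[simp] theorem abelian_pseudo (D : TLieData k L) : D.abelian.pseudo = 0 := rfl
@[simp] theorem abelian_presym (D : TLieData k L) : D.abelian.presym = D.presym := rfl

theorem word_cons (i : ι) (s : List ι) :
    D.word b (i :: s) = D.abelian.envι (b i) * D.word b s := by simp [word]

namespace IsDiagonal

variable (hD : D.IsDiagonal b q)
include hD

theorem isUnit_q (i j : ι) : IsUnit (q i j) :=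
  IsUnit.of_mul_eq_one _ (hD.q_mul i j)

theorem z_mul_z (i j : ι) : D.abelian.envι (b i) * D.abelian.envι (b j)
    = q i j • (D.abelian.envι (b j) * D.abelian.envι (b i)) := by
  rw [envι_mul]
  simp [hD.presym_basis]

variable [LinearOrder ι]

/-- For `j < i` the letter `i` has to pass `j` while `j` never passes `i`, which accounts for the
single factor `q i j`; the opposite case is its inverse. -/
theorem monOp_comm (i j : ι) : monOp q i * monOp q j = q i j • (monOp q j * monOp q i) := by
  have main : ∀ i j, j < i → monOp q i * monOp q j = q i j • (monOp q j * monOp q i) := by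
    intro i j hji
    refine Finsupp.lhom_ext fun s r => ?_
    simp only [Module.End.mul_apply, monOp_single, map_smul, LinearMap.smul_apply]
    rw [Multiset.filter_cons_of_pos (p := (· < i)) _ hji,
      Multiset.filter_cons_of_neg (p := (· < j)) _ hji.not_gt,
      Multiset.cons_swap, Multiset.map_cons, Multiset.prod_cons]
    module
  rcases lt_trichotomy j i with h | rfl | h
  · exact main i j h
  · rw [hD.q_self, one_smul]
  · rw [main j i h, smul_smul, hD.q_mul, one_smul]

/-- `z_i` moves right past the smaller letters, each exchange costing a unit. -/
theorem z_mul_word (i : ι) (s : List ι) (hs : s.Pairwise (· ≤ ·)) :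
    ∃ c : kˣ, D.abelian.envι (b i) * D.word b s = c • D.word b (s.orderedInsert (· ≤ ·) i) := by
  induction s with
  | nil => exact ⟨1, by simp [word]⟩
  | cons j s ih =>
    by_cases hij : i ≤ j
    · exact ⟨1, by simp [word, hij]⟩
    · obtain ⟨c, hc⟩ := ih hs.of_cons
      obtain ⟨d, hd⟩ := hD.isUnit_q i j
      refine ⟨d * c, ?_⟩
      rw [List.orderedInsert_cons, if_neg hij]
      rw [word_cons, ← mul_assoc, hD.z_mul_z, smul_mul_assoc, mul_assoc, hc, ← hd]
      simp [word, Units.smul_def, smul_smul]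

/-- The action of `𝒮(L)` on the span of the monomials. -/
def monRep : D.QSym →ₐ[k] Module.End k (Multiset ι →₀ k) :=
  D.abelian.liftEnv b (b.constr k (monOp q)) fun i j => by
    simp [hD.presym_basis, hD.monOp_comm i j]

/-- In a sorted word no letter has to pass another, so no factors arise. Distinct sorted monomials
thus send the empty monomial to distinct basis vectors, which gives the independence in `zbasis`. -/
theorem monRep_word (s : List ι) (hs : s.Pairwise (· ≤ ·)) :
    hD.monRep (D.word b s) (Finsupp.single 0 1) = Finsupp.single (s : Multiset ι) 1 := by
  induction s with
  | nil => simp [word]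
  | cons i s ih =>
    rw [word_cons, map_mul, Module.End.mul_apply, ih hs.of_cons]
    have h0 : (s : Multiset ι).filter (· < i) = 0 := by
      refine Multiset.filter_eq_nil.2 fun t ht => ?_
      exact (List.rel_of_pairwise_cons hs ht).not_gt
    simp [monRep, monOp_single, h0]

/-- The monomial basis of `𝒮(L)`. -/
def zbasis : Module.Basis (Multiset ι) k D.QSym :=
  Module.Basis.mk (v := fun s : Multiset ι => D.word b (s.sort (· ≤ ·)))
    (by
      refine LinearIndependent.of_comp
        ((LinearMap.applyₗ (Finsupp.single (0 : Multiset ι) (1 : k))) ∘ₗ hD.monRep.toLinearMap) ?_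
      convert (Finsupp.basisSingleOne (R := k) (ι := Multiset ι)).linearIndependent using 1
      funext s
      simp [hD.monRep_word _ (Multiset.pairwise_sort s _)])
    (by
      refine (env_submodule_eq_top D.abelian b _ ?_ ?_).ge
      · exact Submodule.subset_span ⟨0, by simp [word]⟩
      · intro i w hw
        induction hw using Submodule.span_induction with
        | mem w hw =>
          obtain ⟨s, rfl⟩ := hw
          obtain ⟨c, hc⟩ := hD.z_mul_word i _ (Multiset.pairwise_sort s (· ≤ ·))
          rw [hc]
          refine Submodule.smul_mem _ (c : k) (Submodule.subset_span
            ⟨((s.sort (· ≤ ·)).orderedInsert (· ≤ ·) i : List ι), ?_⟩)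
          change D.word b (Multiset.sort _ _) = _
          rw [Multiset.coe_sort, List.mergeSort_eq_self]
          exact (Multiset.pairwise_sort s _).orderedInsert i _
        | zero => simp
        | add x y _ _ hx hy =>
          rw [mul_add]
          exact Submodule.add_mem _ hx hy
        | smul r x _ hx =>
          rw [mul_smul_comm]
          exact Submodule.smul_mem _ r hx)

end IsDiagonal
end TLieData

/-! ### Products of monomials and zero divisors in `𝒮(L)`. -/

namespace TLieData

variable {k L ι : Type*} [CommRing k] [AddCommGroup L] [Module k L]
variable {D : TLieData k L} {b : Module.Basis ι k L} {deg : ι → ℕ} {q : ι → ι → k}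

namespace IsDiagonal

variable (hD : D.IsDiagonal b q) [LinearOrder ι]
include hD

theorem zbasis_coe (s : List ι) (hs : s.Pairwise (· ≤ ·)) :
    hD.zbasis (s : Multiset ι) = D.word b s := by
  rw [zbasis, Module.Basis.mk_apply, Multiset.coe_sort, List.mergeSort_eq_self _ hs]

theorem zbasis_sort (s : Multiset ι) : hD.zbasis s = D.word b (s.sort (· ≤ ·)) := by
  rw [zbasis, Module.Basis.mk_apply]

theorem z_mul_zbasis (i : ι) (s : Multiset ι) :
    ∃ c : kˣ, D.abelian.envι (b i) * hD.zbasis s = c • hD.zbasis (i ::ₘ s) := by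
  obtain ⟨c, hc⟩ := hD.z_mul_word i _ (Multiset.pairwise_sort s (· ≤ ·))
  refine ⟨c, ?_⟩
  rw [zbasis_sort, hc, ← hD.zbasis_coe _ ((Multiset.pairwise_sort s _).orderedInsert i _)]
  congr 2
  rw [Multiset.coe_eq_coe.2 (List.perm_orderedInsert (· ≤ ·) i (s.sort (· ≤ ·))),
    ← Multiset.cons_coe, Multiset.sort_eq]

theorem zbasis_zero : hD.zbasis 0 = 1 := by
  simp [zbasis_sort, word]

theorem zbasis_mul_zbasis (s t : Multiset ι) :
    ∃ c : kˣ, hD.zbasis s * hD.zbasis t = c • hD.zbasis (s + t) := by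
  induction s using Multiset.induction with
  | empty => exact ⟨1, by simp [zbasis_zero]⟩
  | cons i s ih =>
    obtain ⟨c, hc⟩ := ih
    obtain ⟨d, hd⟩ := hD.z_mul_zbasis i s
    obtain ⟨e, he⟩ := hD.z_mul_zbasis i (s + t)
    refine ⟨d⁻¹ * (c * e), ?_⟩
    rw [mul_smul, eq_inv_smul_iff, ← smul_mul_assoc, ← hd, mul_assoc, hc, mul_smul_comm, he,
      Multiset.cons_add, mul_smul]

/-- If `k` is a domain, so is the `q`-symmetric algebra. -/
theorem isDomain_qSym [IsDomain k] : IsDomain D.QSym := by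
  classical
  have : Nontrivial D.QSym := hD.zbasis.repr.toEquiv.nontrivial
  -- Multisets embed additively in finitely supported functions to `ℕ`; unique sums take the place
  -- of a monomial order and of leading terms.
  have : UniqueSums (Multiset ι) := UniqueSums.of_injective_addHom
    (Multiset.toFinsupp (α := ι)).toAddMonoidHom.toAddHom (Multiset.toFinsupp (α := ι)).injective
    inferInstance
  have : NoZeroDivisors D.QSym := ⟨by
    intro x y hxy
    by_contra! hne
    have hx : (hD.zbasis.repr x).support.Nonempty := by simpa using hne.1
    have hy : (hD.zbasis.repr y).support.Nonempty := by simpa using hne.2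
    -- Only the pair `s`, `t` contributes to the coefficient of `s + t` in `x * y`, so that
    -- coefficient is a unit times a product of two nonzero scalars.
    obtain ⟨s, hs, t, ht, hu⟩ := UniqueSums.uniqueAdd_of_nonempty hx hy
    have h0 : hD.zbasis.repr (x * y) (s + t) = 0 := by rw [hxy]; simp
    choose c hc using hD.zbasis_mul_zbasis
    rw [← hD.zbasis.linearCombination_repr x, ← hD.zbasis.linearCombination_repr y,
      Finsupp.linearCombination_apply, Finsupp.linearCombination_apply, Finsupp.sum, Finsupp.sum,
      Finset.sum_mul_sum, map_sum, Finsupp.finsetSum_apply, Finset.sum_eq_single s,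
      map_sum, Finsupp.finsetSum_apply, Finset.sum_eq_single t] at h0
    · rw [smul_mul_smul_comm, hc] at h0
      simp only [Finsupp.mem_support_iff] at hs ht
      simp [Units.smul_def, hs, ht] at h0
    · intro t' ht' hne'
      rw [smul_mul_smul_comm, hc]
      have : s + t' ≠ s + t := by simpa using hne'
      simp [Units.smul_def, this]
    · intro h; exact (h ht).elim
    · intro s' hs' hne'
      rw [map_sum, Finsupp.finsetSum_apply]
      refine Finset.sum_eq_zero fun t' ht' => ?_
      rw [smul_mul_smul_comm, hc]
      have : s' + t' ≠ s + t := fun h => hne' (hu hs' ht' h).1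
      simp [Units.smul_def, this]
    · intro h; exact (h hs).elim⟩
  exact NoZeroDivisors.to_isDomain _

/-! #### The degree filtration of `𝒮(L)` -/

omit hD in
theorem symLT_mono : Monotone (D.symLT b deg) := fun _ _ h =>
  Submodule.span_mono fun _ ⟨s, h1, h2, h3⟩ => ⟨s, h1, h2.trans_le h, h3⟩

omit hD in
theorem word_mem_symLT {s : List ι} (hs : s.Pairwise (· ≤ ·)) {p : ℕ}
    (h : (s.map deg).sum < p) : D.word b s ∈ D.symLT b deg p :=
  Submodule.subset_span ⟨s, hs, h, rfl⟩

theorem z_mul_word_mem (i : ι) {s : List ι} (hs : s.Pairwise (· ≤ ·)) {p : ℕ}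
    (h : deg i + (s.map deg).sum < p) :
    D.abelian.envι (b i) * D.word b s ∈ D.symLT b deg p := by
  obtain ⟨c, hc⟩ := hD.z_mul_word i s hs
  rw [hc]
  refine Submodule.smul_mem _ (c : k) (word_mem_symLT (hs.orderedInsert i _) ?_)
  rw [((List.perm_orderedInsert (· ≤ ·) i s).map deg).sum_eq]
  simpa using h

end IsDiagonal
end TLieData

namespace TLieData

variable {k L ι : Type*} [CommRing k] [AddCommGroup L] [Module k L]
variable {D : TLieData k L} {b : Module.Basis ι k L} {deg : ι → ℕ} {q : ι → ι → k}

/-- The part of the axioms of a basic `T`-Lie algebra that concerns two basis elements, with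
stability expressed through the basis. -/
structure IsQuadratic (D : TLieData k L) (b : Module.Basis ι k L) (deg : ι → ℕ) (q : ι → ι → k) :
    Prop extends D.IsDiagonal b q where
  bracket_self : ∀ i, D.bracket (b i ⊗ₜ b i) = 0
  pseudo_self : ∀ i, D.pseudo (b i ⊗ₜ b i) = 0
  bracket_swap : ∀ i j, D.bracket (b i ⊗ₜ b j) = -(q i j • D.bracket (b j ⊗ₜ b i))
  pseudo_swap : ∀ i j, D.pseudo (b i ⊗ₜ b j) = -(q i j • D.pseudo (b j ⊗ₜ b i))
  bracket_mem : ∀ i j, D.bracket (b i ⊗ₜ b j) ∈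
    Submodule.span k {x | ∃ l, deg l < deg i + deg j ∧ x = b l}
  pseudo_mem : ∀ i j, D.pseudo (b i ⊗ₜ b j) ∈
    Submodule.span k {t | ∃ l m, deg l + deg m < deg i + deg j ∧ t = b l ⊗ₜ b m}

variable [LinearOrder ι]

/-! ### Existence of the action on `𝒮(L)` -/

section Step

variable (hD : D.IsDiagonal b q)

/-- One step of the recursion for the action of `L` on `𝒮(L)`. -/
def pbwStep (f : L →ₗ[k] Module.End k D.QSym) : L →ₗ[k] Module.End k D.QSym :=
  b.constr k fun i => hD.zbasis.constr k fun s => match s.sort (· ≤ ·) with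
    | [] => D.abelian.envι (b i) * D.word b []
    | j :: l => if i ≤ j then D.abelian.envι (b i) * D.word b (j :: l) else
        q i j • f (b j) (f (b i) (D.word b l)) + two f (D.pseudo (b i ⊗ₜ b j)) (D.word b l)
          + f (D.bracket (b i ⊗ₜ b j)) (D.word b l)

theorem pbwStep_of_le (f : L →ₗ[k] Module.End k D.QSym) (i : ι) (s : List ι)
    (hs : s.Pairwise (· ≤ ·)) (h : ∀ t ∈ s, i ≤ t) :
    pbwStep hD f (b i) (D.word b s) = D.abelian.envι (b i) * D.word b s := by
  rw [← hD.zbasis_coe s hs, pbwStep, Module.Basis.constr_basis, Module.Basis.constr_basis,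
    hD.zbasis_coe s hs, Multiset.coe_sort, List.mergeSort_eq_self _ hs]
  cases s with
  | nil => rfl
  | cons j l => exact if_pos (h j (by simp))

theorem pbwStep_of_lt (f : L →ₗ[k] Module.End k D.QSym) (i j : ι) (s : List ι)
    (hs : (j :: s).Pairwise (· ≤ ·)) (h : j < i) :
    pbwStep hD f (b i) (D.word b (j :: s)) =
      q i j • f (b j) (f (b i) (D.word b s)) + two f (D.pseudo (b i ⊗ₜ b j)) (D.word b s)
        + f (D.bracket (b i ⊗ₜ b j)) (D.word b s) := by
  rw [← hD.zbasis_coe _ hs, pbwStep, Module.Basis.constr_basis, Module.Basis.constr_basis,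
    Multiset.coe_sort, List.mergeSort_eq_self _ hs]
  exact if_neg h.not_ge

/-- Iterating the recursion step. -/
def pbwIter (N : ℕ) : L →ₗ[k] Module.End k D.QSym := (pbwStep hD)^[N] 0

theorem pbwIter_succ (N : ℕ) : pbwIter hD (N + 1) = pbwStep hD (pbwIter hD N) :=
  Function.iterate_succ_apply' _ _ _

open Filter

theorem eventually_pbwIter_of_succ {x : L} {w v : D.QSym}
    (h : ∀ᶠ N in atTop, pbwStep hD (pbwIter hD N) x w = v) :
    ∀ᶠ N in atTop, pbwIter hD N x w = v := by
  obtain ⟨N₀, h⟩ := eventually_atTop.1 h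
  refine eventually_atTop.2 ⟨N₀ + 1, fun N hN => ?_⟩
  obtain ⟨M, rfl⟩ : ∃ M, N = M + 1 := ⟨N - 1, by omega⟩
  rw [pbwIter_succ]
  exact h M (by omega)

/-- The elements `t` with `f t` eventually constant, with value in `P`, for a sequence of linear
maps `f`. -/
def eventuallyIn {M V : Type*} [AddCommGroup M] [Module k M] [AddCommGroup V] [Module k V]
    (f : ℕ → M →ₗ[k] V) (P : Submodule k V) : Submodule k M where
  carrier := {t | ∃ v ∈ P, ∀ᶠ N in atTop, f N t = v}
  zero_mem' := ⟨0, P.zero_mem, by simp⟩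
  add_mem' := by
    rintro x y ⟨v, hv, hx⟩ ⟨w, hw, hy⟩
    exact ⟨v + w, P.add_mem hv hw, by filter_upwards [hx, hy] with N h1 h2; simp [h1, h2]⟩
  smul_mem' := by
    rintro r x ⟨v, hv, hx⟩
    exact ⟨r • v, P.smul_mem r hv, by filter_upwards [hx] with N h1; simp [h1]⟩

end Step

open Filter

/-- Induction on the total degree and, within it, on the length of the word: bracket and
pseudobracket terms fall in degree, whereas `y · (x · z_Σ)` keeps the degree but starts from a
shorter word. The estimate on `v - z_i z_Σ` must be carried along: it splits `x · z_Σ` into `z_x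
z_Σ`, on which `y` acts by multiplication, and a rest on which `y` is covered by lower degree. -/
theorem IsQuadratic.exists_limit (hQ : D.IsQuadratic b deg q) (p : ℕ) :
    ∀ (i : ι) (s : List ι), s.Pairwise (· ≤ ·) → deg i + (s.map deg).sum ≤ p →
      ∃ v, (∀ᶠ N in atTop, pbwIter hQ.toIsDiagonal N (b i) (D.word b s) = v) ∧
        v - D.abelian.envι (b i) * D.word b s ∈ D.symLT b deg (deg i + (s.map deg).sum) := by
  have hD := hQ.toIsDiagonal
  induction p using Nat.strong_induction_on with
  | _ p ih =>
  -- In smaller degree the limit itself, and not only its difference from the leading term, is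
  -- bounded; the `+ 1` appears because `symLT` is a strict bound.
  have ih' : ∀ (i : ι) (s : List ι), s.Pairwise (· ≤ ·) → deg i + (s.map deg).sum < p →
      D.word b s ∈ eventuallyIn (fun N => pbwIter hD N (b i))
        (D.symLT b deg (deg i + (s.map deg).sum + 1)) := by
    intro i s hs hp
    obtain ⟨v, h1, h2⟩ := ih _ hp i s hs le_rfl
    refine ⟨v, ?_, h1⟩
    rw [← sub_add_cancel v (D.abelian.envι (b i) * D.word b s)]
    exact Submodule.add_mem _ (IsDiagonal.symLT_mono (Nat.le_succ _) h2)
      (hD.z_mul_word_mem i hs (Nat.lt_succ_self _))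
  have ihw : ∀ (i : ι) (p' : ℕ), deg i + p' ≤ p → ∀ w ∈ D.symLT b deg p',
      w ∈ eventuallyIn (fun N => pbwIter hD N (b i)) (D.symLT b deg (deg i + p')) := by
    intro i p' hp' w hw
    refine Submodule.span_le.2 ?_ hw
    rintro _ ⟨s, hs, hsp, rfl⟩
    obtain ⟨v, h1, h2⟩ := ih' i s hs (by omega)
    exact ⟨v, IsDiagonal.symLT_mono (by omega) h1, h2⟩
  intro i s
  induction s with
  | nil =>
    intro hs hp
    refine ⟨_, eventually_pbwIter_of_succ hD (Eventually.of_forall fun N =>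
      pbwStep_of_le hD _ i [] hs (by simp)), by simp⟩
  | cons j s ihs =>
    intro hs hp
    rcases le_or_gt i j with hij | hij
    · refine ⟨_, eventually_pbwIter_of_succ hD (Eventually.of_forall fun N =>
        pbwStep_of_le hD _ i _ hs ?_), by simp⟩
      intro t ht
      rcases List.mem_cons.1 ht with rfl | ht
      · exact hij
      · exact hij.trans (List.rel_of_pairwise_cons hs ht)
    simp only [List.map_cons, List.sum_cons] at hp ⊢
    obtain ⟨v, hv, hv'⟩ := ihs hs.of_cons (by omega)
    -- the leading term
    have h1 : ∃ v₁, (∀ᶠ N in atTop, pbwIter hD N (b j) v = v₁) ∧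
        v₁ - D.abelian.envι (b j) * (D.abelian.envι (b i) * D.word b s)
          ∈ D.symLT b deg (deg i + (deg j + (s.map deg).sum)) := by
      obtain ⟨c, hc⟩ := hD.z_mul_word i s hs.of_cons
      obtain ⟨v', hv'1, hv'2⟩ := ihw j _ (by omega) _ hv'
      refine ⟨v' + D.abelian.envι (b j) * (D.abelian.envι (b i) * D.word b s), ?_, ?_⟩
      -- `z_i z_Σ` is a unit times a sorted word bounded below by `j`, so here `b j` acts by
      -- multiplication.
      · have : ∀ᶠ N in atTop, pbwIter hD N (b j) (D.abelian.envι (b i) * D.word b s)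
            = D.abelian.envι (b j) * (D.abelian.envι (b i) * D.word b s) := by
          refine eventually_pbwIter_of_succ hD (Eventually.of_forall fun N => ?_)
          rw [hc, Units.smul_def, map_smul, mul_smul_comm,
            pbwStep_of_le hD _ j _ (hs.of_cons.orderedInsert i _)]
          intro t ht
          rcases (List.mem_orderedInsert _).1 ht with rfl | ht
          · exact hij.le
          · exact List.rel_of_pairwise_cons hs ht
        filter_upwards [hv'2, this] with N hN hN'
        rw [← hN', ← hN, ← map_add, sub_add_cancel]
      · rw [add_sub_cancel_right]
        exact IsDiagonal.symLT_mono (by omega) hv'1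
    obtain ⟨v₁, hv₁, hv₁'⟩ := h1
    -- the pseudobracket
    have h2 : D.pseudo (b i ⊗ₜ b j) ∈ eventuallyIn
        (fun N => LinearMap.applyₗ (D.word b s) ∘ₗ two (pbwIter hD N))
        (D.symLT b deg (deg i + (deg j + (s.map deg).sum))) := by
      refine Submodule.span_le.2 ?_ (hQ.pseudo_mem i j)
      rintro _ ⟨l, m, hlm, rfl⟩
      obtain ⟨w, hw, hw'⟩ := ih' m s hs.of_cons (by omega)
      obtain ⟨w', hw1, hw2⟩ := ihw l _ (by omega) _ hw
      refine ⟨w', IsDiagonal.symLT_mono (by omega) hw1, ?_⟩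
      filter_upwards [hw', hw2] with N hN hN'
      simp [hN, hN']
    -- the bracket
    have h3 : D.bracket (b i ⊗ₜ b j) ∈ eventuallyIn
        (fun N => LinearMap.applyₗ (D.word b s) ∘ₗ pbwIter hD N)
        (D.symLT b deg (deg i + (deg j + (s.map deg).sum))) := by
      refine Submodule.span_le.2 ?_ (hQ.bracket_mem i j)
      rintro _ ⟨l, hl, rfl⟩
      obtain ⟨w, hw, hw'⟩ := ih' l s hs.of_cons (by omega)
      exact ⟨w, IsDiagonal.symLT_mono (by omega) hw, hw'⟩
    obtain ⟨v₂, hv₂', hv₂⟩ := h2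
    obtain ⟨v₃, hv₃', hv₃⟩ := h3
    refine ⟨q i j • v₁ + v₂ + v₃, eventually_pbwIter_of_succ hD ?_, ?_⟩
    · filter_upwards [hv, hv₁, hv₂, hv₃] with N h h₁ h₂ h₃
      rw [pbwStep_of_lt hD _ i j s hs hij, h, h₁]
      congr 1
      congr 1
    · have : D.abelian.envι (b i) * D.word b (j :: s)
          = q i j • (D.abelian.envι (b j) * (D.abelian.envι (b i) * D.word b s)) := by
        rw [word_cons, ← mul_assoc, hD.z_mul_z, smul_mul_assoc, mul_assoc]
      rw [this, show ∀ a b c d : D.QSym, a + b + c - d = (a - d) + b + c from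
        fun a b c d => by abel, ← smul_sub]
      exact Submodule.add_mem _ (Submodule.add_mem _ (Submodule.smul_mem _ _ hv₁') hv₂') hv₃'

/-- The limits on basis vectors define the action, and linearity extends the stabilisation to all
vectors. The recursion then follows from one iteration step at an `N` where every term involved has
reached its limit. -/
theorem IsQuadratic.exists_action (hQ : D.IsQuadratic b deg q) :
    ∃ act : L →ₗ[k] Module.End k D.QSym, D.IsPBWAction b deg q act := by
  have hD := hQ.toIsDiagonal
  have h : ∀ (i : ι) (s : Multiset ι), ∃ v,
      (∀ᶠ N in atTop, pbwIter hD N (b i) (hD.zbasis s) = v) ∧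
        v - D.abelian.envι (b i) * hD.zbasis s ∈ D.symLT b deg (deg i + (s.map deg).sum) := by
    intro i s
    have := hQ.exists_limit _ i _ (Multiset.pairwise_sort s _) le_rfl
    rw [← hD.zbasis_sort] at this
    convert this
    rw [← Multiset.sum_coe, ← Multiset.map_coe, Multiset.sort_eq]
  choose v hv hv' using h
  let act : L →ₗ[k] Module.End k D.QSym := b.constr k fun i => hD.zbasis.constr k (v i)
  have hact : ∀ i s, act (b i) (hD.zbasis s) = v i s := fun i s => by simp [act]
  have conv : ∀ x w, ∀ᶠ N in atTop, pbwIter hD N x w = act x w := by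
    intro x w
    induction b.mem_span x using Submodule.span_induction with
    | mem x hx =>
      obtain ⟨i, rfl⟩ := hx
      induction hD.zbasis.mem_span w using Submodule.span_induction with
      | mem w hw =>
        obtain ⟨s, rfl⟩ := hw
        rw [hact]
        exact hv i s
      | zero => simp
      | add y z _ _ hy hz => filter_upwards [hy, hz] with N h1 h2; simp [h1, h2]
      | smul r y _ hy => filter_upwards [hy] with N h1; simp [h1]
    | zero => simp
    | add y z _ _ hy hz => filter_upwards [hy, hz] with N h1 h2; simp [h1, h2]
    | smul r y _ hy => filter_upwards [hy] with N h1; simp [h1]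
  have conv2 : ∀ t w, ∀ᶠ N in atTop, two (pbwIter hD N) t w = two act t w := by
    intro t w
    induction t with
    | zero => simp
    | tmul x y =>
      filter_upwards [conv y w, conv x (act y w)] with N h1 h2
      simp [h1, h2]
    | add y z hy hz => filter_upwards [hy, hz] with N h1 h2; simp [h1, h2]
  have shift : ∀ x w, ∀ᶠ N in atTop, pbwStep hD (pbwIter hD N) x w = act x w := by
    intro x w
    simp only [← pbwIter_succ]
    exact (tendsto_add_atTop_nat 1).eventually (conv x w)
  refine ⟨act, ⟨fun i s hs h => ?_, fun i j s hs hji hjs => ?_, fun i s hs => ?_⟩⟩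
  · obtain ⟨N, hN⟩ := (shift (b i) (D.word b s)).exists
    rw [← hN, pbwStep_of_le hD _ i s hs h]
  · obtain ⟨N, h1, h2, h3, h4, h5⟩ := ((shift (b i) (D.word b (j :: s))).and
      ((conv (b i) (D.word b s)).and ((conv (b j) (act (b i) (D.word b s))).and
        ((conv2 (D.pseudo (b i ⊗ₜ b j)) (D.word b s)).and
          (conv (D.bracket (b i ⊗ₜ b j)) (D.word b s)))))).exists
    rw [← h1, pbwStep_of_lt hD _ i j s (List.pairwise_cons.2 ⟨hjs, hs⟩) hji, h2, h3, h4, h5]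
    rfl
  · have := hv' i s
    rwa [← hact, hD.zbasis_coe s hs, Multiset.map_coe, Multiset.sum_coe] at this

end TLieData

namespace TLieData

variable {k L ι : Type*} [CommRing k] [AddCommGroup L] [Module k L]
variable {D : TLieData k L} {b : Module.Basis ι k L} {deg : ι → ℕ} {q : ι → ι → k}

/-! ### The action is a representation of `U(L)` -/

section Lower

variable {V : Type*} [AddCommGroup V] [Module k V]

/-- The action of `⟨b i, b j⟩ + [b i, b j]`. -/
def lowerOp (D : TLieData k L) (b : Module.Basis ι k L) (act : L →ₗ[k] Module.End k V) (i j : ι) :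
    Module.End k V :=
  two act (D.pseudo (b i ⊗ₜ b j)) + act (D.bracket (b i ⊗ₜ b j))

/-- The defining relation of `U(L)` for the basis elements `b i`, `b j` holds on `w`. -/
def Straightens (D : TLieData k L) (b : Module.Basis ι k L) (q : ι → ι → k)
    (act : L →ₗ[k] Module.End k V) (i j : ι) (w : V) : Prop :=
  act (b i) (act (b j) w) = q i j • act (b j) (act (b i) w) + D.lowerOp b act i j w

/-- The difference of the two ways of reordering `b x ⊗ b y ⊗ b z`, without leading terms. -/
def overlap (D : TLieData k L) (b : Module.Basis ι k L) (q : ι → ι → k)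
    (act : L →ₗ[k] Module.End k V) (x y z : ι) (w : V) : V :=
  (q x z * q y z) • act (b z) (D.lowerOp b act x y w) - D.lowerOp b act x y (act (b z) w)
    + act (b x) (D.lowerOp b act y z w) - (q x y * q x z) • D.lowerOp b act y z (act (b x) w)
    - q x y • act (b y) (D.lowerOp b act x z w) + q y z • D.lowerOp b act x z (act (b y) w)

theorem Straightens.add {act : L →ₗ[k] Module.End k V} {i j : ι} {v w : V}
    (hv : D.Straightens b q act i j v) (hw : D.Straightens b q act i j w) :
    D.Straightens b q act i j (v + w) := by
  unfold Straightens at *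
  simp only [map_add, hv, hw]
  module

theorem Straightens.smul {act : L →ₗ[k] Module.End k V} {i j : ι} {v : V} (r : k)
    (hv : D.Straightens b q act i j v) : D.Straightens b q act i j (r • v) := by
  unfold Straightens at *
  simp only [map_smul, hv]
  module

theorem Straightens.zero {act : L →ₗ[k] Module.End k V} {i j : ι} :
    D.Straightens b q act i j (0 : V) := by
  simp [Straightens]

theorem IsQuadratic.lowerOp_swap (hQ : D.IsQuadratic b deg q) (act : L →ₗ[k] Module.End k V)
    (i j : ι) : D.lowerOp b act i j = -(q i j • D.lowerOp b act j i) := by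
  rw [lowerOp, lowerOp, hQ.bracket_swap i j, hQ.pseudo_swap i j]
  simp only [map_neg, map_smul]
  module

/-- By antisymmetry the relation for `(j, i)` is a multiple of the one for `(i, j)`; with the
trivial relation for equal letters, only decreasing pairs remain to be treated. -/
theorem IsQuadratic.straightens_swap (hQ : D.IsQuadratic b deg q)
    {act : L →ₗ[k] Module.End k V} {i j : ι} {w : V} (h : D.Straightens b q act i j w) :
    D.Straightens b q act j i w := by
  unfold Straightens at *
  rw [h, smul_add, smul_smul, hQ.q_mul, hQ.lowerOp_swap act j i]
  simp

theorem IsQuadratic.straightens_self (hQ : D.IsQuadratic b deg q)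
    (act : L →ₗ[k] Module.End k V) (i : ι) (w : V) : D.Straightens b q act i i w := by
  simp [Straightens, lowerOp, hQ.q_self, hQ.bracket_self, hQ.pseudo_self]

end Lower

variable [LinearOrder ι] {act : L →ₗ[k] Module.End k D.QSym}

theorem IsPBWAction.act_mem (hact : D.IsPBWAction b deg q act) (hD : D.IsDiagonal b q) (i : ι)
    {p : ℕ} {w : D.QSym} (hw : w ∈ D.symLT b deg p) :
    act (b i) w ∈ D.symLT b deg (deg i + p) := by
  have : D.symLT b deg p ≤ (D.symLT b deg (deg i + p)).comap (act (b i)) := by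
    refine Submodule.span_le.2 ?_
    rintro _ ⟨s, hs, hsp, rfl⟩
    change act (b i) (D.word b s) ∈ D.symLT b deg _
    rw [← sub_add_cancel (act (b i) (D.word b s)) (D.abelian.envι (b i) * D.word b s)]
    exact Submodule.add_mem _ (IsDiagonal.symLT_mono (by omega) (hact.lower i s hs))
      (hD.z_mul_word_mem i hs (by omega))
  exact this hw

/-- In this range the relation is the recursion that defines the action. -/
theorem IsPBWAction.straightens_of_le (hact : D.IsPBWAction b deg q act) {i j : ι} {s : List ι}
    (hs : s.Pairwise (· ≤ ·)) (hji : j < i) (hj : ∀ t ∈ s, j ≤ t) :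
    D.Straightens b q act i j (D.word b s) := by
  rw [Straightens, hact.of_le j s hs hj, ← word_cons, hact.of_lt i j s hs hji hj, add_assoc]
  rfl

/-- The relations hold on the whole of `𝒮(L)` if all the overlaps resolve, where the relations may
be used in lower degree. -/
theorem IsPBWAction.straightens (hact : D.IsPBWAction b deg q act) (hQ : D.IsQuadratic b deg q)
    (hres : ∀ (x y z : ι) (s : List ι), z < y → y < x → s.Pairwise (· ≤ ·) → (∀ t ∈ s, z ≤ t) →
      (∀ (u v : ι) (p : ℕ), deg u + deg v + p ≤ deg x + deg y + deg z + (s.map deg).sum →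
        ∀ w ∈ D.symLT b deg p, D.Straightens b q act u v w) →
      D.overlap b q act x y z (D.word b s) = 0) (u v : ι) (w : D.QSym) :
    D.Straightens b q act u v w := by
  have hD := hQ.toIsDiagonal
  suffices H : ∀ (p : ℕ) (s : List ι), s.Pairwise (· ≤ ·) → ∀ u v : ι,
      deg u + deg v + (s.map deg).sum ≤ p → D.Straightens b q act u v (D.word b s) by
    induction hD.zbasis.mem_span w using Submodule.span_induction with
    | mem w hw =>
      obtain ⟨s, rfl⟩ := hw
      rw [hD.zbasis_sort]
      exact H _ _ (Multiset.pairwise_sort s _) u v le_rfl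
    | zero => exact Straightens.zero
    | add x y _ _ hx hy => exact hx.add hy
    | smul r x _ hx => exact hx.smul r
  intro p
  induction p using Nat.strong_induction_on with
  | _ p ih =>
  have ihw : ∀ (u v : ι) (p' : ℕ), deg u + deg v + p' ≤ p → ∀ w ∈ D.symLT b deg p',
      D.Straightens b q act u v w := by
    intro u v p' hp' w hw
    induction hw using Submodule.span_induction with
    | mem w hw =>
      obtain ⟨s, hs, hsp, rfl⟩ := hw
      exact ih (deg u + deg v + (s.map deg).sum) (by omega) s hs u v le_rfl
    | zero => exact Straightens.zero
    | add x y _ _ hx hy => exact hx.add hy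
    | smul r x _ hx => exact hx.smul r
  intro s
  induction s with
  | nil =>
    intro hs u v _
    rcases lt_trichotomy v u with h | rfl | h
    · exact hact.straightens_of_le hs h (by simp)
    · exact hQ.straightens_self _ _ _
    · exact hQ.straightens_swap (hact.straightens_of_le hs h (by simp))
  | cons z s ihs =>
    intro hs
    suffices H : ∀ x y : ι, y < x → deg x + deg y + ((z :: s).map deg).sum ≤ p →
        D.Straightens b q act x y (D.word b (z :: s)) by
      intro u v huv
      rcases lt_trichotomy v u with h | rfl | h
      · exact H u v h huv
      · exact hQ.straightens_self _ _ _
      · exact hQ.straightens_swap (H v u h (by omega))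
    intro x y hyx hp
    have hs' := hs.of_cons
    have hz : ∀ t ∈ s, z ≤ t := fun t ht => List.rel_of_pairwise_cons hs ht
    rcases le_or_gt y z with hyz | hzy
    · refine hact.straightens_of_le hs hyx fun t ht => ?_
      rcases List.mem_cons.1 ht with rfl | ht
      · exact hyz
      · exact hyz.trans (hz t ht)
    simp only [List.map_cons, List.sum_cons] at hp
    -- `b j` sends `z_Σ` to `z_j z_Σ` plus lower terms. The former is a unit times a sorted word
    -- bounded below by `z`, where the relation with `z` is the recursion; the lower terms are
    -- covered by induction on the degree.
    have aux : ∀ i j : ι, z < i → z < j → deg i + deg j + (deg z + (s.map deg).sum) ≤ p →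
        D.Straightens b q act i z (act (b j) (D.word b s)) := by
      intro i j hi hj hij
      rw [← sub_add_cancel (act (b j) (D.word b s)) (D.abelian.envι (b j) * D.word b s)]
      refine (ihw i z _ (by omega) _ (hact.lower j s hs')).add ?_
      obtain ⟨c, hc⟩ := hD.z_mul_word j s hs'
      rw [hc]
      refine (hact.straightens_of_le (hs'.orderedInsert j _) hi ?_).smul (c : k)
      intro t ht
      rcases (List.mem_orderedInsert _).1 ht with rfl | ht
      · exact hj.le
      · exact hz t ht
    have hzw : D.word b (z :: s) = act (b z) (D.word b s) := by
      rw [hact.of_le z s hs' hz, word_cons]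
    have h1 := hact.straightens_of_le hs' hzy hz
    have h2 := hact.straightens_of_le hs' (hzy.trans hyx) hz
    have h3 := aux x y (hzy.trans hyx) hzy (by omega)
    have h4 := aux y x hzy (hzy.trans hyx) (by omega)
    -- Induction on the length is needed here: `z` may have degree `0`, and then the total degree
    -- does not drop.
    have h5 := ihs hs' x y (by omega)
    have h6 := hres x y z s hzy hyx hs' hz fun u v p' hp' => ihw u v p' (by omega)
    rw [hzw]
    unfold Straightens at *
    have h1' := congrArg (act (b x)) h1
    have h2' := congrArg (act (b y)) h2
    have h5' := congrArg (act (b z)) h5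
    simp only [map_add, map_smul] at h1' h2' h5'
    unfold overlap at h6
    -- Both `x y z` (by `h1'`, `h3`, `h5'`) and `q_(x,y) y x z` (by `h2'`, `h4`) become the same
    -- multiple of `z y x`; the remaining terms, together with the lower term of the goal, form the
    -- overlap `h6`.
    linear_combination (norm := module) h1' - q x y • h2' + (q y z) • h3 - (q x y * q x z) • h4
      + (q y z * q x z) • h5' + h6

/-- `𝒮(L)` as a representation of `U(L)`. -/
def envRep (hst : ∀ u v w, D.Straightens b q act u v w) (hD : D.IsDiagonal b q) :
    D.Env →ₐ[k] Module.End k D.QSym :=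
  D.liftEnv b act fun i j => LinearMap.ext fun w => by
    have := hst i j w
    simp only [Straightens, lowerOp] at this
    simp [hD.presym_basis, this, add_assoc]

/-! ### The isomorphism of `𝒮(L)` with the graded algebra of `U(L)` -/

variable {gr : ℕ → Submodule k L}

omit [LinearOrder ι] in
theorem envι_basis_mem (hgr : ∀ c, gr c = Submodule.span k {x | ∃ i, deg i = c ∧ x = b i})
    (i : ι) : b i ∈ gr (deg i) := by
  rw [hgr]
  exact Submodule.subset_span ⟨i, rfl, rfl⟩

omit [LinearOrder ι] in
/-- Products of basis elements of total degree at most `m` span `U_m`. -/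
theorem envFil_eq_span (hgr : ∀ c, gr c = Submodule.span k {x | ∃ i, deg i = c ∧ x = b i}) (m : ℕ) :
    (D.envFil gr).F m = Submodule.span k
      {u | ∃ s : List ι, (s.map deg).sum ≤ m ∧ u = (s.map fun i => D.envι (b i)).prod} := by
  apply le_antisymm
  · change (tensorFil gr m).map D.proj.toLinearMap ≤ _
    rw [tensorFil]
    simp only [Submodule.map_iSup, iSup_le_iff]
    intro l hl
    -- The degree is kept exact, so that the induction on `l` does not involve the bound `m`.
    have key : ((l.map fun η => (gr η).map (TensorAlgebra.ι k)).prod).map D.proj.toLinearMap ≤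
        Submodule.span k {u | ∃ s : List ι, (s.map deg).sum = l.sum ∧
          u = (s.map fun i => D.envι (b i)).prod} := by
      clear hl
      induction l with
      | nil =>
        simp only [List.map_nil, List.prod_nil]
        rintro _ ⟨t, ht, rfl⟩
        obtain ⟨r, rfl⟩ := Submodule.mem_one.1 ht
        rw [AlgHom.toLinearMap_apply, AlgHom.commutes, Algebra.algebraMap_eq_smul_one]
        exact Submodule.smul_mem _ _ (Submodule.subset_span ⟨[], by simp⟩)
      | cons η l ihl =>
        rw [List.map_cons, List.prod_cons, Submodule.map_mul]
        refine (mul_le_mul' le_rfl ihl).trans ?_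
        rw [hgr, Submodule.map_span, Submodule.map_span, Submodule.span_mul_span]
        refine Submodule.span_mono ?_
        rintro _ ⟨_, ⟨_, ⟨_, ⟨i, rfl, rfl⟩, rfl⟩, rfl⟩, _, ⟨s, hs, rfl⟩, rfl⟩
        exact ⟨i :: s, by simp [hs], by simp [proj_ι]⟩
    refine key.trans (Submodule.span_mono ?_)
    rintro _ ⟨s, hs, rfl⟩
    exact ⟨s, hs.trans_le hl, rfl⟩
  · refine Submodule.span_le.2 ?_
    rintro _ ⟨s, hs, rfl⟩
    refine (D.envFil gr).mono hs ?_
    clear hs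
    induction s with
    | nil => exact (D.envFil gr).one_mem
    | cons i s ih =>
      simp only [List.map_cons, List.prod_cons, List.sum_cons]
      exact (D.envFil gr).mul_mem (D.envι_mem gr _ _ (envι_basis_mem hgr i)) ih

end TLieData

/-! ### Symbols in the associated graded algebra. -/

namespace AlgFiltration

variable {k A : Type*} [CommRing k] [Ring A] [Algebra k A] (E : AlgFiltration k A)

/-- The class of an element of `F m` in the associated graded algebra. -/
def symbol (m : ℕ) : E.F m →ₗ[k] E.AssocGraded :=
  DirectSum.lof k ℕ E.Gr m ∘ₗ Submodule.mkQ _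

theorem symbol_apply {m : ℕ} (a : A) (ha : a ∈ E.F m) :
    E.symbol m ⟨a, ha⟩ = DirectSum.of E.Gr m (E.cls a ha) := rfl

theorem symbol_mul {m n : ℕ} (a c : A) (ha : a ∈ E.F m) (hc : c ∈ E.F n) :
    E.symbol m ⟨a, ha⟩ * E.symbol n ⟨c, hc⟩ = E.symbol (m + n) ⟨a * c, E.mul_mem ha hc⟩ := by
  rw [symbol_apply, symbol_apply, DirectSum.of_mul_of]
  rfl

theorem symbol_congr {m n : ℕ} (h : m = n) {a : A} (ha : a ∈ E.F m) (ha' : a ∈ E.F n) :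
    E.symbol m ⟨a, ha⟩ = E.symbol n ⟨a, ha'⟩ := by
  subst h
  rfl

theorem symbol_eq_zero {m : ℕ} {a : A} (ha : a ∈ E.F m) :
    E.symbol m ⟨a, ha⟩ = 0 ↔ a ∈ E.prev m := by
  rw [symbol_apply, map_eq_zero_iff _ (DirectSum.of_injective m)]
  exact Submodule.Quotient.mk_eq_zero _

theorem symbol_eq_symbol {m : ℕ} {a c : A} (ha : a ∈ E.F m) (hc : c ∈ E.F m) :
    E.symbol m ⟨a, ha⟩ = E.symbol m ⟨c, hc⟩ ↔ a - c ∈ E.prev m := by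
  rw [symbol_apply, symbol_apply, (DirectSum.of_injective m).eq_iff]
  exact Submodule.Quotient.eq _

theorem symbol_one : E.symbol 0 ⟨1, E.one_mem⟩ = 1 := rfl

/-- An exhaustively filtered algebra is a domain if its associated graded algebra is. -/
theorem isDomain_of_assocGraded [IsDomain E.AssocGraded] (hE : ∀ a, ∃ m, a ∈ E.F m) :
    IsDomain A := by
  classical
  have : Nontrivial A := by
    refine ⟨1, 0, fun h => ?_⟩
    have h1 : E.symbol 0 ⟨1, E.one_mem⟩ = 0 := (E.symbol_eq_zero _).2 (h ▸ Submodule.zero_mem _)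
    exact one_ne_zero (E.symbol_one.symm.trans h1)
  have key : ∀ a : A, a ≠ 0 → ∃ (m : ℕ) (ha : a ∈ E.F m), E.symbol m ⟨a, ha⟩ ≠ 0 := by
    intro a ha
    -- The symbol is taken in the first step of the filtration that contains `a`; it cannot vanish
    -- there, as `a` would then lie in the preceding step.
    refine ⟨Nat.find (hE a), Nat.find_spec (hE a), fun h => ?_⟩
    rw [symbol_eq_zero] at h
    cases hm : Nat.find (hE a) with
    | zero =>
      rw [hm] at h
      exact ha (by simpa [prev] using h)
    | succ m =>
      rw [hm] at h
      exact Nat.find_min (hE a) (m := m) (by omega) h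
  have : NoZeroDivisors A := ⟨by
    intro a c hac
    by_contra! hne
    obtain ⟨m, ha, ha'⟩ := key a hne.1
    obtain ⟨n, hc, hc'⟩ := key c hne.2
    have := mul_ne_zero ha' hc'
    rw [symbol_mul, Ne, symbol_eq_zero] at this
    exact this (hac ▸ Submodule.zero_mem _)⟩
  exact NoZeroDivisors.to_isDomain _

end AlgFiltration

/-! ### The symbol map from `𝒮(L)` and its left inverse. -/

namespace TLieData

variable {k L ι : Type*} [CommRing k] [AddCommGroup L] [Module k L]
variable {D : TLieData k L} {b : Module.Basis ι k L} {deg : ι → ℕ} {q : ι → ι → k}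
variable {gr : ℕ → Submodule k L}

theorem prod_mem_envFil (hgr : ∀ c, gr c = Submodule.span k {x | ∃ i, deg i = c ∧ x = b i})
    (s : List ι) : (s.map fun i => D.envι (b i)).prod ∈ (D.envFil gr).F (s.map deg).sum := by
  rw [envFil_eq_span hgr]
  exact Submodule.subset_span ⟨s, le_rfl, rfl⟩

theorem envFil_exhaustive (hgr : ∀ c, gr c = Submodule.span k {x | ∃ i, deg i = c ∧ x = b i})
    (u : D.Env) : ∃ m, u ∈ (D.envFil gr).F m := by
  have h : (⨆ m, (D.envFil gr).F m) = ⊤ := by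
    refine env_submodule_eq_top D b _ (Submodule.mem_iSup_of_mem 0 (D.envFil gr).one_mem) ?_
    intro i w hw
    obtain ⟨m, hm⟩ := (Submodule.mem_iSup_of_directed _ (D.envFil gr).mono.directed_le).1 hw
    exact Submodule.mem_iSup_of_mem (deg i + m)
      ((D.envFil gr).mul_mem (D.envι_mem gr _ _ (envι_basis_mem hgr i)) hm)
  exact (Submodule.mem_iSup_of_directed _ (D.envFil gr).mono.directed_le).1 (h ▸ Submodule.mem_top)

/-- The linear map `L → G` that sends `x ∈ L_m` to the class of `π(x)`. -/
def grι (D : TLieData k L) (hgr : ∀ c, gr c = Submodule.span k {x | ∃ i, deg i = c ∧ x = b i}) :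
    L →ₗ[k] D.GrEnv gr :=
  b.constr k fun i => (D.envFil gr).symbol (deg i)
    ⟨D.envι (b i), D.envι_mem gr _ _ (envι_basis_mem hgr i)⟩

theorem grι_basis (hgr : ∀ c, gr c = Submodule.span k {x | ∃ i, deg i = c ∧ x = b i}) (i : ι) :
    D.grι hgr (b i) = (D.envFil gr).symbol (deg i)
      ⟨D.envι (b i), D.envι_mem gr _ _ (envι_basis_mem hgr i)⟩ := by
  simp [grι]

theorem grι_of_mem (hgr : ∀ c, gr c = Submodule.span k {x | ∃ i, deg i = c ∧ x = b i})
    (m : ℕ) (x : L) (hx : x ∈ gr m) :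
    D.grι hgr x = (D.envFil gr).symbol m ⟨D.envι x, D.envι_mem gr m x hx⟩ := by
  have hle : ∀ x ∈ Submodule.span k {x | ∃ i, deg i = m ∧ x = b i}, x ∈ gr m := fun x hx => by
    rwa [hgr]
  have hx' := hx
  rw [hgr] at hx'
  induction hx' using Submodule.span_induction with
  | mem x hx' =>
    obtain ⟨i, rfl, rfl⟩ := hx'
    exact grι_basis hgr i
  | zero =>
    rw [map_zero, eq_comm]
    convert map_zero ((D.envFil gr).symbol m)
    simp
  | add x y hx1 hy1 ihx ihy =>
    rw [map_add, ihx (hle _ hx1), ihy (hle _ hy1), ← map_add]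
    congr 1
    ext
    simp
  | smul r x hx1 ihx =>
    rw [map_smul, ihx (hle _ hx1), ← map_smul]
    congr 1
    ext
    simp

/-- Bracket and pseudobracket lie in lower degree, so the classes of the generators satisfy the
relations of `𝒮(L)`; this makes `qSymToGr` well defined. -/
theorem IsQuadratic.commutator_mem (hQ : D.IsQuadratic b deg q)
    (hgr : ∀ c, gr c = Submodule.span k {x | ∃ i, deg i = c ∧ x = b i}) (i j : ι) :
    D.envι (b i) * D.envι (b j) - q i j • (D.envι (b j) * D.envι (b i))
      ∈ (D.envFil gr).prev (deg i + deg j) := by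
  have key : ∀ (p : ℕ) (u : D.Env), (∃ m < p, u ∈ (D.envFil gr).F m) → u ∈ (D.envFil gr).prev p := by
    rintro p u ⟨m, hm, hu⟩
    obtain ⟨p, rfl⟩ : ∃ p', p = p' + 1 := ⟨p - 1, by omega⟩
    exact (D.envFil gr).mono (Nat.lt_succ_iff.1 hm) hu
  rw [envι_mul, hQ.presym_basis, map_smul, two_tmul, add_assoc, add_sub_cancel_left]
  refine Submodule.add_mem _ ?_ ?_
  · have : Submodule.span k {t | ∃ l m, deg l + deg m < deg i + deg j ∧ t = b l ⊗ₜ b m}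
        ≤ ((D.envFil gr).prev (deg i + deg j)).comap (two D.envι) := by
      refine Submodule.span_le.2 ?_
      rintro _ ⟨l, m, hlm, rfl⟩
      refine key _ _ ⟨_, hlm, ?_⟩
      rw [two_tmul]
      exact (D.envFil gr).mul_mem (D.envι_mem gr _ _ (envι_basis_mem hgr l))
        (D.envι_mem gr _ _ (envι_basis_mem hgr m))
    exact this (hQ.pseudo_mem i j)
  · have : Submodule.span k {x | ∃ l, deg l < deg i + deg j ∧ x = b l}
        ≤ ((D.envFil gr).prev (deg i + deg j)).comap D.envι := by
      refine Submodule.span_le.2 ?_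
      rintro _ ⟨l, hl, rfl⟩
      exact key _ _ ⟨_, hl, D.envι_mem gr _ _ (envι_basis_mem hgr l)⟩
    exact this (hQ.bracket_mem i j)

/-- The homomorphism `𝒮(L) → G`, `z_x ↦ π(x)`. -/
def qSymToGr (hQ : D.IsQuadratic b deg q)
    (hgr : ∀ c, gr c = Submodule.span k {x | ∃ i, deg i = c ∧ x = b i}) :
    D.QSym →ₐ[k] D.GrEnv gr :=
  D.abelian.liftEnv (A := D.GrEnv gr) b (D.grι hgr) fun i j => by
    simp only [abelian_bracket, abelian_pseudo, abelian_presym, LinearMap.zero_apply, map_zero,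
      add_zero, hQ.presym_basis, map_smul, two_tmul]
    -- The two products live in the components `deg i + deg j` and `deg j + deg i`, which must be
    -- identified before their symbols can be compared.
    rw [grι_basis, grι_basis, AlgFiltration.symbol_mul, AlgFiltration.symbol_mul,
      (D.envFil gr).symbol_congr (add_comm (deg j) (deg i)) _
        (add_comm (deg j) (deg i) ▸ AlgFiltration.mul_mem _
          (D.envι_mem gr _ _ (envι_basis_mem hgr j)) (D.envι_mem gr _ _ (envι_basis_mem hgr i))),
      ← map_smul]
    exact ((D.envFil gr).symbol_eq_symbol _ _).2 (hQ.commutator_mem hgr i j)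

theorem qSymToGr_envι (hQ : D.IsQuadratic b deg q)
    (hgr : ∀ c, gr c = Submodule.span k {x | ∃ i, deg i = c ∧ x = b i}) (x : L) :
    qSymToGr hQ hgr (D.abelian.envι x) = D.grι hgr x := by
  rw [qSymToGr, liftEnv_envι]

theorem qSymToGr_word (hQ : D.IsQuadratic b deg q)
    (hgr : ∀ c, gr c = Submodule.span k {x | ∃ i, deg i = c ∧ x = b i}) (s : List ι) :
    qSymToGr hQ hgr (D.word b s) = (D.envFil gr).symbol (s.map deg).sum
      ⟨(s.map fun i => D.envι (b i)).prod, prod_mem_envFil hgr s⟩ := by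
  induction s with
  | nil =>
    rw [show D.word b [] = 1 from rfl, map_one]
    rfl
  | cons i s ih =>
    rw [word_cons, map_mul, qSymToGr_envι, grι_basis, ih, AlgFiltration.symbol_mul]
    rfl

/-- `U_m` is spanned by products of basis elements of total degree at most `m`. The class of such a
product is the image of a word if the degree is `m`, and zero otherwise. -/
theorem qSymToGr_surjective (hQ : D.IsQuadratic b deg q)
    (hgr : ∀ c, gr c = Submodule.span k {x | ∃ i, deg i = c ∧ x = b i}) :
    Function.Surjective (qSymToGr hQ hgr) := by
  have key : ∀ m (a : D.Env), a ∈ (D.envFil gr).F m →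
      ∃ ha : a ∈ (D.envFil gr).F m, ∃ w, qSymToGr hQ hgr w = (D.envFil gr).symbol m ⟨a, ha⟩ := by
    intro m a ha
    rw [envFil_eq_span hgr] at ha
    induction ha using Submodule.span_induction with
    | mem a ha =>
      obtain ⟨s, hs, rfl⟩ := ha
      have h1 := prod_mem_envFil (D := D) hgr s
      refine ⟨(D.envFil gr).mono hs h1, ?_⟩
      rcases hs.eq_or_lt with rfl | hs
      · exact ⟨_, qSymToGr_word hQ hgr s⟩
      · refine ⟨0, ?_⟩
        rw [map_zero, eq_comm, AlgFiltration.symbol_eq_zero]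
        obtain ⟨m, rfl⟩ : ∃ m', m = m' + 1 := ⟨m - 1, by omega⟩
        exact (D.envFil gr).mono (Nat.lt_succ_iff.1 hs) h1
    | zero => exact ⟨Submodule.zero_mem _, 0, by rw [map_zero]; exact (map_zero _).symm⟩
    | add x y _ _ hx hy =>
      obtain ⟨hx, w, hw⟩ := hx
      obtain ⟨hy, v, hv⟩ := hy
      exact ⟨Submodule.add_mem _ hx hy, w + v, by rw [map_add, hw, hv, ← map_add]; rfl⟩
    | smul r x _ hx =>
      obtain ⟨hx, w, hw⟩ := hx
      exact ⟨Submodule.smul_mem _ r hx, r • w, by rw [map_smul, hw, ← map_smul]; rfl⟩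
  intro g
  induction g using DirectSum.induction_on with
  | zero => exact ⟨0, map_zero _⟩
  | of m x =>
    obtain ⟨a, ha, rfl⟩ := (D.envFil gr).exists_cls x
    obtain ⟨_, w, hw⟩ := key m a ha
    exact ⟨w, hw⟩
  | add x y hx hy =>
    obtain ⟨v, rfl⟩ := hx
    obtain ⟨w, rfl⟩ := hy
    exact ⟨v + w, map_add _ _ _⟩

variable [LinearOrder ι] {act : L →ₗ[k] Module.End k D.QSym}

omit [LinearOrder ι] in
theorem envRep_envι (hst : ∀ u v w, D.Straightens b q act u v w) (hD : D.IsDiagonal b q) (x : L) :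
    envRep hst hD (D.envι x) = act x :=
  liftEnv_envι D b act _ x

/-- Each factor raises the degree by at most its own, so `U_m` sends `1` into degree at most `m`,
which is `symLT` at `m + 1`. Hence the degree `m` part of `u · 1` depends only on `u` modulo
`U_(m-1)`. -/
theorem envRep_mem (hact : D.IsPBWAction b deg q act)
    (hst : ∀ u v w, D.Straightens b q act u v w) (hD : D.IsDiagonal b q)
    (hgr : ∀ c, gr c = Submodule.span k {x | ∃ i, deg i = c ∧ x = b i}) {m : ℕ} {u : D.Env}
    (hu : u ∈ (D.envFil gr).F m) : envRep hst hD u 1 ∈ D.symLT b deg (m + 1) := by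
  rw [envFil_eq_span hgr] at hu
  induction hu using Submodule.span_induction with
  | mem u hu =>
    obtain ⟨s, hs, rfl⟩ := hu
    refine IsDiagonal.symLT_mono (Nat.add_le_add_right hs 1) ?_
    clear hs
    induction s with
    | nil =>
      have := IsDiagonal.word_mem_symLT (D := D) (b := b) (deg := deg) (s := []) (p := 1) (by simp)
        (by simp)
      simpa [word] using this
    | cons i s ih =>
      simp only [List.map_cons, List.prod_cons, List.sum_cons, map_mul, Module.End.mul_apply]
      rw [envRep_envι, add_assoc]
      exact hact.act_mem hD i ih
  | zero => simp
  | add x y _ _ hx hy =>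
    rw [map_add, LinearMap.add_apply]
    exact Submodule.add_mem _ hx hy
  | smul r x _ hx =>
    rw [map_smul, LinearMap.smul_apply]
    exact Submodule.smul_mem _ r hx

/-- In a sorted product every factor meets only letters at least as large as itself, on which it
acts by multiplication. -/
theorem envRep_prod (hact : D.IsPBWAction b deg q act)
    (hst : ∀ u v w, D.Straightens b q act u v w) (hD : D.IsDiagonal b q) (s : List ι)
    (hs : s.Pairwise (· ≤ ·)) :
    envRep hst hD (s.map fun i => D.envι (b i)).prod 1 = D.word b s := by
  induction s with
  | nil => simp [word]
  | cons i s ih =>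
    simp only [List.map_cons, List.prod_cons, map_mul, Module.End.mul_apply]
    rw [ih hs.of_cons, envRep_envι,
      hact.of_le i s hs.of_cons fun t ht => List.rel_of_pairwise_cons hs ht, word_cons]

/-- The projection of `𝒮(L)` on its component of degree `m`. -/
def degreePart (hD : D.IsDiagonal b q) (deg : ι → ℕ) (m : ℕ) : D.QSym →ₗ[k] D.QSym :=
  hD.zbasis.constr k fun s => if (s.map deg).sum = m then hD.zbasis s else 0

theorem degreePart_word (hD : D.IsDiagonal b q) (m : ℕ) (s : List ι) (hs : s.Pairwise (· ≤ ·)) :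
    degreePart hD deg m (D.word b s) = if (s.map deg).sum = m then D.word b s else 0 := by
  rw [← hD.zbasis_coe s hs, degreePart, Module.Basis.constr_basis]
  exact if_congr (by rw [Multiset.map_coe, Multiset.sum_coe]) rfl rfl

theorem degreePart_eq_zero (hD : D.IsDiagonal b q) (m : ℕ) {w : D.QSym}
    (hw : w ∈ D.symLT b deg m) : degreePart hD deg m w = 0 := by
  rw [← LinearMap.mem_ker]
  refine Submodule.span_le.2 ?_ hw
  rintro _ ⟨s, hs, hsm, rfl⟩
  change degreePart hD deg m _ = 0
  rw [degreePart_word hD m s hs, if_neg hsm.ne]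

/-- The leading term in `𝒮(L)` of the class of an element of `U(L)`. -/
def grToQSym (hact : D.IsPBWAction b deg q act)
    (hst : ∀ u v w, D.Straightens b q act u v w) (hD : D.IsDiagonal b q)
    (hgr : ∀ c, gr c = Submodule.span k {x | ∃ i, deg i = c ∧ x = b i}) :
    D.GrEnv gr →ₗ[k] D.QSym :=
  DirectSum.toModule k ℕ _ fun m => Submodule.liftQ _
    (degreePart hD deg m ∘ₗ LinearMap.applyₗ 1 ∘ₗ (envRep hst hD).toLinearMap ∘ₗ
      ((D.envFil gr).F m).subtype) (by
    intro u hu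
    rw [LinearMap.mem_ker]
    refine degreePart_eq_zero hD m ?_
    change envRep hst hD u 1 ∈ _
    have hu' : (u : D.Env) ∈ (D.envFil gr).prev m := hu
    cases m with
    | zero =>
      have : (u : D.Env) = 0 := by simpa [AlgFiltration.prev] using hu'
      rw [this, map_zero]
      exact Submodule.zero_mem _
    | succ m => exact envRep_mem hact hst hD hgr hu')

theorem grToQSym_symbol (hact : D.IsPBWAction b deg q act)
    (hst : ∀ u v w, D.Straightens b q act u v w) (hD : D.IsDiagonal b q)
    (hgr : ∀ c, gr c = Submodule.span k {x | ∃ i, deg i = c ∧ x = b i}) (m : ℕ) (u : D.Env)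
    (hu : u ∈ (D.envFil gr).F m) : grToQSym hact hst hD hgr ((D.envFil gr).symbol m ⟨u, hu⟩)
      = degreePart hD deg m (envRep hst hD u 1) := by
  rw [grToQSym, AlgFiltration.symbol, LinearMap.comp_apply, DirectSum.toModule_lof]
  rfl

/-- `grToQSym` is a left inverse: on a sorted word it takes the top degree part of the same word. -/
theorem qSymToGr_injective (hQ : D.IsQuadratic b deg q) (hact : D.IsPBWAction b deg q act)
    (hst : ∀ u v w, D.Straightens b q act u v w)
    (hgr : ∀ c, gr c = Submodule.span k {x | ∃ i, deg i = c ∧ x = b i}) :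
    Function.Injective (qSymToGr hQ hgr) := by
  have hD := hQ.toIsDiagonal
  have : grToQSym hact hst hD hgr ∘ₗ (qSymToGr hQ hgr).toLinearMap = LinearMap.id := by
    refine hD.zbasis.ext fun s => ?_
    rw [hD.zbasis_sort, LinearMap.comp_apply, AlgHom.toLinearMap_apply, qSymToGr_word,
      grToQSym_symbol, envRep_prod hact hst hD _ (Multiset.pairwise_sort s _),
      degreePart_word hD _ _ (Multiset.pairwise_sort s _), if_pos rfl]
    rfl
  exact Function.LeftInverse.injective (g := grToQSym hact hst hD hgr)
    fun w => LinearMap.congr_fun this w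

/-- All overlaps `b x ⊗ b y ⊗ b z`, `x > y > z`, resolve on the sorted monomials that `z` bounds
from below, for every action of `L` on `𝒮(L)` for which the relations hold in lower degree. -/
def OverlapsResolve (D : TLieData k L) (b : Module.Basis ι k L) (deg : ι → ℕ) (q : ι → ι → k) :
    Prop :=
  ∀ act : L →ₗ[k] Module.End k D.QSym, D.IsPBWAction b deg q act →
    ∀ (x y z : ι) (s : List ι), z < y → y < x → s.Pairwise (· ≤ ·) → (∀ t ∈ s, z ≤ t) →
      (∀ (u v : ι) (p : ℕ), deg u + deg v + p ≤ deg x + deg y + deg z + (s.map deg).sum →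
        ∀ w ∈ D.symLT b deg p, D.Straightens b q act u v w) →
      D.overlap b q act x y z (D.word b s) = 0

/-- The Poincaré–Birkhoff–Witt theorem. -/
theorem IsQuadratic.exists_equiv (hQ : D.IsQuadratic b deg q) (hres : D.OverlapsResolve b deg q)
    (hgr : ∀ c, gr c = Submodule.span k {x | ∃ i, deg i = c ∧ x = b i}) :
    ∃ ω : D.QSym ≃ₐ[k] D.GrEnv gr, ∀ (m : ℕ) (x : L) (hx : x ∈ gr m),
      ω (D.abelian.envι x) =
        DirectSum.of (D.envFil gr).Gr m ((D.envFil gr).cls (D.envι x) (D.envι_mem gr m x hx)) := by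
  obtain ⟨act, hact⟩ := hQ.exists_action
  have hst := hact.straightens hQ (hres act hact)
  have hbij : Function.Bijective (qSymToGr hQ hgr) :=
    ⟨qSymToGr_injective hQ hact hst hgr, qSymToGr_surjective hQ hgr⟩
  refine ⟨AlgEquiv.ofBijective (qSymToGr hQ hgr) hbij, fun m x hx => ?_⟩
  change qSymToGr hQ hgr _ = _
  rw [qSymToGr_envι, grι_of_mem hgr m x hx]
  rfl

theorem IsQuadratic.isDomain [IsDomain k] (hQ : D.IsQuadratic b deg q)
    (hres : D.OverlapsResolve b deg q) : IsDomain D.Env := by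
  -- The conclusion mentions no grading, so the one defined by the degrees of the basis is used; it
  -- satisfies the hypothesis on `gr` by definition.
  obtain ⟨ω, -⟩ := hQ.exists_equiv hres
    (gr := fun c => Submodule.span k {x | ∃ i, deg i = c ∧ x = b i}) fun _ => rfl
  have := hQ.isDomain_qSym
  have := ω.symm.toMulEquiv.isDomain
  exact AlgFiltration.isDomain_of_assocGraded _ (envFil_exhaustive (deg := deg) (b := b) fun _ => rfl)

end TLieData

namespace TLieData

variable {k L ι : Type*} [CommRing k] [AddCommGroup L] [Module k L]
variable {D : TLieData k L} {b : Module.Basis ι k L} {deg : ι → ℕ} {q : ι → ι → k}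
variable {gr : ℕ → Submodule k L}

/-! ### Basic `T`-Lie algebras -/

/-- Expand `x ∈ gr c` in the basis and split off the part of degree `c`. The rest lies both in `gr
c` and in the sum of the other components, so it vanishes by independence. -/
theorem eq_span_of_isInternal (hgr : DirectSum.IsInternal gr) (hb : ∀ i, b i ∈ gr (deg i)) (c : ℕ) :
    gr c = Submodule.span k {x | ∃ i, deg i = c ∧ x = b i} := by
  have hle : ∀ d, Submodule.span k {x | ∃ i, deg i = d ∧ x = b i} ≤ gr d := by
    intro d
    refine Submodule.span_le.2 ?_
    rintro _ ⟨i, rfl, rfl⟩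
    exact hb i
  refine le_antisymm (fun x hx => ?_) (hle c)
  have htop : Submodule.span k {x | ∃ i, deg i = c ∧ x = b i} ⊔
      Submodule.span k {x | ∃ i, deg i ≠ c ∧ x = b i} = ⊤ := by
    rw [← Submodule.span_union, eq_top_iff, ← b.span_eq]
    refine Submodule.span_mono ?_
    rintro _ ⟨i, rfl⟩
    by_cases h : deg i = c
    · exact Or.inl ⟨i, h, rfl⟩
    · exact Or.inr ⟨i, h, rfl⟩
  obtain ⟨y, hy, z, hz, rfl⟩ := Submodule.mem_sup.1 (htop ▸ Submodule.mem_top : x ∈ _)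
  have hz1 : z ∈ gr c := by simpa using (gr c).sub_mem hx (hle c hy)
  have hz2 : z ∈ ⨆ (d : ℕ) (_ : d ≠ c), gr d := by
    refine (Submodule.span_le.2 ?_) hz
    rintro _ ⟨i, hi, rfl⟩
    exact Submodule.mem_iSup_of_mem (deg i) (Submodule.mem_iSup_of_mem hi (hb i))
  have hz0 : z = 0 := by
    have := (hgr.submodule_iSupIndep c).le_bot ⟨hz1, hz2⟩
    simpa using this
  simpa [hz0] using hy

variable [LinearOrder ι]

theorem IsBasic.gr_eq (h : D.IsBasic gr b deg q) (c : ℕ) :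
    gr c = Submodule.span k {x | ∃ i, deg i = c ∧ x = b i} :=
  eq_span_of_isInternal h.isInternal h.homogeneous c

theorem IsBasic.isQuadratic (h : D.IsBasic gr b deg q) : D.IsQuadratic b deg q where
  presym_basis := h.presym_basis
  q_mul := h.q_mul
  q_self := h.q_self
  bracket_self := h.bracket_self
  pseudo_self := h.pseudo_self
  bracket_swap i j := by
    have := LinearMap.congr_fun h.bracket_presym (b i ⊗ₜ b j)
    simp only [LinearMap.comp_apply, h.presym_basis, map_smul, LinearMap.neg_apply] at this
    rw [this, neg_neg]
  pseudo_swap i j := by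
    have := LinearMap.congr_fun h.pseudo_presym (b i ⊗ₜ b j)
    simp only [LinearMap.comp_apply, h.presym_basis, map_smul, LinearMap.neg_apply] at this
    rw [this, neg_neg]
  bracket_mem i j := by
    refine (iSup₂_le fun c hc => ?_ : _ ≤ Submodule.span k _)
      (h.bracket_mem _ _ _ (h.homogeneous i) _ (h.homogeneous j))
    rw [h.gr_eq]
    refine Submodule.span_mono ?_
    rintro _ ⟨l, rfl, rfl⟩
    exact ⟨l, by omega, rfl⟩
  pseudo_mem i j := by
    refine (iSup₂_le fun c d => iSup_le fun hcd => ?_ : _ ≤ Submodule.span k _)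
      (h.pseudo_mem _ _ _ (h.homogeneous i) _ (h.homogeneous j))
    rw [tensorSub]
    rintro _ ⟨t, rfl⟩
    induction t with
    | zero => simp
    | add x y hx hy =>
      rw [map_add]
      exact Submodule.add_mem _ hx hy
    | tmul x y =>
      have hx := (h.gr_eq c).le x.2
      have hy := (h.gr_eq d).le y.2
      have := Submodule.apply_mem_map₂ (TensorProduct.mk k L L) hx hy
      rw [Submodule.map₂_span_span] at this
      refine Submodule.span_mono ?_ this
      rintro _ ⟨_, ⟨l, rfl, rfl⟩, _, ⟨m, rfl, rfl⟩, rfl⟩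
      exact ⟨l, m, by omega, rfl⟩

theorem IsDiagonal.presym_presym {ι : Type*} {b : Module.Basis ι k L} {q : ι → ι → k}
    (hD : D.IsDiagonal b q) (t : L ⊗[k] L) : D.presym (D.presym t) = t := by
  have : D.presym ∘ₗ D.presym = LinearMap.id := (b.tensorProduct b).ext fun ij => by
    simp [Module.Basis.tensorProduct_apply', hD.presym_basis, smul_smul, hD.q_mul]
  exact LinearMap.congr_fun this t

/-- Multiplicativity is given on increasing triples. Since `S` is an involution, applying it to
`mult_left` moves the bracket to the other side, and antisymmetry reverses the arguments of the
bracket. -/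
theorem IsBasic.presym_bracket_right (h : D.IsBasic gr b deg q) {x y z : ι} (hzy : z < y)
    (hyx : y < x) : D.presym (b x ⊗ₜ D.bracket (b y ⊗ₜ b z)) =
      (q x y * q x z) • (D.bracket (b y ⊗ₜ b z) ⊗ₜ b x) := by
  have h1 := congrArg D.presym (h.mult_left z y x hzy hyx)
  rw [h.isQuadratic.presym_presym, map_smul] at h1
  rw [h.isQuadratic.bracket_swap y z, TensorProduct.tmul_neg, TensorProduct.neg_tmul,
    TensorProduct.tmul_smul, ← TensorProduct.smul_tmul', h1, map_neg, map_smul, smul_neg,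
    smul_comm _ (q y z), smul_smul (q x y * q x z)]
  have : q x y * q x z * (q z x * q y x) = 1 := by
    linear_combination (q x z * q z x) * h.q_mul x y + h.q_mul x z
  rw [this, one_smul]

theorem IsBasic.presym_bracket_left (h : D.IsBasic gr b deg q) {x y z : ι} (hzy : z < y)
    (hyx : y < x) : D.presym (D.bracket (b x ⊗ₜ b y) ⊗ₜ b z) =
      (q x z * q y z) • (b z ⊗ₜ D.bracket (b x ⊗ₜ b y)) := by
  have h1 := congrArg D.presym (h.mult_right z y x hzy hyx)
  rw [h.isQuadratic.presym_presym, map_smul] at h1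
  rw [h.isQuadratic.bracket_swap x y, TensorProduct.tmul_neg, TensorProduct.neg_tmul,
    TensorProduct.tmul_smul, ← TensorProduct.smul_tmul', h1, map_neg, map_smul, smul_neg,
    smul_comm _ (q x y), smul_smul (q x z * q y z)]
  have : q x z * q y z * (q z y * q z x) = 1 := by
    linear_combination (q x z * q z x) * h.q_mul y z + h.q_mul x z
  rw [this, one_smul]

/-- The pseudobracket terms of the overlap already occur in the residue. As `[y, z]` and `[x, y]`
have low enough degree, their relations with `x` and `z` may be used; multiplicativity identifies
the presymmetry terms with the products subtracted in the overlap. Two iterated brackets arise, and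
the Jacobi identity turns their difference into the third one, `q_(x,y) [y, [x, z]]`, which is part
of the residue. -/
theorem IsBasic.overlapsResolve (h : D.IsBasic gr b deg q) (ha : D.IsAdequate b deg q) :
    D.OverlapsResolve b deg q := by
  intro act hact x y z s hzy hyx hs hz hlow
  have hQ := h.isQuadratic
  set w := D.word b s with hw
  have hmem := IsDiagonal.word_mem_symLT (D := D) (b := b) (deg := deg) hs
    (Nat.lt_succ_self (s.map deg).sum)
  have right : ∀ l ∈ Submodule.span k {l | ∃ i, deg i < deg y + deg z ∧ l = b i},
      act (b x) (act l w) = two act (D.presym (b x ⊗ₜ l)) w + (two act (D.pseudo (b x ⊗ₜ l)) w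
        + act (D.bracket (b x ⊗ₜ l)) w) := by
    intro l hl
    induction hl using Submodule.span_induction with
    | mem l hl =>
      obtain ⟨i, hi, rfl⟩ := hl
      have := hlow x i _ (by omega) _ hmem
      simp only [Straightens, lowerOp, LinearMap.add_apply] at this
      simpa [hQ.presym_basis] using this
    | zero => simp
    | add u v _ _ hu hv =>
      simp only [map_add, TensorProduct.tmul_add, LinearMap.add_apply, hu, hv]
      abel
    | smul r u _ hu =>
      simp only [map_smul, TensorProduct.tmul_smul, LinearMap.smul_apply, hu]
      module
  have left : ∀ l ∈ Submodule.span k {l | ∃ i, deg i < deg x + deg y ∧ l = b i},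
      act l (act (b z) w) = two act (D.presym (l ⊗ₜ b z)) w + (two act (D.pseudo (l ⊗ₜ b z)) w
        + act (D.bracket (l ⊗ₜ b z)) w) := by
    intro l hl
    induction hl using Submodule.span_induction with
    | mem l hl =>
      obtain ⟨i, hi, rfl⟩ := hl
      have := hlow i z _ (by omega) _ hmem
      simp only [Straightens, lowerOp, LinearMap.add_apply] at this
      simpa [hQ.presym_basis] using this
    | zero => simp
    | add u v _ _ hu hv =>
      simp only [map_add, TensorProduct.add_tmul, LinearMap.add_apply, hu, hv]
      abel
    | smul r u _ hu =>
      simp only [map_smul, ← TensorProduct.smul_tmul', LinearMap.smul_apply, hu]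
      module
  have hr := right _ (hQ.bracket_mem y z)
  have hl := left _ (hQ.bracket_mem x y)
  rw [h.presym_bracket_right hzy hyx] at hr
  rw [h.presym_bracket_left hzy hyx] at hl
  have hj := congrArg (fun l => act l w) (h.jacobi x y z hzy hyx)
  have hres := ha act hact x y z hzy hyx s hs hz
  simp only [residue, map_add, map_sub, map_smul, map_mul, TensorAlgebra.lift_ι_apply,
    ← two_apply, LinearMap.add_apply, LinearMap.sub_apply, LinearMap.smul_apply,
    Module.End.mul_apply, ← hw] at hres
  simp only [map_sub, map_smul, LinearMap.sub_apply, LinearMap.smul_apply, map_zero,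
    LinearMap.zero_apply] at hj
  simp only [map_smul, two_tmul, LinearMap.smul_apply, Module.End.mul_apply] at hr hl
  simp only [overlap, lowerOp, LinearMap.add_apply, map_add]
  linear_combination (norm := module) hres + hr - hl + hj

end TLieData

/-! ### Operations extended by antisymmetry. -/

namespace TLieData

variable {k L ι : Type*} [CommRing k] [AddCommGroup L] [Module k L]
variable {D : TLieData k L} {b : Module.Basis ι k L} {deg : ι → ℕ}

/-- The structure constants of a presymmetry given by `c x y` for `r x y`, with square `1`. -/
def antisymmCoeff (r : ι → ι → Prop) [DecidableRel r] (c : ι → ι → kˣ) (x y : ι) : k :=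
  if r x y then (c x y : k) else if r y x then ((c y x)⁻¹ : kˣ) else 1

/-- The antisymmetric extension to all pairs of values given for the pairs `r x y`. -/
def antisymmExt {M : Type*} [AddCommGroup M] [Module k M] (r : ι → ι → Prop) [DecidableRel r]
    (c : ι → ι → kˣ) (f : ι → ι → M) (x y : ι) : M :=
  if r x y then f x y else if r y x then -((((c y x)⁻¹ : kˣ) : k) • f y x) else 0

variable {r : ι → ι → Prop} [DecidableRel r] {c : ι → ι → kˣ}

theorem antisymmExt_swap {M : Type*} [AddCommGroup M] [Module k M] (hr : ∀ x y, r x y → ¬ r y x)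
    (f : ι → ι → M) (x y : ι) :
    antisymmExt r c f x y = -(antisymmCoeff r c x y • antisymmExt r c f y x) := by
  unfold antisymmExt antisymmCoeff
  by_cases h : r x y
  · simp only [h, hr x y h, if_true, if_false, smul_neg, neg_neg, smul_smul, Units.mul_inv, one_smul]
  · by_cases h' : r y x <;> simp [h, h']

/-- Both examples prescribe their operations on half of the pairs; the extension then makes every
two-variable axiom automatic except the degree bounds on the prescribed values. The relation `r` is
independent of any order used to sort monomials. -/
theorem IsQuadratic.of_antisymm (hr : ∀ x y, r x y → ¬ r y x) {P : ι → ι → L ⊗[k] L}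
    {B : ι → ι → L}
    (hS : ∀ x y, D.presym (b x ⊗ₜ b y) = antisymmCoeff r c x y • (b y ⊗ₜ b x))
    (hP : ∀ x y, D.pseudo (b x ⊗ₜ b y) = antisymmExt r c P x y)
    (hB : ∀ x y, D.bracket (b x ⊗ₜ b y) = antisymmExt r c B x y)
    (hP' : ∀ x y, r x y → P x y ∈
      Submodule.span k {t | ∃ l m, deg l + deg m < deg x + deg y ∧ t = b l ⊗ₜ b m})
    (hB' : ∀ x y, r x y → B x y ∈ Submodule.span k {v | ∃ l, deg l < deg x + deg y ∧ v = b l}) :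
    D.IsQuadratic b deg (antisymmCoeff r c) where
  presym_basis := hS
  q_mul x y := by
    unfold antisymmCoeff
    by_cases h : r x y
    · simp [h, hr x y h]
    · by_cases h' : r y x <;> simp [h, h']
  q_self x := by
    have : ¬ r x x := fun h => hr x x h h
    simp [antisymmCoeff, this]
  bracket_self x := by
    have : ¬ r x x := fun h => hr x x h h
    simp [hB, antisymmExt, this]
  pseudo_self x := by
    have : ¬ r x x := fun h => hr x x h h
    simp [hP, antisymmExt, this]
  bracket_swap x y := by rw [hB, hB, antisymmExt_swap hr]
  pseudo_swap x y := by rw [hP, hP, antisymmExt_swap hr]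
  bracket_mem x y := by
    rw [hB, antisymmExt]
    split_ifs with h h
    · exact hB' x y h
    · rw [add_comm (deg x)]
      exact Submodule.neg_mem _ (Submodule.smul_mem _ _ (hB' y x h))
    · exact Submodule.zero_mem _
  pseudo_mem x y := by
    rw [hP, antisymmExt]
    split_ifs with h h
    · exact hP' x y h
    · rw [add_comm (deg x)]
      exact Submodule.neg_mem _ (Submodule.smul_mem _ _ (hP' y x h))
    · exact Submodule.zero_mem _

end TLieData

namespace SlPlus

open TLieData

variable {k : Type*} [CommRing k] {n : ℕ}

/-! ### The algebra `(sl_{n+1}^+)_q` -/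

/-- The total order on the matrix units with decreasing rows and, in each row, increasing
columns. -/
instance instLinearOrderIdx : LinearOrder (Idx n) :=
  LinearOrder.lift' (fun x : Idx n => toLex (OrderDual.toDual x.1.1, x.1.2)) fun x y h => by
    have := toLex.injective h
    simp only [Prod.mk.injEq, OrderDual.toDual_inj] at this
    exact Subtype.ext (Prod.ext this.1 this.2)

/-- Only the operations are tied to `idxLT`; monomials may be sorted by another order. Sorting by
rows lets the single formulas `coeffUp` and `lowUp` describe all relations between different rows.
-/
theorem idx_lt_iff {x y : Idx n} :
    x < y ↔ y.1.1 < x.1.1 ∨ (x.1.1 = y.1.1 ∧ x.1.2 < y.1.2) := by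
  change toLex (OrderDual.toDual x.1.1, x.1.2) < toLex (OrderDual.toDual y.1.1, y.1.2) ↔ _
  rw [Prod.Lex.toLex_lt_toLex]
  simp

theorem idxLT_asymm {x y : Idx n} (h : idxLT x y) : ¬ idxLT y x := by
  unfold idxLT at *
  omega

/-- The basis of matrix units. -/
def basis (k : Type*) [CommRing k] (n : ℕ) : Module.Basis (Idx n) k (Mod k n) :=
  Finsupp.basisSingleOne

theorem basis_apply (x : Idx n) : basis k n x = e k x := by
  simp [basis, e]

/-- The degree of `e_ab`. -/
def degree (x : Idx n) : ℕ := (x.1.1 : ℕ) * x.1.2 + (n + 1) ^ 2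

/-- The rearrangement inequality `(i - a) * (j - b) > 0`: the pseudobracket exchanges the columns of
two positions, and this lowers the sum of the products. -/
theorem degree_cross {a i b j N : ℕ} (h1 : a < i) (h2 : b < j) :
    (i * b + N) + (a * j + N) < (a * b + N) + (i * j + N) := by
  nlinarith [Nat.mul_lt_mul_of_lt_of_le h1 h2.le]

/-- The constant in the degree serves this inequality: it occurs once on the left and twice on the
right, and it exceeds `a * j`. -/
theorem degree_join {a i j n : ℕ} (h1 : a < i) (h2 : i < j) (_ : j < n + 1) :
    (a * j + (n + 1) ^ 2) < (a * i + (n + 1) ^ 2) + (i * j + (n + 1) ^ 2) := by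
  nlinarith

theorem classical_mem (x y : Idx n) : classical k x y ∈
    Submodule.span k {v | ∃ l : Idx n, degree l < degree x + degree y ∧ v = basis k n l} := by
  unfold classical
  split_ifs with h h
  · exact Submodule.subset_span ⟨_, by
      have := degree_join x.2 (h.trans_lt y.2) y.1.2.2
      simp only [degree]
      rw [← h]
      exact this, (basis_apply _).symm⟩
  · refine Submodule.neg_mem _ (Submodule.subset_span ⟨_, ?_, (basis_apply _).symm⟩)
    have := degree_join y.2 (h.trans_lt x.2) x.1.2.2
    simp only [degree]
    rw [← h, add_comm]
    simpa [add_comm, add_left_comm] using this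
  · exact Submodule.zero_mem _

theorem pseudoUp_mem (q : kˣ) (x y : Idx n) : pseudoUp q x y ∈
    Submodule.span k {t | ∃ l m : Idx n, degree l + degree m < degree x + degree y ∧
      t = basis k n l ⊗ₜ basis k n m} := by
  unfold pseudoUp
  split_ifs with h
  · refine Submodule.smul_mem _ _ (Submodule.subset_span
      ⟨⟨(y.1.1, x.1.2), h.2.1⟩, ⟨(x.1.1, y.1.2), x.2.trans h.2.2⟩, ?_,
        congrArg₂ (fun u v => u ⊗ₜ[k] v) (basis_apply _).symm (basis_apply _).symm⟩)
    exact degree_cross h.1 h.2.2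
  · exact Submodule.zero_mem _

open Classical in
theorem presym_basis (q : kˣ) (x y : Idx n) :
    (slPlus q n).presym (basis k n x ⊗ₜ basis k n y) =
      antisymmCoeff idxLT (fun x y => q ^ cartan x y) x y • (basis k n y ⊗ₜ basis k n x) := by
  rw [basis_apply, basis_apply, slPlus, ofBasis_e, antisymmCoeff]
  simp only [zpow_neg]
  split_ifs
  · rfl
  · rfl
  · exact (one_smul _ _).symm

open Classical in
theorem pseudo_basis (q : kˣ) (x y : Idx n) :
    (slPlus q n).pseudo (basis k n x ⊗ₜ basis k n y) =
      antisymmExt idxLT (fun x y => q ^ cartan x y) (pseudoUp q) x y := by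
  rw [basis_apply, basis_apply, slPlus, ofBasis_e]
  simp only [zpow_neg]
  rfl

open Classical in
theorem bracket_basis (q : kˣ) (x y : Idx n) :
    (slPlus q n).bracket (basis k n x ⊗ₜ basis k n y) =
      antisymmExt idxLT (fun x y => q ^ cartan x y) (classical k) x y := by
  rw [basis_apply, basis_apply, slPlus, ofBasis_e]
  simp only [zpow_neg]
  rfl

open Classical in
theorem isQuadratic (q : kˣ) (n : ℕ) : (slPlus q n).IsQuadratic (basis k n) degree
    (antisymmCoeff idxLT fun x y => q ^ cartan x y) :=
  IsQuadratic.of_antisymm (fun _ _ => idxLT_asymm) (presym_basis q) (pseudo_basis q)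
    (bracket_basis q) (fun x y _ => pseudoUp_mem q x y) (fun x y _ => classical_mem x y)

end SlPlus

/-! ### Overlaps of matrix units as operator identities. -/

namespace SlPlus

open TLieData

section Rules

variable {K V : Type*} [CommRing K] [AddCommGroup V] [Module K V]

/-- The coefficient of the presymmetry for `e_ab`, `e_ij`, `a < i`. -/
def coeffUp (q qi : K) (b i j : ℕ) : K := if b = j then q else if b = i then qi else 1

/-- The terms of lower degree in the relation for `e_ab`, `e_ij`, `a < i`. -/
def lowUp (X : ℕ → ℕ → Module.End K V) (q qi : K) (a b i j : ℕ) (v : V) : V :=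
  if b = i then X a j v else if i < b ∧ b < j then (q - qi) • X i b (X a j v) else 0

/-- The defining relations on a vector `v` of degree `c`, in degree less than `M`. -/
structure Rules (X : ℕ → ℕ → Module.End K V) (q qi : K) (n : ℕ) (d : ℕ → ℕ → ℕ) (M : ℕ)
    (v : V) (c : ℕ) : Prop where
  comm : ∀ a b i j, a < i → a < b → i < j → b ≤ n → j ≤ n → (b < i ∨ j < b) →
    d a b + d i j + c < M → X a b (X i j v) = (1 : K) • X i j (X a b v)
  join : ∀ a i j, a < i → i < j → j ≤ n → d a i + d i j + c < M →
    X a i (X i j v) = qi • X i j (X a i v) + X a j v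
  cross : ∀ a b i j, a < i → i < b → b < j → j ≤ n → d a b + d i j + c < M →
    X a b (X i j v) = X i j (X a b v) + (q - qi) • X i b (X a j v)
  col : ∀ a i j, a < i → i < j → j ≤ n → d a j + d i j + c < M →
    X a j (X i j v) = q • X i j (X a j v)
  row : ∀ a b j, a < j → j < b → b ≤ n → d a b + d a j + c < M →
    X a b (X a j v) = qi • X a j (X a b v)

variable {X : ℕ → ℕ → Module.End K V} {q qi : K} {n : ℕ} {d : ℕ → ℕ → ℕ} {M : ℕ} {w : V}

-- A finite verification. With the rows `a < i < k` fixed, the positions of the columns relative to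
-- each other and to the rows determine every coefficient and every lower term. In each case the
-- products are sorted by relations of degree below `M`, and the coefficients agree because `q * qi
-- = 1`.
set_option maxHeartbeats 2000000 in
theorem overlap_rows
    (hcross : ∀ a i b j, a < i → b < j → d i b + d a j < d a b + d i j)
    (hjoin : ∀ a i j, a < i → i < j → j ≤ n → d a j < d a i + d i j)
    {a b i j k l : ℕ} (hai : a < i) (hik : i < k) (hab : a < b) (hij : i < j) (hkl : k < l)
    (hb : b ≤ n) (hj : j ≤ n) (hl : l ≤ n) (hq : q * qi = 1)
    (hM : d a b + d i j + d k l ≤ M) {c : ℕ} (hc : c = 0) (H0 : Rules X q qi n d M w c)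
    (H1 : ∀ e f, e < f → f ≤ n → Rules X q qi n d M (X e f w) (d e f)) :
    (coeffUp q qi b k l * coeffUp q qi j k l) • X k l (lowUp X q qi a b i j w)
      - lowUp X q qi a b i j (X k l w) + X a b (lowUp X q qi i j k l w)
      - (coeffUp q qi b i j * coeffUp q qi b k l) • lowUp X q qi i j k l (X a b w)
      - coeffUp q qi b i j • X i j (lowUp X q qi a b k l w)
      + coeffUp q qi j k l • lowUp X q qi a b k l (X i j w) = 0 := by
  have j1 := hjoin a i j hai hij hj
  have j2 := hjoin a k l (by omega) hkl hl
  have j3 := hjoin i k l hik hkl hl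
  have j4 := hjoin a i l hai (by omega) hl
  -- Each comparison of two columns carries the degree inequalities for all pairs of rows, so that
  -- linear arithmetic can check the degree condition of every relation used.
  have tri : ∀ x y, (x < y ∧ d i x + d a y < d a x + d i y ∧ d k x + d a y < d a x + d k y ∧
      d k x + d i y < d i x + d k y) ∨ x = y ∨ (y < x ∧ d i y + d a x < d a y + d i x ∧
      d k y + d a x < d a y + d k x ∧ d k y + d i x < d i y + d k x) := by
    intro x y
    rcases lt_trichotomy x y with h | h | h
    · exact Or.inl ⟨h, hcross _ _ _ _ hai h, hcross _ _ _ _ (hai.trans hik) h, hcross _ _ _ _ hik h⟩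
    · exact Or.inr (Or.inl h)
    · exact Or.inr (Or.inr
        ⟨h, hcross _ _ _ _ hai h, hcross _ _ _ _ (hai.trans hik) h, hcross _ _ _ _ hik h⟩)
  unfold coeffUp lowUp
  rcases lt_trichotomy j k with h1 | h1 | h1 <;> rcases lt_trichotomy b i with h2 | h2 | h2 <;>
    rcases lt_trichotomy b k with h3 | h3 | h3
  all_goals try (exfalso; omega)
  all_goals
    rcases tri b j with ⟨t1, t2, t3, t4⟩ | t1 | ⟨t1, t2, t3, t4⟩
  all_goals try (exfalso; omega)
  all_goals
    rcases tri j l with ⟨u1, u2, u3, u4⟩ | u1 | ⟨u1, u2, u3, u4⟩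
  all_goals try (exfalso; omega)
  all_goals
    rcases tri b l with ⟨v1, v2, v3, v4⟩ | v1 | ⟨v1, v2, v3, v4⟩
  all_goals try (exfalso; omega)
  all_goals subst_vars
  all_goals
    simp (disch := omega) only [if_pos, if_neg, if_true, map_zero, smul_zero]
    try simp (disch := omega) only [H0.comm, H0.join, H0.cross, H0.col,
      (H1 _ _ _ _).comm, (H1 _ _ _ _).join, (H1 _ _ _ _).cross, (H1 _ _ _ _).col,
      map_add, map_smul]
    first
    | module
    | (clear H0 H1 hcross hjoin tri; match_scalars <;> grind)

/-- The two larger units share the row `a`: they commute up to `qi` without lower term, so only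
their relations with row `k` contribute. -/
theorem overlap_rows_left
    (hcross : ∀ a i b j, a < i → b < j → d i b + d a j < d a b + d i j)
    (hjoin : ∀ a i j, a < i → i < j → j ≤ n → d a j < d a i + d i j)
    {a b j k l : ℕ} (hak : a < k) (hjb : j < b) (haj : a < j) (hkl : k < l)
    (hb : b ≤ n) (hl : l ≤ n) (hq : q * qi = 1)
    (hM : d a b + d a j + d k l ≤ M) {c : ℕ} (hc : c = 0) (H0 : Rules X q qi n d M w c)
    (H1 : ∀ e f, e < f → f ≤ n → Rules X q qi n d M (X e f w) (d e f)) :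
    X a b (lowUp X q qi a j k l w)
      - (qi * coeffUp q qi b k l) • lowUp X q qi a j k l (X a b w)
      - qi • X a j (lowUp X q qi a b k l w)
      + coeffUp q qi j k l • lowUp X q qi a b k l (X a j w) = 0 := by
  have j1 := hjoin a k l hak hkl hl
  have c1 := hcross a k j b hak hjb
  have tri : ∀ x, (x < l ∧ d k x + d a l < d a x + d k l) ∨ x = l ∨
      (l < x ∧ d k l + d a x < d a l + d k x) := by
    intro x
    rcases lt_trichotomy x l with h | h | h
    · exact Or.inl ⟨h, hcross _ _ _ _ hak h⟩
    · exact Or.inr (Or.inl h)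
    · exact Or.inr (Or.inr ⟨h, hcross _ _ _ _ hak h⟩)
  unfold coeffUp lowUp
  rcases lt_trichotomy j k with h1 | h1 | h1 <;> rcases lt_trichotomy b k with h2 | h2 | h2
  all_goals try (exfalso; omega)
  all_goals
    rcases tri b with ⟨t1, t2⟩ | t1 | ⟨t1, t2⟩ <;> rcases tri j with ⟨u1, u2⟩ | u1 | ⟨u1, u2⟩
  all_goals try (exfalso; omega)
  all_goals subst_vars
  all_goals
    simp (disch := omega) only [if_pos, if_neg, if_true, map_zero, smul_zero]
    try simp (disch := omega) only [H0.row,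
      (H1 _ _ _ _).comm, (H1 _ _ _ _).join, (H1 _ _ _ _).cross, map_smul]
    first
    | module
    | (clear H0 H1 hcross hjoin tri; match_scalars <;> grind)

/-- The mirror case, where the two smaller units share the row `i`. -/
theorem overlap_rows_right
    (hcross : ∀ a i b j, a < i → b < j → d i b + d a j < d a b + d i j)
    (hjoin : ∀ a i j, a < i → i < j → j ≤ n → d a j < d a i + d i j)
    {a b i j l : ℕ} (hai : a < i) (hlj : l < j) (hab : a < b) (hil : i < l)
    (hb : b ≤ n) (hj : j ≤ n) (hq : q * qi = 1)
    (hM : d a b + d i j + d i l ≤ M) {c : ℕ} (hc : c = 0) (H0 : Rules X q qi n d M w c)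
    (H1 : ∀ e f, e < f → f ≤ n → Rules X q qi n d M (X e f w) (d e f)) :
    (coeffUp q qi b i l * qi) • X i l (lowUp X q qi a b i j w)
      - lowUp X q qi a b i j (X i l w)
      - coeffUp q qi b i j • X i j (lowUp X q qi a b i l w)
      + qi • lowUp X q qi a b i l (X i j w) = 0 := by
  have j1 := hjoin a i l hai hil (by omega)
  have j2 := hjoin a i j hai (by omega) hj
  have c1 := hcross a i l j hai hlj
  have tri : ∀ x, (b < x ∧ d i b + d a x < d a b + d i x) ∨ b = x ∨
      (x < b ∧ d i x + d a b < d a x + d i b) := by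
    intro x
    rcases lt_trichotomy b x with h | h | h
    · exact Or.inl ⟨h, hcross _ _ _ _ hai h⟩
    · exact Or.inr (Or.inl h)
    · exact Or.inr (Or.inr ⟨h, hcross _ _ _ _ hai h⟩)
  unfold coeffUp lowUp
  rcases lt_trichotomy b i with h1 | h1 | h1
  all_goals
    rcases tri l with ⟨t1, t2⟩ | t1 | ⟨t1, t2⟩ <;> rcases tri j with ⟨u1, u2⟩ | u1 | ⟨u1, u2⟩
  all_goals try (exfalso; omega)
  all_goals subst_vars
  all_goals
    simp (disch := omega) only [if_pos, if_neg, if_true, map_zero, smul_zero]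
    try simp (disch := omega) only [H0.comm, H0.cross, (H1 _ _ _ _).row,
      map_add, map_smul]
    first
    | module
    | (clear H0 H1 hcross hjoin tri; match_scalars <;> grind)

end Rules

end SlPlus

/-! ### Translation of `(sl_{n+1}^+)_q` into operators indexed by natural numbers. -/

namespace SlPlus

open TLieData

variable {k V : Type*} [CommRing k] [AddCommGroup V] [Module k V] {n : ℕ}

/-- The operator of `e_ab` for natural numbers `a < b ≤ n`, and `0` for other `a`, `b`. -/
def op (act : Mod k n →ₗ[k] Module.End k V) (a b : ℕ) : Module.End k V :=
  if h : a < b ∧ b < n + 1 then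
    act (basis k n ⟨(⟨a, h.1.trans h.2⟩, ⟨b, h.2⟩), h.1⟩)
  else 0

theorem act_basis (act : Mod k n →ₗ[k] Module.End k V) (x : Idx n) :
    act (basis k n x) = op act x.1.1 x.1.2 := by
  rw [op, dif_pos ⟨x.2, x.1.2.2⟩]
  rfl

theorem act_e (act : Mod k n →ₗ[k] Module.End k V) (x : Idx n) :
    act (e k x) = op act x.1.1 x.1.2 := by
  rw [← basis_apply, act_basis]

theorem exists_idx {a b : ℕ} (hab : a < b) (hb : b ≤ n) :
    ∃ x : Idx n, (x.1.1 : ℕ) = a ∧ (x.1.2 : ℕ) = b :=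
  ⟨⟨(⟨a, by omega⟩, ⟨b, by omega⟩), hab⟩, rfl, rfl⟩

theorem act_classical (act : Mod k n →ₗ[k] Module.End k V) {x y : Idx n} (h : x.1.1 < y.1.1) :
    act (classical k x y) =
      if (x.1.2 : ℕ) = y.1.1 then op act x.1.1 y.1.2 else 0 := by
  have hx := x.2
  have hy := y.2
  unfold classical
  by_cases h1 : x.1.2 = y.1.1
  · rw [dif_pos h1, if_pos (congrArg Fin.val h1)]
    exact act_e act _
  · rw [dif_neg h1, if_neg (fun h2 => h1 (Fin.ext h2)), dif_neg (by omega), map_zero]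

theorem two_pseudoUp (act : Mod k n →ₗ[k] Module.End k V) (q : kˣ) {x y : Idx n}
    (h : x.1.1 < y.1.1) (v : V) : two act (pseudoUp q x y) v =
      if (y.1.1 : ℕ) < x.1.2 ∧ (x.1.2 : ℕ) < y.1.2 then
        ((q : k) - (q⁻¹ : kˣ)) • op act y.1.1 x.1.2 (op act x.1.1 y.1.2 v) else 0 := by
  unfold pseudoUp
  by_cases h1 : y.1.1 < x.1.2 ∧ x.1.2 < y.1.2
  · have h2 : (y.1.1 : ℕ) < x.1.2 ∧ (x.1.2 : ℕ) < y.1.2 := h1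
    rw [dif_pos ⟨h, h1⟩, if_pos h2, map_smul, LinearMap.smul_apply]
    refine congrArg _ ?_
    exact (LinearMap.congr_fun (two_tmul act _ _) v).trans
      ((LinearMap.congr_fun (act_e act _) _).trans
        (congrArg _ (LinearMap.congr_fun (act_e act _) v)))
  · have h2 : ¬ ((y.1.1 : ℕ) < x.1.2 ∧ (x.1.2 : ℕ) < y.1.2) := h1
    rw [dif_neg fun h2 => h1 h2.2, if_neg h2, map_zero, LinearMap.zero_apply]

/-- For `x = e_ab`, `y = e_ij` with `a < i`, the operations may be prescribed on `(y, x)` instead of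
`(x, y)`. Then `a + b ≥ i + j` forces `b > j`, where both sides vanish, so one formula covers all
pairs. -/
theorem lowerOp_of_row_lt (act : Mod k n →ₗ[k] Module.End k V) (q : kˣ) {x y : Idx n}
    (h : x.1.1 < y.1.1) (v : V) : (slPlus q n).lowerOp (basis k n) act x y v =
      lowUp (op act) (q : k) (q⁻¹ : kˣ) x.1.1 x.1.2 y.1.1 y.1.2 v := by
  have hx := x.2
  have hy := y.2
  rw [lowerOp, LinearMap.add_apply, pseudo_basis, bracket_basis, lowUp, antisymmExt, antisymmExt]
  by_cases hr : idxLT x y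
  · rw [if_pos hr, if_pos hr, act_classical act h, two_pseudoUp act q h]
    split_ifs <;> first | omega | simp
  · have h1 : ¬ (x.1.2 : ℕ) = y.1.1 := by unfold idxLT at hr; omega
    have h2 : ¬ ((y.1.1 : ℕ) < x.1.2 ∧ (x.1.2 : ℕ) < y.1.2) := by unfold idxLT at hr; omega
    rw [if_neg hr, if_neg hr, if_neg h1, if_neg h2]
    have h3 : classical k y x = 0 := by
      rw [classical, dif_neg (by omega), dif_neg (fun h => h1 (congrArg Fin.val h))]
    have h4 : pseudoUp q y x = 0 := by
      rw [pseudoUp, dif_neg (by omega)]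
    rw [h3, h4]
    split_ifs <;> simp

theorem lowerOp_of_row_eq (act : Mod k n →ₗ[k] Module.End k V) (q : kˣ) {x y : Idx n}
    (h : x.1.1 = y.1.1) : (slPlus q n).lowerOp (basis k n) act x y = 0 := by
  have hx := x.2
  have hy := y.2
  have key : ∀ x y : Idx n, x.1.1 = y.1.1 → classical k x y = 0 ∧ pseudoUp q x y = 0 := by
    intro x y h
    have hx := x.2
    have hy := y.2
    rw [classical, pseudoUp, dif_neg (by omega), dif_neg (by omega), dif_neg (by omega)]
    exact ⟨rfl, rfl⟩
  rw [lowerOp, pseudo_basis, bracket_basis, antisymmExt, antisymmExt, (key x y h).1, (key x y h).2,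
    (key y x h.symm).1, (key y x h.symm).2]
  split_ifs <;> simp

open Classical in
theorem coeff_of_row_lt (q : kˣ) {x y : Idx n} (h : x.1.1 < y.1.1) :
    antisymmCoeff idxLT (fun x y => q ^ cartan x y) x y =
      coeffUp (q : k) (q⁻¹ : kˣ) x.1.2 y.1.1 y.1.2 := by
  have hx := x.2
  have hy := y.2
  have h1 : ¬ x.1.1 = y.1.1 := by omega
  have h2 : ¬ x.1.1 = y.1.2 := by omega
  have e1 : ((x.1.2 : ℕ) = y.1.2) ↔ x.1.2 = y.1.2 := Fin.ext_iff.symm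
  have e2 : ((x.1.2 : ℕ) = y.1.1) ↔ x.1.2 = y.1.1 := Fin.ext_iff.symm
  rw [antisymmCoeff, coeffUp]
  simp only [cartan, e1, e2, if_neg h1, if_neg h2, eq_comm (a := y.1.1),
    eq_comm (a := y.1.2)]
  by_cases hr : idxLT x y
  · rw [if_pos hr]
    split_ifs <;> first | omega | simp
  · have h3 : ¬ x.1.2 = y.1.1 := by unfold idxLT at hr; omega
    have h4 : ¬ x.1.2 = y.1.2 := by unfold idxLT at hr; omega
    simp [hr, h3, h4]

open Classical in
theorem coeff_of_row_eq (q : kˣ) {x y : Idx n} (h : x.1.1 = y.1.1) (h' : y.1.2 < x.1.2) :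
    antisymmCoeff idxLT (fun x y => q ^ cartan x y) x y = ((q⁻¹ : kˣ) : k) := by
  have hx := x.2
  have hy := y.2
  have h1 : idxLT y x := by unfold idxLT; omega
  have h2 : ¬ y.1.1 = x.1.2 := by omega
  have h3 : ¬ y.1.2 = x.1.1 := by omega
  have h4 : ¬ y.1.2 = x.1.2 := by omega
  rw [antisymmCoeff, if_neg (idxLT_asymm h1), if_pos h1, cartan, if_pos h.symm, if_neg h2,
    if_neg h3, if_neg h4]
  simp

-- The uniform formula for two rows is specialised to the mutually exclusive patterns of columns,
-- which yields rewriting rules with sorted right-hand sides.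
open Classical in
theorem Rules.of_straightens {act : Mod k n →ₗ[k] Module.End k V} {q : kˣ} {v : V} {M c : ℕ}
    (hv : ∀ x y : Idx n, degree x + degree y + c < M →
      (slPlus q n).Straightens (basis k n) (antisymmCoeff idxLT fun x y => q ^ cartan x y) act x y v) :
    Rules (op act) (q : k) (q⁻¹ : kˣ) n (fun a b => a * b + (n + 1) ^ 2) M v c := by
  have up : ∀ a b i j, a < i → a < b → i < j → b ≤ n → j ≤ n →
      a * b + (n + 1) ^ 2 + (i * j + (n + 1) ^ 2) + c < M →
      op act a b (op act i j v) = coeffUp (q : k) (q⁻¹ : kˣ) b i j • op act i j (op act a b v)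
        + lowUp (op act) (q : k) (q⁻¹ : kˣ) a b i j v := by
    intro a b i j hai hab hij hb hj hM
    obtain ⟨x, rfl, rfl⟩ := exists_idx hab hb
    obtain ⟨y, rfl, rfl⟩ := exists_idx hij hj
    have := hv x y hM
    rwa [Straightens, act_basis, act_basis, coeff_of_row_lt q hai, lowerOp_of_row_lt act q hai]
      at this
  refine ⟨?_, ?_, ?_, ?_, ?_⟩
  · intro a b i j hai hab hij hb hj h hM
    rw [up a b i j hai hab hij hb hj hM, coeffUp, lowUp]
    simp (disch := omega) only [if_neg, add_zero]
  · intro a i j hai hij hj hM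
    rw [up a i i j hai hai hij (by omega) hj hM, coeffUp, lowUp, if_neg hij.ne, if_pos rfl,
      if_pos rfl]
  · intro a b i j hai hib hbj hj hM
    rw [up a b i j hai (by omega) (by omega) (by omega) hj hM, coeffUp, lowUp]
    simp (disch := omega) only [if_pos, if_neg, one_smul]
  · intro a i j hai hij hj hM
    rw [up a j i j hai (by omega) hij hj hj hM, coeffUp, lowUp]
    simp (disch := omega) only [if_neg, if_true, add_zero]
  · intro a b j haj hjb hb hM
    obtain ⟨x, rfl, rfl⟩ := exists_idx (haj.trans hjb) hb
    obtain ⟨y, h1, rfl⟩ := exists_idx haj (hjb.le.trans hb)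
    have h2 : x.1.1 = y.1.1 := Fin.ext h1.symm
    have := hv x y (by unfold degree; rw [h1]; exact hM)
    rw [Straightens, act_basis, act_basis, coeff_of_row_eq q h2 hjb, lowerOp_of_row_eq act q h2,
      h1] at this
    simpa using this

-- For `x > y > z` the rows increase weakly, so there are four cases according to which rows
-- coincide; three units in one row have no lower terms at all.
open Classical in
theorem overlapsResolve (q : kˣ) (n : ℕ) : (slPlus q n).OverlapsResolve (basis k n) degree
    (antisymmCoeff idxLT fun x y => q ^ cartan x y) := by
  intro act hact x y z s hzy hyx hs hz hlow
  have hD := (isQuadratic q n).toIsDiagonal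
  have hmem := IsDiagonal.word_mem_symLT (D := slPlus q n) (b := basis k n) (deg := degree) hs
    (Nat.lt_succ_self (s.map degree).sum)
  set w := (slPlus q n).word (basis k n) s
  -- The degree of `w` occurs on both sides of the bound and is counted as `0`; the strict
  -- inequality in `Rules` absorbs the `+ 1` of `symLT`.
  have H0 : Rules (op act) (q : k) (q⁻¹ : kˣ) n (fun a b => a * b + (n + 1) ^ 2)
      (degree x + degree y + degree z) w 0 :=
    Rules.of_straightens fun u v huv => hlow u v _ (by omega) w hmem
  have H1 : ∀ e f, e < f → f ≤ n → Rules (op act) (q : k) (q⁻¹ : kˣ) n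
      (fun a b => a * b + (n + 1) ^ 2) (degree x + degree y + degree z) (op act e f w)
      (e * f + (n + 1) ^ 2) := by
    intro e f hef hf
    obtain ⟨t, rfl, rfl⟩ := exists_idx hef hf
    refine Rules.of_straightens fun u v huv => hlow u v _ ?_ _ (act_basis act t ▸ hact.act_mem hD t hmem)
    change degree u + degree v + degree t < _ at huv
    omega
  have hcross : ∀ a i b j, a < i → b < j → (i * b + (n + 1) ^ 2) + (a * j + (n + 1) ^ 2) <
      (a * b + (n + 1) ^ 2) + (i * j + (n + 1) ^ 2) := fun a i b j h1 h2 => degree_cross h1 h2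
  have hjoin : ∀ a i j, a < i → i < j → j ≤ n → (a * j + (n + 1) ^ 2) <
      (a * i + (n + 1) ^ 2) + (i * j + (n + 1) ^ 2) :=
    fun a i j h1 h2 h3 => degree_join h1 h2 (Nat.lt_succ_of_le h3)
  have hq : (q : k) * (q⁻¹ : kˣ) = 1 := q.mul_inv
  have hx := x.2
  have hy := y.2
  have hz := z.2
  have hx' := Nat.le_of_lt_succ x.1.2.2
  have hy' := Nat.le_of_lt_succ y.1.2.2
  have hz' := Nat.le_of_lt_succ z.1.2.2
  unfold overlap
  simp only [act_basis]
  rcases idx_lt_iff.1 hyx with h1 | ⟨h1, h1'⟩ <;> rcases idx_lt_iff.1 hzy with h2 | ⟨h2, h2'⟩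
  · simp only [lowerOp_of_row_lt act q h1, lowerOp_of_row_lt act q h2,
      lowerOp_of_row_lt act q (h1.trans h2), coeff_of_row_lt q h1, coeff_of_row_lt q h2,
      coeff_of_row_lt q (h1.trans h2)]
    exact overlap_rows hcross hjoin h1 h2 hx hy hz hx' hy' hz' hq le_rfl rfl H0 H1
  · have h3 : x.1.1 < z.1.1 := h2 ▸ h1
    simp only [lowerOp_of_row_lt act q h1, lowerOp_of_row_eq act q h2.symm,
      lowerOp_of_row_lt act q h3, coeff_of_row_lt q h1, coeff_of_row_eq q h2.symm h2',
      coeff_of_row_lt q h3, LinearMap.zero_apply, map_zero, smul_zero, add_zero, sub_zero]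
    have := overlap_rows_right hcross hjoin (w := w) h1 h2' hx (h2 ▸ hz) hx' hy' hq
      (show _ ≤ degree x + degree y + degree z by unfold degree; rw [h2]) rfl H0 H1
    rw [← h2] at this ⊢
    exact this
  · have h3 : x.1.1 < z.1.1 := h1 ▸ h2
    simp only [lowerOp_of_row_eq act q h1.symm, lowerOp_of_row_lt act q h2,
      lowerOp_of_row_lt act q h3, coeff_of_row_eq q h1.symm h1', coeff_of_row_lt q h2,
      coeff_of_row_lt q h3, LinearMap.zero_apply, map_zero, smul_zero, zero_add, sub_zero]
    have := overlap_rows_left hcross hjoin (w := w) h3 h1' (h1 ▸ hy) hz hx' hz' hq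
      (show _ ≤ degree x + degree y + degree z by unfold degree; rw [h1]) rfl H0 H1
    rw [← h1] at this ⊢
    exact this
  · have h3 : x.1.1 = z.1.1 := (h2.trans h1).symm
    simp [lowerOp_of_row_eq act q h1.symm, lowerOp_of_row_eq act q h2.symm,
      lowerOp_of_row_eq act q h3]

/-- `U((sl_{n+1}^+)_q)` is a domain. -/
theorem isDomain_env [IsDomain k] (q : kˣ) (n : ℕ) : IsDomain (slPlus q n).Env :=
  (isQuadratic q n).isDomain (overlapsResolve q n)

end SlPlus

/-! ### Overlaps of the quantum matrix relations with constant signs. -/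

namespace QuantumMatrix

open TLieData

section Rules

variable {K V : Type*} [CommRing K] [AddCommGroup V] [Module K V] {n : ℕ}

/-- The coefficient of the presymmetry for `Z_i^a`, `Z_j^b`, `i < j`. -/
def coeffUp (P : Fin n → Fin n → K) (u : K) (i a j b : Fin n) : K :=
  if a < b then P j i * P a b else P j i * P a b * u

/-- The term of lower degree in the relation for `Z_i^a`, `Z_j^b`, `i < j`. -/
def lowUp (X : Fin n → Fin n → Module.End K V) (P : Fin n → Fin n → K) (u : K)
    (i a j b : Fin n) (v : V) : V :=
  if a < b then ((u - 1) * P j i) • X j a (X i b v) else 0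

/-- The defining relations on a vector `v` of degree `c`, in degree less than `M`. -/
structure Rules (X : Fin n → Fin n → Module.End K V) (P : Fin n → Fin n → K) (u : K)
    (d : Fin n → Fin n → ℕ) (M : ℕ) (v : V) (c : ℕ) : Prop where
  diag : ∀ i a j b, i < j → a < b → d i a + d j b + c < M →
    X i a (X j b v) = (P j i * P a b) • X j b (X i a v) + ((u - 1) * P j i) • X j a (X i b v)
  anti : ∀ i a j b, i < j → b ≤ a → d i a + d j b + c < M →
    X i a (X j b v) = (P j i * P a b * u) • X j b (X i a v)
  row : ∀ i a b, b < a → d i a + d i b + c < M →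
    X i a (X i b v) = P a b • X i b (X i a v)

variable {X : Fin n → Fin n → Module.End K V} {P : Fin n → Fin n → K} {u : K}
  {d : Fin n → Fin n → ℕ} {M : ℕ} {w : V}

/-- The same kind of verification as for `(sl_{n+1}^+)_q`, but without bracket: only the mutual
order of the columns matters, and the coefficients agree because `P` is multiplicatively
antisymmetric. -/
theorem overlap_rows (hcross : ∀ a i b j, a < i → b < j → d i b + d a j < d a b + d i j)
    (hP : ∀ a b, P a b * P b a = 1) (hP' : ∀ a, P a a = 1) {i j l a b c : Fin n}
    (hij : i < j) (hjl : j < l) (hM : d i a + d j b + d l c ≤ M) {e : ℕ} (he : e = 0)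
    (H0 : Rules X P u d M w e) (H1 : ∀ e f, Rules X P u d M (X e f w) (d e f)) :
    (coeffUp P u i a l c * coeffUp P u j b l c) • X l c (lowUp X P u i a j b w)
      - lowUp X P u i a j b (X l c w) + X i a (lowUp X P u j b l c w)
      - (coeffUp P u i a j b * coeffUp P u i a l c) • lowUp X P u j b l c (X i a w)
      - coeffUp P u i a j b • X j b (lowUp X P u i a l c w)
      + coeffUp P u j b l c • lowUp X P u i a l c (X j b w) = 0 := by
  have tri : ∀ x y, (x < y ∧ d j x + d i y < d i x + d j y ∧ d l x + d i y < d i x + d l y ∧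
      d l x + d j y < d j x + d l y) ∨ x = y ∨ (y < x ∧ d j y + d i x < d i y + d j x ∧
      d l y + d i x < d i y + d l x ∧ d l y + d j x < d j y + d l x) := by
    intro x y
    rcases lt_trichotomy x y with h | h | h
    · exact Or.inl ⟨h, hcross _ _ _ _ hij h, hcross _ _ _ _ (hij.trans hjl) h, hcross _ _ _ _ hjl h⟩
    · exact Or.inr (Or.inl h)
    · exact Or.inr (Or.inr
        ⟨h, hcross _ _ _ _ hij h, hcross _ _ _ _ (hij.trans hjl) h, hcross _ _ _ _ hjl h⟩)
  have pab := hP a b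
  have pac := hP a c
  have pbc := hP b c
  have pa := hP' a
  have pb := hP' b
  have pc := hP' c
  unfold coeffUp lowUp
  rcases tri a b with ⟨t1, t2, t3, t4⟩ | t1 | ⟨t1, t2, t3, t4⟩ <;>
    rcases tri b c with ⟨u1, u2, u3, u4⟩ | u1 | ⟨u1, u2, u3, u4⟩ <;>
    rcases tri a c with ⟨v1, v2, v3, v4⟩ | v1 | ⟨v1, v2, v3, v4⟩
  all_goals try (exfalso; omega)
  all_goals subst_vars
  all_goals
    simp (disch := omega) only [if_pos, if_neg, map_zero, smul_zero, lt_self_iff_false, if_false]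
    try simp (disch := omega) only [H0.diag, H0.anti,
      (H1 _ _).diag, (H1 _ _).anti, map_add, map_smul]
    first
    | module
    | (clear H0 H1 hcross tri hP hP'; match_scalars <;> grind)

theorem overlap_rows_left (hcross : ∀ a i b j, a < i → b < j → d i b + d a j < d a b + d i j)
    (hP : ∀ a b, P a b * P b a = 1) (hP' : ∀ a, P a a = 1) {i l a b c : Fin n}
    (hil : i < l) (hba : b < a) (hM : d i a + d i b + d l c ≤ M) {e : ℕ} (he : e = 0)
    (H0 : Rules X P u d M w e) (H1 : ∀ e f, Rules X P u d M (X e f w) (d e f)) :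
    X i a (lowUp X P u i b l c w)
      - (P a b * coeffUp P u i a l c) • lowUp X P u i b l c (X i a w)
      - P a b • X i b (lowUp X P u i a l c w)
      + coeffUp P u i b l c • lowUp X P u i a l c (X i b w) = 0 := by
  have c1 := hcross i l b a hil hba
  have tri : ∀ x y, (x < y ∧ d l x + d i y < d i x + d l y) ∨ x = y ∨
      (y < x ∧ d l y + d i x < d i y + d l x) := by
    intro x y
    rcases lt_trichotomy x y with h | h | h
    · exact Or.inl ⟨h, hcross _ _ _ _ hil h⟩
    · exact Or.inr (Or.inl h)
    · exact Or.inr (Or.inr ⟨h, hcross _ _ _ _ hil h⟩)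
  have pab := hP a b
  have pac := hP a c
  have pbc := hP b c
  have pa := hP' a
  have pb := hP' b
  have pc := hP' c
  unfold coeffUp lowUp
  rcases tri b c with ⟨u1, u2⟩ | u1 | ⟨u1, u2⟩ <;> rcases tri a c with ⟨v1, v2⟩ | v1 | ⟨v1, v2⟩
  all_goals try (exfalso; omega)
  all_goals subst_vars
  all_goals
    simp (disch := omega) only [if_pos, if_neg, map_zero, smul_zero, lt_self_iff_false, if_false]
    try simp (disch := omega) only [H0.row,
      (H1 _ _).diag, (H1 _ _).anti, map_smul]
    first
    | module
    | (clear H0 H1 hcross tri hP hP'; match_scalars <;> grind)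

theorem overlap_rows_right (hcross : ∀ a i b j, a < i → b < j → d i b + d a j < d a b + d i j)
    (hP : ∀ a b, P a b * P b a = 1) (hP' : ∀ a, P a a = 1) {i j a b c : Fin n}
    (hij : i < j) (hcb : c < b) (hM : d i a + d j b + d j c ≤ M) {e : ℕ} (he : e = 0)
    (H0 : Rules X P u d M w e) (H1 : ∀ e f, Rules X P u d M (X e f w) (d e f)) :
    (coeffUp P u i a j c * P b c) • X j c (lowUp X P u i a j b w)
      - lowUp X P u i a j b (X j c w)
      - coeffUp P u i a j b • X j b (lowUp X P u i a j c w)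
      + P b c • lowUp X P u i a j c (X j b w) = 0 := by
  have c1 := hcross i j c b hij hcb
  have tri : ∀ x y, (x < y ∧ d j x + d i y < d i x + d j y) ∨ x = y ∨
      (y < x ∧ d j y + d i x < d i y + d j x) := by
    intro x y
    rcases lt_trichotomy x y with h | h | h
    · exact Or.inl ⟨h, hcross _ _ _ _ hij h⟩
    · exact Or.inr (Or.inl h)
    · exact Or.inr (Or.inr ⟨h, hcross _ _ _ _ hij h⟩)
  have pab := hP a b
  have pac := hP a c
  have pbc := hP b c
  have pa := hP' a
  have pb := hP' b
  have pc := hP' c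
  unfold coeffUp lowUp
  rcases tri a b with ⟨u1, u2⟩ | u1 | ⟨u1, u2⟩ <;> rcases tri a c with ⟨v1, v2⟩ | v1 | ⟨v1, v2⟩
  all_goals try (exfalso; omega)
  all_goals subst_vars
  all_goals
    simp (disch := omega) only [if_pos, if_neg, map_zero, smul_zero, lt_self_iff_false, if_false]
    try simp (disch := omega) only [H0.diag, H0.anti,
      (H1 _ _).row, map_add, map_smul]
    first
    | module
    | (clear H0 H1 hcross tri hP hP'; match_scalars <;> grind)

end Rules

end QuantumMatrix

/-! ### The `T`-Lie algebra of quantum matrices with constant signs. -/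

namespace QuantumMatrix

open TLieData

variable {k V : Type*} [CommRing k] [AddCommGroup V] [Module k V] {n : ℕ}

/-- The positions in an `n × n` matrix. -/
@[ext]
structure Pos (n : ℕ) where
  row : Fin n
  col : Fin n

/-- The total order on the positions with decreasing rows and, in each row, increasing columns. -/
instance instLinearOrderPos : LinearOrder (Pos n) :=
  LinearOrder.lift' (fun x : Pos n => toLex (OrderDual.toDual x.row, x.col)) fun x y h => by
    have := toLex.injective h
    simp only [Prod.mk.injEq, OrderDual.toDual_inj] at this
    exact Pos.ext this.1 this.2

theorem pos_lt_iff {x y : Pos n} : x < y ↔ y.row < x.row ∨ (x.row = y.row ∧ x.col < y.col) := by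
  change toLex (OrderDual.toDual x.row, x.col) < toLex (OrderDual.toDual y.row, y.col) ↔ _
  rw [Prod.Lex.toLex_lt_toLex]
  simp

/-- The basis of the free module on the positions. -/
def basis (k : Type*) [CommRing k] (n : ℕ) : Module.Basis (Pos n) k (Pos n →₀ k) :=
  Finsupp.basisSingleOne

/-- The basis vector at the position `(i, a)`. -/
def gen (k : Type*) [CommRing k] {n : ℕ} (i a : Fin n) : Pos n →₀ k := basis k n ⟨i, a⟩

/-- The degree of a position. -/
def degree (x : Pos n) : ℕ := (x.row : ℕ) * x.col

/-- Again the rearrangement inequality; the degree needs no added constant, since the bracket is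
zero. -/
theorem degree_cross {a i b j : ℕ} (h1 : a < i) (h2 : b < j) :
    i * b + a * j < a * b + i * j := by
  nlinarith [Nat.mul_lt_mul_of_lt_of_le h1 h2.le]

/-- The pairs of positions on which the operations are prescribed. -/
def posLT (x y : Pos n) : Prop := x.row < y.row ∨ (x.row = y.row ∧ x.col < y.col)

instance instDecidableRelPosLT : DecidableRel (posLT (n := n)) := fun x y => by
  unfold posLT
  infer_instance

theorem posLT_asymm {x y : Pos n} (h : posLT x y) : ¬ posLT y x := by
  unfold posLT at *
  omega

/-- The structure constants for the pairs `posLT x y`. -/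
def unitCoeff (P : Fin n → Fin n → kˣ) (u : kˣ) (x y : Pos n) : kˣ :=
  if x.row < y.row then P y.row x.row * P x.col y.col * (if x.col < y.col then 1 else u) else P x.col y.col

/-- The pseudobracket for the pairs `posLT x y`. -/
def pseudoUp (P : Fin n → Fin n → kˣ) (u : kˣ) (x y : Pos n) : (Pos n →₀ k) ⊗[k] (Pos n →₀ k) :=
  if x.row < y.row ∧ x.col < y.col then
    (((u : k) - 1) * P y.row x.row) • (gen k y.row x.col ⊗ₜ gen k x.row y.col)
  else 0

/-- The `T`-Lie algebra whose enveloping algebra is the quantum matrix algebra with constant signs,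
where `P` is multiplicatively antisymmetric. -/
def tLie (P : Fin n → Fin n → kˣ) (u : kˣ) : TLieData k (Pos n →₀ k) where
  bracket := 0
  presym := ((basis k n).tensorProduct (basis k n)).constr k fun x =>
    antisymmCoeff posLT (unitCoeff P u) x.1 x.2 • (basis k n x.2 ⊗ₜ basis k n x.1)
  pseudo := ((basis k n).tensorProduct (basis k n)).constr k fun x =>
    antisymmExt posLT (unitCoeff P u) (pseudoUp P u) x.1 x.2

variable {P : Fin n → Fin n → kˣ} {u : kˣ}

theorem presym_basis (x y : Pos n) : (tLie P u).presym (basis k n x ⊗ₜ basis k n y) =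
    antisymmCoeff posLT (unitCoeff P u) x y • (basis k n y ⊗ₜ basis k n x) := by
  rw [← Module.Basis.tensorProduct_apply]
  exact Module.Basis.constr_basis _ _ _ _

theorem pseudo_basis (x y : Pos n) : (tLie P u).pseudo (basis k n x ⊗ₜ basis k n y) =
    antisymmExt posLT (unitCoeff P u) (pseudoUp P u) x y := by
  rw [← Module.Basis.tensorProduct_apply]
  exact Module.Basis.constr_basis _ _ _ _

theorem pseudoUp_mem (x y : Pos n) : pseudoUp P u x y ∈
    Submodule.span k {t | ∃ l m : Pos n, degree l + degree m < degree x + degree y ∧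
      t = basis k n l ⊗ₜ basis k n m} := by
  unfold pseudoUp
  split_ifs with h
  · exact Submodule.smul_mem _ _ (Submodule.subset_span
      ⟨⟨y.row, x.col⟩, ⟨x.row, y.col⟩, degree_cross h.1 h.2, rfl⟩)
  · exact Submodule.zero_mem _

theorem isQuadratic (P : Fin n → Fin n → kˣ) (u : kˣ) :
    (tLie P u).IsQuadratic (basis k n) degree (antisymmCoeff posLT (unitCoeff P u)) :=
  IsQuadratic.of_antisymm (B := 0) (fun _ _ => posLT_asymm) presym_basis pseudo_basis
    (fun x y => by simp [tLie, antisymmExt]) (fun x y _ => pseudoUp_mem x y)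
    (fun x y _ => Submodule.zero_mem _)

/-- The operator of the basis vector at the position `(i, a)`. -/
def op (act : (Pos n →₀ k) →ₗ[k] Module.End k V) (i a : Fin n) : Module.End k V :=
  act (gen k i a)

theorem act_basis (act : (Pos n →₀ k) →ₗ[k] Module.End k V) (x : Pos n) :
    act (basis k n x) = op act x.row x.col := rfl

theorem lowerOp_of_row_lt (act : (Pos n →₀ k) →ₗ[k] Module.End k V) {x y : Pos n}
    (h : x.row < y.row) (v : V) : (tLie P u).lowerOp (basis k n) act x y v =
      lowUp (op act) (fun a b => (P a b : k)) u x.row x.col y.row y.col v := by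
  have hr : posLT x y := Or.inl h
  rw [lowerOp, pseudo_basis, lowUp, antisymmExt, if_pos hr, pseudoUp]
  have hB : (tLie P u).bracket = 0 := rfl
  simp only [h, true_and, hB, LinearMap.zero_apply, map_zero, add_zero]
  split_ifs <;> simp [op]

theorem lowerOp_of_row_eq (act : (Pos n →₀ k) →ₗ[k] Module.End k V) {x y : Pos n}
    (h : x.row = y.row) : (tLie P u).lowerOp (basis k n) act x y = 0 := by
  have hB : (tLie P u).bracket = 0 := rfl
  have h1 : pseudoUp (k := k) P u x y = 0 := if_neg fun h2 => h2.1.ne h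
  have h2 : pseudoUp (k := k) P u y x = 0 := if_neg fun h2 => h2.1.ne h.symm
  rw [lowerOp, pseudo_basis, antisymmExt, hB, h1, h2]
  split_ifs <;> simp

theorem coeff_of_row_lt {x y : Pos n} (h : x.row < y.row) :
    antisymmCoeff posLT (unitCoeff P u) x y =
      coeffUp (fun a b => (P a b : k)) u x.row x.col y.row y.col := by
  have hr : posLT x y := Or.inl h
  rw [antisymmCoeff, if_pos hr, unitCoeff, if_pos h, coeffUp]
  split_ifs <;> simp

variable (hP : ∀ a b, P a b * P b a = 1)
include hP

theorem coeff_of_row_eq {x y : Pos n} (h : x.row = y.row) (h' : y.col < x.col) :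
    antisymmCoeff posLT (unitCoeff P u) x y = (P x.col y.col : k) := by
  have hr : posLT y x := Or.inr ⟨h.symm, h'⟩
  rw [antisymmCoeff, if_neg (posLT_asymm hr), if_pos hr, unitCoeff, if_neg (by omega),
    inv_eq_of_mul_eq_one_left (hP _ _)]

theorem Rules.of_straightens {act : (Pos n →₀ k) →ₗ[k] Module.End k V} {v : V} {M c : ℕ}
    (hv : ∀ x y : Pos n, degree x + degree y + c < M →
      (tLie P u).Straightens (basis k n) (antisymmCoeff posLT (unitCoeff P u)) act x y v) :
    Rules (op act) (fun a b => (P a b : k)) u (fun i a => (i : ℕ) * a) M v c where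
  diag i a j b hij hab hM := by
    have := hv ⟨i, a⟩ ⟨j, b⟩ hM
    rwa [Straightens, act_basis, act_basis, coeff_of_row_lt hij, lowerOp_of_row_lt act hij, coeffUp, lowUp, if_pos hab,
      if_pos hab] at this
  anti i a j b hij hba hM := by
    have := hv ⟨i, a⟩ ⟨j, b⟩ hM
    rwa [Straightens, act_basis, act_basis, coeff_of_row_lt hij, lowerOp_of_row_lt act hij, coeffUp, lowUp,
      if_neg hba.not_gt, if_neg hba.not_gt, add_zero] at this
  row i a b hba hM := by
    have := hv ⟨i, a⟩ ⟨i, b⟩ hM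
    rwa [Straightens, act_basis, act_basis, coeff_of_row_eq hP (x := ⟨i, a⟩) (y := ⟨i, b⟩) rfl hba,
      lowerOp_of_row_eq act (x := ⟨i, a⟩) (y := ⟨i, b⟩) rfl, LinearMap.zero_apply,
      add_zero] at this

theorem overlapsResolve (hP' : ∀ a, P a a = 1) : (tLie P u).OverlapsResolve (basis k n) degree
    (antisymmCoeff posLT (unitCoeff P u)) := by
  intro act hact x y z s hzy hyx hs hz hlow
  have hD := (isQuadratic P u).toIsDiagonal
  have hmem := IsDiagonal.word_mem_symLT (D := tLie P u) (b := basis k n) (deg := degree) hs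
    (Nat.lt_succ_self (s.map degree).sum)
  set w := (tLie P u).word (basis k n) s
  have H0 : Rules (op act) (fun a b => (P a b : k)) u
      (fun i a => (i : ℕ) * a) (degree x + degree y + degree z) w 0 :=
    Rules.of_straightens hP fun u v huv => hlow u v _ (by omega) w hmem
  have H1 : ∀ e f : Fin n, Rules (op act) (fun a b => (P a b : k)) u
      (fun i a => (i : ℕ) * a) (degree x + degree y + degree z) (op act e f w) (e * f) := by
    intro e f
    refine Rules.of_straightens hP fun u v huv => hlow u v _ ?_ _ (hact.act_mem hD ⟨e, f⟩ hmem)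
    change _ + _ + degree ⟨e, f⟩ < _ at huv
    omega
  have hcross : ∀ a i b j : Fin n, a < i → b < j → (i * b + a * j : ℕ) < a * b + i * j :=
    fun a i b j h1 h2 => degree_cross h1 h2
  have hk : ∀ a b, (P a b : k) * P b a = 1 := fun a b => by rw [← Units.val_mul, hP, Units.val_one]
  have hk' : ∀ a, (P a a : k) = 1 := fun a => by rw [hP', Units.val_one]
  unfold overlap
  simp only [act_basis]
  rcases pos_lt_iff.1 hyx with h1 | ⟨h1, h1'⟩ <;> rcases pos_lt_iff.1 hzy with h2 | ⟨h2, h2'⟩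
  · simp only [lowerOp_of_row_lt act h1, lowerOp_of_row_lt act h2,
      lowerOp_of_row_lt act (h1.trans h2), coeff_of_row_lt h1, coeff_of_row_lt h2,
      coeff_of_row_lt (h1.trans h2)]
    exact overlap_rows hcross hk hk' h1 h2 le_rfl rfl H0 H1
  · have h3 : x.row < z.row := h2 ▸ h1
    simp only [lowerOp_of_row_lt act h1, lowerOp_of_row_eq act h2.symm,
      lowerOp_of_row_lt act h3, coeff_of_row_lt h1, coeff_of_row_eq hP h2.symm h2',
      coeff_of_row_lt h3, LinearMap.zero_apply, map_zero, smul_zero, add_zero, sub_zero]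
    have := overlap_rows_right (a := x.col) hcross hk hk' h1 h2'
      (show _ ≤ degree x + degree y + degree z by unfold degree; rw [h2]) rfl H0 H1
    rw [← h2] at this ⊢
    exact this
  · have h3 : x.row < z.row := h1 ▸ h2
    simp only [lowerOp_of_row_eq act h1.symm, lowerOp_of_row_lt act h2,
      lowerOp_of_row_lt act h3, coeff_of_row_eq hP h1.symm h1', coeff_of_row_lt h2,
      coeff_of_row_lt h3, LinearMap.zero_apply, map_zero, smul_zero, zero_add, sub_zero]
    have := overlap_rows_left (c := z.col) hcross hk hk' h3 h1'
      (show _ ≤ degree x + degree y + degree z by unfold degree; rw [h1]) rfl H0 H1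
    rw [← h1] at this ⊢
    exact this
  · have h3 : x.row = z.row := (h2.trans h1).symm
    simp [lowerOp_of_row_eq act h1.symm, lowerOp_of_row_eq act h2.symm,
      lowerOp_of_row_eq act h3]

theorem isDomain_env [IsDomain k] (hP' : ∀ a, P a a = 1) : IsDomain (tLie P u).Env :=
  (isQuadratic P u).isDomain (overlapsResolve hP hP')

end QuantumMatrix

/-! ### Reduction of arbitrary signs to constant signs. -/

namespace QuantumMatrix

open TLieData

section Relations

variable {k A : Type*} [CommRing k] [Ring A] [Algebra k A] {n : ℕ}

/-- The relations of the quantum matrix algebra, for a total order `r` of the rows and columns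
with respect to which all signs are equal. -/
structure Relations (r : Fin n → Fin n → Prop) (P : Fin n → Fin n → kˣ) (u : kˣ)
    (z : Fin n → Fin n → A) : Prop where
  diag : ∀ i a j b, r i j → r a b → z i a * z j b =
    ((P j i : k) * P a b) • (z j b * z i a) + (((u : k) - 1) * P j i) • (z j a * z i b)
  anti : ∀ i a j b, r i j → ¬ r a b → z i a * z j b =
    ((P j i : k) * P a b * u) • (z j b * z i a)
  row : ∀ i a b, z i a * z i b = (P a b : k) • (z i b * z i a)

/-- The order with respect to which all signs become `1`. -/
def prec (ε : Fin n → Fin n → ℤˣ) (i j : Fin n) : Prop :=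
  (i < j ∧ ε i j = 1) ∨ (j < i ∧ ε j i = -1)

/-- The multiplicatively antisymmetric extension of `p`. -/
def antisymm (p : Fin n → Fin n → kˣ) (i j : Fin n) : kˣ :=
  if i < j then p i j else if j < i then (p j i)⁻¹ else 1

theorem antisymm_of_lt (p : Fin n → Fin n → kˣ) {i j : Fin n} (h : i < j) :
    antisymm p i j = p i j := if_pos h

theorem antisymm_of_gt (p : Fin n → Fin n → kˣ) {i j : Fin n} (h : j < i) :
    antisymm p i j = (p j i)⁻¹ := by
  rw [antisymm, if_neg h.not_gt, if_pos h]

theorem antisymm_self (p : Fin n → Fin n → kˣ) (i : Fin n) : antisymm p i i = 1 := by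
  simp [antisymm]

theorem antisymm_mul (p : Fin n → Fin n → kˣ) (i j : Fin n) :
    antisymm p i j * antisymm p j i = 1 := by
  rcases lt_trichotomy i j with h | rfl | h
  · simp [antisymm_of_lt p h, antisymm_of_gt p h]
  · simp [antisymm_self]
  · simp [antisymm_of_lt p h, antisymm_of_gt p h]

variable {p q : Fin n → Fin n → kˣ} {ε : Fin n → Fin n → ℤˣ} {u : kˣ}

theorem units_ne {x y : ℤˣ} : x ≠ y ↔ (x = 1 ∧ y = -1) ∨ (x = -1 ∧ y = 1) := by
  revert x y
  decide

namespace Admissible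

variable (h : Admissible p q ε u)
include h

theorem mul_eq_one {i j : Fin n} (hij : i < j) (hε : ε i j = 1) : (p i j : k) * q i j = u := by
  rw [← Units.val_mul, h.mul_eq i j hij, hε]
  simp

theorem mul_eq_neg {i j : Fin n} (hij : i < j) (hε : ε i j = -1) :
    (p i j : k) * q i j = (u⁻¹ : kˣ) := by
  rw [← Units.val_mul, h.mul_eq i j hij, hε]
  simp

/-- Transitivity on three indices, in whatever natural order they stand, is the admissibility
condition on the sorted triple or its contrapositive. -/
theorem isStrictTotalOrder : IsStrictTotalOrder (Fin n) (prec ε) where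
  irrefl i := by simp [prec]
  trichotomous i j h1 h2 := by
    unfold prec at h1 h2
    rcases lt_trichotomy i j with hij | hij | hij
    · rcases Int.units_eq_one_or (ε i j) with h3 | h3 <;> simp_all
    · exact hij
    · rcases Int.units_eq_one_or (ε j i) with h3 | h3 <;> simp_all
  trans i j l h1 h2 := by
    have hne : (1 : ℤˣ) ≠ -1 := by decide
    have ht := h.trans
    unfold prec at *
    rcases lt_trichotomy i l with h3 | h3 | h3
    · rcases Int.units_eq_one_or (ε i l) with h4 | h4 <;> grind
    · grind
    · rcases Int.units_eq_one_or (ε l i) with h4 | h4 <;> grind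

-- If `ε_ij = -1`, exchanging `i` and `j` replaces `p_ij`, `q_ij` by their inverses, whose product
-- is `u`, as for sign `1`. Eliminating the `q_ij` in this way brings all relations to the form for
-- constant signs.
set_option maxHeartbeats 1000000 in
theorem relations_of_rel {z : Fin n → Fin n → A}
    (hz : ∀ x y, Rel p q ε x y → FreeAlgebra.lift k (fun x : Fin n × Fin n => z x.1 x.2) x =
      FreeAlgebra.lift k (fun x : Fin n × Fin n => z x.1 x.2) y) :
    Relations (prec ε) (antisymm p) u z := by
  have hrow := fun i l m h => hz _ _ (Rel.row (k := k) i l m h)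
  have hcol := fun i j l h => hz _ _ (Rel.col (k := k) i j l h)
  have hae := fun i j l m h h' hε => hz _ _ (Rel.anti_eq (k := k) i j l m h h' hε)
  have hde := fun i j l m h h' hε => hz _ _ (Rel.diag_eq (k := k) i j l m h h' hε)
  have han := fun i j l m h h' hε => hz _ _ (Rel.anti_ne (k := k) i j l m h h' hε)
  have hdn := fun i j l m h h' hε => hz _ _ (Rel.diag_ne (k := k) i j l m h h' hε)
  simp only [Z, map_mul, map_smul, map_add, FreeAlgebra.lift_ι_apply, Units.val_mul] at hrow hcol hae hde han hdn
  have hu := u.mul_inv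
  have hne : (1 : ℤˣ) ≠ -1 := by decide
  constructor
  · rintro i a j b (⟨hij, h1⟩ | ⟨hij, h1⟩) (⟨hab, h2⟩ | ⟨hab, h2⟩)
    · have e1 := h.mul_eq_one hij h1
      have e2 := h.mul_eq_one hab h2
      have i1 := (p i j).mul_inv
      have i2 := (p a b).mul_inv
      have i3 := (q a b).mul_inv
      rw [hde i j a b hij hab (h1.trans h2.symm), antisymm_of_gt p hij, antisymm_of_lt p hab]
      match_scalars <;> grind
    · have e1 := h.mul_eq_one hij h1
      have i1 := (p i j).mul_inv
      rw [han i j b a hij hab (by simp [h1, h2]), antisymm_of_gt p hij, antisymm_of_gt p hab]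
      match_scalars <;> grind
    · have e1 := h.mul_eq_neg hij h1
      have i1 := (p j i).mul_inv
      have i2 := (p a b).mul_inv
      -- The rows are reversed, so both products on the right of the goal are left-hand sides of
      -- given relations; rewriting them leaves only `z_i^a z_j^b` and `z_i^b z_j^a`.
      rw [han j i a b hij hab (by simp [h1, h2]), hdn j i a b hij hab (by simp [h1, h2]),
        antisymm_of_lt p hij, antisymm_of_lt p hab]
      have e2 := h.mul_eq_one hab h2
      have i3 := (q a b).mul_inv
      match_scalars <;> grind
    · have e1 := h.mul_eq_neg hij h1
      have e2 := h.mul_eq_neg hab h2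
      have i1 := (p j i).mul_inv
      have i2 := (p b a).mul_inv
      have i3 := (q b a).mul_inv
      rw [hde j i b a hij hab (h1.trans h2.symm), hae j i b a hij hab (h1.trans h2.symm),
        antisymm_of_lt p hij, antisymm_of_gt p hab]
      match_scalars <;> grind
  · intro i a j b hij hab
    rcases lt_trichotomy a b with hlt | rfl | hlt
    · have h2 : ε a b = -1 := by
        rcases Int.units_eq_one_or (ε a b) with h2 | h2
        · exact absurd (Or.inl ⟨hlt, h2⟩) hab
        · exact h2
      have e2 := h.mul_eq_neg hlt h2
      have i2 := (p a b).mul_inv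
      have i3 := (q a b).mul_inv
      rcases hij with ⟨hij, h1⟩ | ⟨hij, h1⟩
      · have e1 := h.mul_eq_one hij h1
        have i1 := (p i j).mul_inv
        rw [hdn i j a b hij hlt (by simp [h1, h2]), antisymm_of_gt p hij, antisymm_of_lt p hlt]
        match_scalars
        grind
      · have e1 := h.mul_eq_neg hij h1
        have i1 := (p j i).mul_inv
        rw [hae j i a b hij hlt (by simp [h1, h2]), antisymm_of_lt p hij, antisymm_of_lt p hlt]
        match_scalars
        grind
    · rw [antisymm_self]
      rcases hij with ⟨hij, h1⟩ | ⟨hij, h1⟩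
      · have e1 := h.mul_eq_one hij h1
        have i1 := (p i j).mul_inv
        rw [hcol i j a hij, antisymm_of_gt p hij]
        match_scalars
        grind
      · have e1 := h.mul_eq_neg hij h1
        have i1 := (p j i).mul_inv
        rw [hcol j i a hij, antisymm_of_lt p hij]
        match_scalars
        grind
    · have h2 : ε b a = 1 := by
        rcases Int.units_eq_one_or (ε b a) with h2 | h2
        · exact h2
        · exact absurd (Or.inr ⟨hlt, h2⟩) hab
      have e2 := h.mul_eq_one hlt h2
      have i2 := (p b a).mul_inv
      have i3 := (q b a).mul_inv
      rcases hij with ⟨hij, h1⟩ | ⟨hij, h1⟩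
      · have e1 := h.mul_eq_one hij h1
        have i1 := (p i j).mul_inv
        rw [hae i j b a hij hlt (by simp [h1, h2]), antisymm_of_gt p hij, antisymm_of_gt p hlt]
        match_scalars
        grind
      · have e1 := h.mul_eq_neg hij h1
        have i1 := (p j i).mul_inv
        rw [hdn j i b a hij hlt (by simp [h1, h2]), antisymm_of_lt p hij, antisymm_of_gt p hlt]
        match_scalars
        grind
  · intro i a b
    rcases lt_trichotomy a b with hlt | rfl | hlt
    · rw [hrow i a b hlt, antisymm_of_lt p hlt]
    · rw [antisymm_self, Units.val_one, one_smul]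
    · have i2 := (p b a).mul_inv
      rw [hrow i b a hlt, antisymm_of_gt p hlt]
      match_scalars
      grind

-- The converse translation; together the two show that both lists of relations present the same
-- algebra.
set_option maxHeartbeats 1000000 in
theorem rel_of_relations {z : Fin n → Fin n → A} (hz : Relations (prec ε) (antisymm p) u z)
    ⦃x y : FreeAlgebra k (Fin n × Fin n)⦄ (hxy : Rel p q ε x y) :
    FreeAlgebra.lift k (fun x : Fin n × Fin n => z x.1 x.2) x =
      FreeAlgebra.lift k (fun x : Fin n × Fin n => z x.1 x.2) y := by
  have hu := u.mul_inv
  have hasymm : ∀ {i j}, prec ε i j → ¬ prec ε j i := fun h1 h2 =>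
    h.isStrictTotalOrder.irrefl _ (h.isStrictTotalOrder.trans _ _ _ h1 h2)
  have pos : ∀ {i j}, i < j → ε i j = 1 → prec ε i j := fun h1 h2 => Or.inl ⟨h1, h2⟩
  have neg : ∀ {i j}, i < j → ε i j = -1 → prec ε j i := fun h1 h2 => Or.inr ⟨h1, h2⟩
  cases hxy with
  | row i l m hlm =>
    simp only [Z, map_mul, map_smul, FreeAlgebra.lift_ι_apply]
    rw [hz.row, antisymm_of_lt p hlm]
  | col i j l hij =>
    simp only [Z, map_mul, map_smul, FreeAlgebra.lift_ι_apply]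
    have i1 := (p i j).mul_inv
    have i2 := (q i j).mul_inv
    rcases Int.units_eq_one_or (ε i j) with h1 | h1
    · have e1 := h.mul_eq_one hij h1
      rw [hz.anti i l j l (pos hij h1) (h.isStrictTotalOrder.irrefl l), antisymm_self,
        antisymm_of_gt p hij]
      match_scalars
      grind
    · have e1 := h.mul_eq_neg hij h1
      rw [hz.anti j l i l (neg hij h1) (h.isStrictTotalOrder.irrefl l), antisymm_self,
        antisymm_of_lt p hij]
      match_scalars
      grind
  | anti_eq i j l m hij hlm hε =>
    simp only [Z, map_mul, map_smul, FreeAlgebra.lift_ι_apply, Units.val_mul]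
    have i1 := (p i j).mul_inv
    have i2 := (p l m).mul_inv
    rcases Int.units_eq_one_or (ε i j) with h1 | h1
    · have h2 := hε.symm.trans h1
      have e1 := h.mul_eq_one hij h1
      have e2 := h.mul_eq_one hlm h2
      rw [hz.anti i m j l (pos hij h1) (hasymm (pos hlm h2)), antisymm_of_gt p hij,
        antisymm_of_gt p hlm]
      match_scalars
      grind
    · have h2 := hε.symm.trans h1
      have e1 := h.mul_eq_neg hij h1
      have e2 := h.mul_eq_neg hlm h2
      rw [hz.anti j l i m (neg hij h1) (hasymm (neg hlm h2)), antisymm_of_lt p hij,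
        antisymm_of_lt p hlm]
      match_scalars
      grind
  | diag_eq i j l m hij hlm hε =>
    simp only [Z, map_mul, map_smul, map_add, FreeAlgebra.lift_ι_apply, Units.val_mul]
    have i1 := (p i j).mul_inv
    have i2 := (p l m).mul_inv
    have i3 := (q l m).mul_inv
    rcases Int.units_eq_one_or (ε i j) with h1 | h1
    · have h2 := hε.symm.trans h1
      have e1 := h.mul_eq_one hij h1
      have e2 := h.mul_eq_one hlm h2
      rw [hz.diag i l j m (pos hij h1) (pos hlm h2), antisymm_of_gt p hij, antisymm_of_lt p hlm]
      match_scalars <;> grind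
    · have h2 := hε.symm.trans h1
      have e1 := h.mul_eq_neg hij h1
      have e2 := h.mul_eq_neg hlm h2
      rw [hz.diag j m i l (neg hij h1) (neg hlm h2),
        hz.anti j l i m (neg hij h1) (hasymm (neg hlm h2)), antisymm_of_lt p hij,
        antisymm_of_lt p hlm, antisymm_of_gt p hlm]
      match_scalars <;> grind
  | diag_ne i j l m hij hlm hε =>
    simp only [Z, map_mul, map_smul, FreeAlgebra.lift_ι_apply, Units.val_mul]
    have i1 := (p i j).mul_inv
    have i2 := (p l m).mul_inv
    have i3 := (q l m).mul_inv
    rcases units_ne.1 hε with ⟨h1, h2⟩ | ⟨h1, h2⟩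
    · have e1 := h.mul_eq_one hij h1
      have e2 := h.mul_eq_neg hlm h2
      rw [hz.anti i l j m (pos hij h1) (hasymm (neg hlm h2)), antisymm_of_gt p hij,
        antisymm_of_lt p hlm]
      match_scalars
      grind
    · have e1 := h.mul_eq_neg hij h1
      have e2 := h.mul_eq_one hlm h2
      rw [hz.anti j m i l (neg hij h1) (hasymm (pos hlm h2)), antisymm_of_lt p hij,
        antisymm_of_gt p hlm]
      match_scalars
      grind
  | anti_ne i j l m hij hlm hε =>
    simp only [Z, map_mul, map_smul, map_add, FreeAlgebra.lift_ι_apply, Units.val_mul]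
    have i1 := (p i j).mul_inv
    have i2 := (p l m).mul_inv
    have i3 := (q l m).mul_inv
    rcases units_ne.1 hε with ⟨h1, h2⟩ | ⟨h1, h2⟩
    · have e1 := h.mul_eq_one hij h1
      have e2 := h.mul_eq_neg hlm h2
      rw [hz.diag i m j l (pos hij h1) (neg hlm h2), antisymm_of_gt p hij, antisymm_of_gt p hlm]
      match_scalars <;> grind
    · have e1 := h.mul_eq_neg hij h1
      have e2 := h.mul_eq_one hlm h2
      rw [hz.diag j l i m (neg hij h1) (pos hlm h2),
        hz.anti j m i l (neg hij h1) (hasymm (pos hlm h2)), antisymm_of_lt p hij,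
        antisymm_of_gt p hlm, antisymm_of_lt p hlm]
      match_scalars <;> grind

end Admissible

end Relations

end QuantumMatrix

/-! ### Checking the defining relations of `U(L)`. -/

namespace TLieData

variable {k L ι A : Type*} [CommRing k] [AddCommGroup L] [Module k L] [Ring A] [Algebra k A]
variable {D : TLieData k L} {b : Module.Basis ι k L}

/-- The defining relations of `U(L)` hold in the regular representation. -/
theorem straightens_mul {q : ι → ι → k}
    (hS : ∀ i j, D.presym (b i ⊗ₜ b j) = q i j • (b j ⊗ₜ b i)) (i j : ι) (w : D.Env) :
    D.Straightens b q ((Algebra.lmul k D.Env).toLinearMap ∘ₗ D.envι) i j w := by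
  have key : ∀ t, two ((Algebra.lmul k D.Env).toLinearMap ∘ₗ D.envι) t w = two D.envι t * w :=
    fun t => (LinearMap.congr_fun (two_comp D.envι (Algebra.lmul k D.Env) t) w).symm
  rw [Straightens, lowerOp, LinearMap.add_apply, key]
  have := congrArg (· * w) (D.envι_mul (b i) (b j))
  simp only [hS, map_smul, two_tmul, add_mul, smul_mul_assoc, mul_assoc] at this
  simpa [add_assoc] using this

/-- For operations extended by antisymmetry, it is enough to test the relations on the pairs on
which the operations are prescribed. -/
theorem relation_of_antisymm {r : ι → ι → Prop} [DecidableRel r] {c : ι → ι → kˣ}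
    (htri : ∀ x y, r x y ∨ x = y ∨ r y x) (hr : ∀ x y, r x y → ¬ r y x) {P : ι → ι → L ⊗[k] L}
    (hS : ∀ x y, D.presym (b x ⊗ₜ b y) = antisymmCoeff r c x y • (b y ⊗ₜ b x))
    (hP : ∀ x y, D.pseudo (b x ⊗ₜ b y) = antisymmExt r c P x y)
    (hB : D.bracket = 0) {f : L →ₗ[k] A}
    (hf : ∀ x y, r x y → f (b x) * f (b y) = (c x y : k) • (f (b y) * f (b x)) + two f (P x y))
    (x y : ι) : f (b x) * f (b y) = two f (D.presym (b x ⊗ₜ b y))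
      + two f (D.pseudo (b x ⊗ₜ b y)) + f (D.bracket (b x ⊗ₜ b y)) := by
  rw [hS, hP, hB, LinearMap.zero_apply, map_zero, add_zero, map_smul, two_tmul, antisymmCoeff,
    antisymmExt]
  rcases htri x y with h | rfl | h
  · rw [if_pos h, if_pos h, hf x y h]
  · have h : ¬ r x x := fun h => hr x x h h
    simp [h]
  · rw [if_neg (hr y x h), if_neg (hr y x h), if_pos h, if_pos h, hf y x h, map_neg, map_smul,
      smul_add, smul_smul, Units.inv_mul, one_smul]
    abel

end TLieData

/-! ### Comparison of the quantum matrix algebra with an enveloping algebra. -/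

namespace QuantumMatrix

open TLieData

section Iso

variable {k A : Type*} [CommRing k] [Ring A] [Algebra k A] {n : ℕ}
variable {P : Fin n → Fin n → kˣ} {u : kˣ}

/-- The rules hold in any module where the relations do; here it is `U(L)` acting on itself by left
multiplication, evaluated at `1`. All relations hold there, so the degree bound `M` can be taken as
large as needed. -/
theorem relations_env (hP : ∀ a b, P a b * P b a = 1) (hP' : ∀ a, P a a = 1) :
    Relations (· < ·) P u fun i a => (tLie P u).envι (gen k i a) := by
  have H : ∀ M, Rules _ _ (u : k) _ M (1 : (tLie P u).Env) 0 := fun M =>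
    Rules.of_straightens hP fun x y _ => straightens_mul presym_basis x y 1
  have hrow : ∀ i a b, b < a → (tLie P u).envι (gen k i a) * (tLie P u).envι (gen k i b) =
      (P a b : k) • ((tLie P u).envι (gen k i b) * (tLie P u).envι (gen k i a)) := by
    intro i a b h
    simpa [op] using (H _).row i a b h (Nat.lt_succ_self _)
  refine ⟨fun i a j b hij hab => ?_, fun i a j b hij hab => ?_, fun i a b => ?_⟩
  · simpa [op] using (H _).diag i a j b hij hab (Nat.lt_succ_self _)
  · simpa [op] using (H _).anti i a j b hij (not_lt.1 hab) (Nat.lt_succ_self _)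
  · rcases lt_trichotomy a b with h | rfl | h
    · rw [hrow i b a h, smul_smul, ← Units.val_mul, hP, Units.val_one, one_smul]
    · rw [hP', Units.val_one, one_smul]
    · exact hrow i a b h

/-- The homomorphism from the enveloping algebra given by elements satisfying the relations. -/
def envLift {z : Fin n → Fin n → A} (hz : Relations (· < ·) P u z) : (tLie P u).Env →ₐ[k] A :=
  (tLie P u).liftEnv (basis k n) ((basis k n).constr k fun x => z x.row x.col)
    (relation_of_antisymm (r := posLT) (fun x y => by
        rw [Pos.ext_iff]
        unfold posLT
        omega) (fun _ _ => posLT_asymm) presym_basis pseudo_basis rfl (by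
      intro x y h
      simp only [Module.Basis.constr_basis]
      rw [unitCoeff, pseudoUp]
      by_cases h1 : x.row < y.row
      · by_cases h2 : x.col < y.col
        · rw [hz.diag _ _ _ _ h1 h2]
          simp [h1, h2, gen]
        · rw [hz.anti _ _ _ _ h1 h2]
          simp [h1, h2, mul_assoc]
      · obtain ⟨h2, h3⟩ := h.resolve_left h1
        rw [h2, hz.row]
        simp))

theorem envLift_gen {z : Fin n → Fin n → A} (hz : Relations (· < ·) P u z) (i a : Fin n) :
    envLift hz ((tLie P u).envι (gen k i a)) = z i a := by
  rw [envLift, liftEnv_envι, gen, Module.Basis.constr_basis]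

theorem Relations.reindex {r s : Fin n → Fin n → Prop} {z : Fin n → Fin n → A}
    (hz : Relations s P u z) (σ : Fin n → Fin n) (hσ : ∀ i j, r i j ↔ s (σ i) (σ j)) :
    Relations r (fun i j => P (σ i) (σ j)) u fun i j => z (σ i) (σ j) where
  diag _ _ _ _ hij hab := hz.diag _ _ _ _ ((hσ _ _).1 hij) ((hσ _ _).1 hab)
  anti _ _ _ _ hij hab := hz.anti _ _ _ _ ((hσ _ _).1 hij) fun h => hab ((hσ _ _).2 h)
  row _ _ _ := hz.row _ _ _

variable {p q : Fin n → Fin n → kˣ} {ε : Fin n → Fin n → ℤˣ}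

theorem exists_perm (r : Fin n → Fin n → Prop) (hr : IsStrictTotalOrder (Fin n) r) :
    ∃ σ : Equiv.Perm (Fin n), ∀ i j, r (σ i) (σ j) ↔ i < j := by
  classical
  let o := linearOrderOfSTO r
  let τ := @Fintype.orderIsoFinOfCardEq (Fin n) o _ n (Fintype.card_fin n)
  exact ⟨τ.toEquiv, fun i j => @OrderIso.lt_iff_lt _ _ _ o.toPreorder τ i j⟩

/-- After sorting the indices by `prec`, the relations become those of `tLie`. Injectivity of the
map to that enveloping algebra is enough, so only one composite has to be checked on generators. -/
theorem isDomain_alg [IsDomain k] (h : Admissible p q ε u) : IsDomain (Alg p q ε) := by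
  obtain ⟨σ, hσ⟩ := exists_perm (prec ε) h.isStrictTotalOrder
  let P' : Fin n → Fin n → kˣ := fun i j => antisymm p (σ i) (σ j)
  have hP : ∀ a b, P' a b * P' b a = 1 := fun a b => antisymm_mul p _ _
  have hP' : ∀ a, P' a a = 1 := fun a => antisymm_self p _
  have : IsDomain (tLie P' u).Env := isDomain_env hP hP'
  let mk : FreeAlgebra k (Fin n × Fin n) →ₐ[k] Alg p q ε := RingQuot.mkAlgHom k (Rel p q ε)
  have hmk : FreeAlgebra.lift k (fun x : Fin n × Fin n => mk (Z k x.1 x.2)) = mk :=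
    FreeAlgebra.hom_ext (funext fun x => FreeAlgebra.lift_ι_apply _ _)
  have h1 : Relations (prec ε) (antisymm p) u fun i j => mk (Z k i j) :=
    h.relations_of_rel fun x y hxy => by
      rw [hmk]
      exact RingQuot.mkAlgHom_rel k hxy
  let g : (tLie P' u).Env →ₐ[k] Alg p q ε := envLift (h1.reindex σ fun i j => (hσ i j).symm)
  have h2 : Relations (prec ε) (antisymm p) u
      fun i a => (tLie P' u).envι (gen k (σ.symm i) (σ.symm a)) := by
    have := (relations_env (u := u) hP hP').reindex (r := prec ε) σ.symm fun i j => by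
      rw [← hσ, σ.apply_symm_apply, σ.apply_symm_apply]
    simpa only [P', Equiv.apply_symm_apply] using this
  let f : Alg p q ε →ₐ[k] (tLie P' u).Env :=
    RingQuot.liftAlgHom k ⟨FreeAlgebra.lift k
      fun x => (tLie P' u).envι (gen k (σ.symm x.1) (σ.symm x.2)), h.rel_of_relations h2⟩
  have hgf : g.comp f = AlgHom.id k _ := by
    refine RingQuot.ringQuot_ext' k _ _ (FreeAlgebra.hom_ext (funext fun x => ?_))
    change g (f (mk (Z k x.1 x.2))) = mk (Z k x.1 x.2)
    have hf : f (mk (Z k x.1 x.2)) = (tLie P' u).envι (gen k (σ.symm x.1) (σ.symm x.2)) :=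
      (RingQuot.liftAlgHom_mkAlgHom_apply _ _ _ _).trans (FreeAlgebra.lift_ι_apply _ _)
    rw [hf]
    refine (envLift_gen _ _ _).trans ?_
    simp only [Equiv.apply_symm_apply]
  have hinj : Function.Injective f :=
    Function.LeftInverse.injective (g := g) fun x => AlgHom.congr_fun hgf x
  exact hinj.isDomain f.toRingHom

end Iso

end QuantumMatrix

end

theorem mainTheorem4 :
    (∀ {k L ι : Type*} [CommRing k] [AddCommGroup L] [Module k L] [LinearOrder ι]
      (D : TLieData k L) (gr : ℕ → Submodule k L) (b : Module.Basis ι k L) (deg : ι → ℕ)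
      (q : ι → ι → k), D.IsBasic gr b deg q → D.IsAdequate b deg q →
      ∃ ω : D.QSym ≃ₐ[k] D.GrEnv gr, ∀ (m : ℕ) (x : L) (hx : x ∈ gr m),
        ω (D.abelian.envι x) =
          DirectSum.of (D.envFil gr).Gr m ((D.envFil gr).cls (D.envι x) (D.envι_mem gr m x hx))) ∧
    (∀ {k L ι : Type*} [CommRing k] [IsDomain k] [AddCommGroup L] [Module k L] [LinearOrder ι]
      (D : TLieData k L) (gr : ℕ → Submodule k L) (b : Module.Basis ι k L) (deg : ι → ℕ)
      (q : ι → ι → k), D.IsBasic gr b deg q → D.IsAdequate b deg q → IsDomain D.Env) ∧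
    (∀ {k : Type*} [CommRing k] [IsDomain k] (q : kˣ) (n : ℕ),
      IsDomain (SlPlus.slPlus q n).Env) ∧
    (∀ {k : Type*} [CommRing k] [IsDomain k] (n : ℕ) (p q : Fin n → Fin n → kˣ)
      (ε : Fin n → Fin n → ℤˣ) (u : kˣ), QuantumMatrix.Admissible p q ε u →
      IsDomain (QuantumMatrix.Alg p q ε)) :=
  ⟨fun _ _ _ _ _ h ha => h.isQuadratic.exists_equiv (h.overlapsResolve ha) h.gr_eq,
    fun _ _ _ _ _ h ha => h.isQuadratic.isDomain (h.overlapsResolve ha),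
    fun q n => SlPlus.isDomain_env q n,
    fun _ _ _ _ _ h => QuantumMatrix.isDomain_alg h⟩
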